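/- **Setting.** Let $\mathcal X$ be a real Hilbert space (identified with its dual) and $\mathcal Y_1,\dots,\mathcal Y_N$ real uniformly smooth Banach spaces. Consider the system $F_i(x)=y_i$, $i=1,\dots,N$, with $F_i:\mathrm{dom}(F_i)\subset\mathcal X\to\mathcal Y_i$ and $\mathcal D:=\bigcap_i\mathrm{dom}(F_i)$. For $\Theta:\mathcal X\to(-\infty,\infty]$ put $\mathrm{dom}(\Theta)=\{\Theta<\infty\}$, $\partial\Theta(x)=\{\xi:\Theta(z)\ge\Theta(x)+\langle\xi,z-x\rangle\ \forall z\}$ and, for $x\in\mathrm{dom}(\Theta)$ and $\xi\in\partial\Theta(x)$, let $D_\xi\Theta(z,x)=\Theta(z)-\Theta(x)-\langle\xi,z-x\rangle$ be the Bregman distance. Let $x_0\in\mathrm{dom}(\Theta)$, $\xi_0\in\partial\Theta(x_0)$, and let $B_{2\rho}(x_0)$ be the closed ball of radius $2\rho$ about $x_0$. Assume: 1. $\Theta$ is proper, lower semicontinuous and strongly convex (that is, for some $\kappa>0$, $\Theta(tx+(1-t)z)+\kappa t(1-t)\|x-z\|^2\le t\Theta(x)+(1-t)\Theta(z)$ for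 all $x,z\in\mathcal X$, $t\in[0,1]$), and $\sigma>0$ is such that $D_\xi\Theta(z,x)\ge\sigma\|z-x\|^2$ for all $z\in\mathcal X$, $x\in\mathrm{dom}(\Theta)$, $\xi\in\partial\Theta(x)$. 2. $\rho>0$, $B_{2\rho}(x_0)\subset\mathcal D$, and the system has a solution $\hat x\in\mathrm{dom}(\Theta)$ with $D_{\xi_0}\Theta(\hat x,x_0)\le\sigma\rho^2$. 3. For $x\in B_{2\rho}(x_0)$ there are bounded linear operators $L_i(x):\mathcal X\to\mathcal Y_i$, continuous in $x$ on $B_{2\rho}(x_0)$ in operator norm, with $\|L_i(x)\|\le B_0$ for some constant $B_0>0$, and there is $0\le\eta<1$ with $\|F_i(x)-F_i(\bar x)-L_i(x)(x-\bar x)\|\le\eta\|F_i(x)-F_i(\bar x)\|$ for all $x,\bar x\in B_{2\rho}(x_0)$ and all $i$. **Method.** Let $1<r<\infty$, $\mu_1,\upsilon_0,\upsilon_1>0$, $0<\mu_0<4\sigma$, $0\le\beta<1$ and $\tau>(1+\eta)/(1-\eta)$. Let $i_0,i_1,\dots$ be independent random variables, uniformly distributed on $\{1,\dots,N\}$, on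 a probability space $(\Omega,\mathbb P)$. Let $J_r^{\mathcal Y}(v)$ be the unique $\varphi\in\mathcal Y^*$ with $\|\varphi\|=\|v\|^{r-1}$ and $\langle\varphi,v\rangle=\|v\|^r$. Given noisy data $y^\delta=(y_i^\delta)$ with noise levels $\delta_i>0$, put $\xi_{-1}=\xi_0$, $\tilde\gamma_0=0$, $I_0=\{1,\dots,N\}$, and for $n\ge0$, writing $i=i_n$, $$\mathfrak r_n=F_i(x_n)-y_i^\delta,\qquad \mathfrak g_n=L_i(x_n)^*J_r^{\mathcal Y_i}(\mathfrak r_n),\qquad \mathfrak m_n=\xi_n-\xi_{n-1},$$ $$t_n=\min\Big\{\tfrac{\mu_0((1-\eta)\|\mathfrak r_n\|-(1+\eta)\delta_i)\|\mathfrak r_n\|^{r-1}}{\|\mathfrak g_n\|^2},\ \mu_1\|\mathfrak r_n\|^{2-r}\Big\}\ \text{ if }\|\mathfrak r_n\|>\tau\delta_i,\qquad t_n=0\ \text{ otherwise},$$ $$\beta_n=\min\Big\{\tfrac{t_n\langle\mathfrak g_n,\mathfrak m_n\rangle-2\sigma\tilde\gamma_n}{\|\mathfrak m_n\|^2},\ \beta\Big\}\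 \text{ if }\|\mathfrak m_n\|>\upsilon_0\delta_i\text{ and }\tilde\gamma_n-\tfrac{t_n}{2\sigma}\langle\mathfrak g_n,\mathfrak m_n\rangle<-\upsilon_1\delta_i\|\mathfrak m_n\|^2,\qquad \beta_n=0\ \text{ otherwise},$$ $$\xi_{n+1}=\xi_n-t_n\mathfrak g_n+\beta_n\mathfrak m_n,\qquad x_{n+1}=\arg\min_{x\in\mathcal X}\{\Theta(x)-\langle\xi_{n+1},x\rangle\},$$ $$\tilde\gamma_{n+1}=\langle\mathfrak m_{n+1},x_{n+1}-x_n\rangle-(1-\eta)t_n\|\mathfrak r_n\|^r+(1+\eta)\delta_it_n\|\mathfrak r_n\|^{r-1}+\beta_n\tilde\gamma_n,$$ and $I_{n+1}=I_n\setminus\{i\}$ if $t_n=\beta_n=0$, $I_{n+1}=\{1,\dots,N\}$ otherwise. The stopping index is the first $n$ with $I_n=\emptyset$. **Theorem.** Let $y^{(l)}=(y^{(l)}_1,\dots,y^{(l)}_N)$, $l\in\mathbb N$, be noisy data with $\|y_i^{(l)}-y_i\|\le\delta_i^{(l)}$, $\delta_i^{(l)}>0$ and $\delta^{(l)}:=\max_i\delta_i^{(l)}\to0$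 as $l\to\infty$. Run the method for every $l$ along the same random indices $(i_n)$, let $n_l$ be its stopping index, and let $x^{\delta^{(l)}}_{n_l}$, $\xi^{\delta^{(l)}}_{n_l}$ be the stopped iterates. Then almost surely $n_l<\infty$ for all $l$, and there is a random element $x_*$ of $\mathcal X$ with values in the set of solutions of the system in $B_{2\rho}(x_0)\cap\mathrm{dom}(\Theta)$ such that, as $l\to\infty$, $$\|x^{\delta^{(l)}}_{n_l}-x_*\|\to0\quad\text{and}\quad D_{\xi^{\delta^{(l)}}_{n_l}}\Theta\big(x_*,x^{\delta^{(l)}}_{n_l}\big)\to0\quad\text{almost surely},$$ $$\mathbb E\Big[\|x^{\delta^{(l)}}_{n_l}-x_*\|^2\Big]\to0\quad\text{and}\quad\mathbb E\Big[D_{\xi^{\delta^{(l)}}_{n_l}}\Theta\big(x_*,x^{\delta^{(l)}}_{n_l}\big)\Big]\to0,$$ all these expectations being finite. Moreover, there is a unique solution $x^\dagger\in\mathrm{dom}(\Theta)$ of the system that minimizes $D_{\xi_0}\Theta(\cdot,x_0)$ among all solutions in $\mathcal D\cap\mathrm{dom}(\Theta)$; and if $\mathrm{Ran}(L_i(x)^*)\subset\overline{\mathrm{Ran}(L_i(x^\dagger)^*)}$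 for all $x\in B_{2\rho}(x_0)$ and all $i$, then $x_*=x^\dagger$ almost surely. -/

import Mathlib

open MeasureTheory ProbabilityTheory Filter Topology

namespace HeavyBall

noncomputable section

/-! ### Convex analysis for functions with values in `(-∞, ∞]` -/

/-- The effective domain of an extended real valued function. -/
def effDom {X : Type*} (f : X → EReal) : Set X := {x | f x < ⊤}

/-- A proper function never takes the value `-∞` and is somewhere finite. -/
def IsProper {X : Type*} (f : X → EReal) : Prop :=
  (∀ x, f x ≠ ⊥) ∧ (effDom f).Nonempty

section Hilbert

variable {X : Type*} [NormedAddCommGroup X] [InnerProductSpace ℝ X]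

/-- The subdifferential of `f` at `x`; the dual of the Hilbert space is identified with the space.
For a proper `f` it is empty outside of the effective domain. -/
def subdiff (f : X → EReal) (x : X) : Set X :=
  {ξ | ∀ z, f x + ((inner ℝ ξ (z - x) : ℝ) : EReal) ≤ f z}

/-- The Bregman distance `D_ξ f (z, x) = f z - f x - ⟨ξ, z - x⟩`. It may take the value `∞`. -/
def bregman (f : X → EReal) (ξ z x : X) : EReal :=
  f z - f x - ((inner ℝ ξ (z - x) : ℝ) : EReal)

/-- Strong convexity with constant `κ` (`κ t (1 - t) ‖x - z‖²`, without a factor `1 / 2`). -/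
def StronglyConvexWith (f : X → EReal) (κ : ℝ) : Prop :=
  ∀ x z : X, ∀ t : ℝ, 0 ≤ t → t ≤ 1 →
    f (t • x + (1 - t) • z) + ((κ * t * (1 - t) * ‖x - z‖ ^ 2 : ℝ) : EReal)
      ≤ (t : EReal) * f x + ((1 - t : ℝ) : EReal) * f z

/-- The set of minimizers of `z ↦ f z - ⟨ξ, z⟩`. -/
def minimizers (f : X → EReal) (ξ : X) : Set X :=
  {x | ∀ z, f x - ((inner ℝ ξ x : ℝ) : EReal) ≤ f z - ((inner ℝ ξ z : ℝ) : EReal)}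

/-- `argmin_z {f z - ⟨ξ, z⟩}`, the element of `minimizers f ξ`, which is unique for a proper
lower semicontinuous strongly convex function on a Hilbert space. -/
def argminTilt (f : X → EReal) (ξ : X) : X :=
  Classical.epsilon fun x => x ∈ minimizers f ξ

end Hilbert

/-! ### Banach spaces -/

section Banach

variable {Y : Type*} [NormedAddCommGroup Y] [NormedSpace ℝ Y]

/-- The modulus of smoothness of a normed space. -/
def modulusOfSmoothness (Y : Type*) [NormedAddCommGroup Y] (ε : ℝ) : ℝ :=
  (1 / 2) * sSup {s : ℝ | ∃ u v : Y, ‖u‖ = 1 ∧ ‖v‖ ≤ ε ∧ s = ‖u + v‖ + ‖u - v‖ - 2}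

/-- Uniform smoothness: `ρ_Y(ε) / ε → 0` as `ε → 0+`. -/
def IsUniformlySmooth (Y : Type*) [NormedAddCommGroup Y] : Prop :=
  Tendsto (fun ε : ℝ => modulusOfSmoothness Y ε / ε) (𝓝[>] 0) (𝓝 0)

/-- The (set-valued) duality mapping of `Y` with gauge function `t ↦ t ^ (r - 1)`. -/
def dualitySet (r : ℝ) (v : Y) : Set (StrongDual ℝ Y) :=
  {φ | ‖φ‖ = ‖v‖ ^ (r - 1) ∧ φ v = ‖v‖ ^ r}

/-- The value of the duality mapping: the element of `dualitySet r v`, which is unique when `Y` is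
uniformly smooth. -/
def dualityMap (r : ℝ) (v : Y) : StrongDual ℝ Y :=
  Classical.epsilon fun φ => φ ∈ dualitySet r v

/-- The adjoint `A^* : Y^* → X` of a bounded operator from a Hilbert space to a Banach space, the
dual of the Hilbert space being identified with the space. -/
def adj {X : Type*} [NormedAddCommGroup X] [InnerProductSpace ℝ X] [CompleteSpace X]
    (A : X →L[ℝ] Y) (φ : StrongDual ℝ Y) : X :=
  (InnerProductSpace.toDual ℝ X).symm (φ.comp A)

end Banach

/-! ### The system of equations -/

section System

variable {N : ℕ} {X : Type*} {Y : Fin N → Type*}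

/-- `x` is a solution of the system `F i x = y i`, `i = 1, …, N`, where `F i` is defined on
`domF i`. -/
def IsSolution (domF : Fin N → Set X) (F : ∀ i, X → Y i) (y : ∀ i, Y i) (x : X) : Prop :=
  ∀ i, x ∈ domF i ∧ F i x = y i

/-- `x` minimizes the Bregman distance to `x₀` among all solutions of the system in the effective
domain of `Θ`. -/
def IsMinimalSolution [NormedAddCommGroup X] [InnerProductSpace ℝ X]
    (domF : Fin N → Set X) (F : ∀ i, X → Y i) (y : ∀ i, Y i)
    (Θ : X → EReal) (x₀ ξ₀ x : X) : Prop :=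
  x ∈ effDom Θ ∧ IsSolution domF F y x ∧
    ∀ z, z ∈ effDom Θ → IsSolution domF F y z → bregman Θ ξ₀ x x₀ ≤ bregman Θ ξ₀ z x₀

end System

/-! ### The adaptive stochastic heavy ball method with noisy data -/

/-- The real parameters that enter the method. -/
structure Params where
  /-- step size parameter -/
  μ₀ : ℝ
  /-- step size parameter -/
  μ₁ : ℝ
  /-- discrepancy parameter -/
  τ : ℝ
  /-- momentum threshold parameter -/
  υ₀ : ℝ
  /-- momentum threshold parameter -/
  υ₁ : ℝ
  /-- upper bound for the momentum coefficients -/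
  β : ℝ
  /-- exponent of the duality mappings -/
  r : ℝ
  /-- constant of the tangential cone condition -/
  η : ℝ
  /-- constant of strong convexity -/
  σ : ℝ

/-- What the method carries from step to step: at the beginning of step `n` these are
`ξ_n`, `ξ_{n-1}`, `x_n`, `γ̃_n` and `I_n`. -/
structure State (N : ℕ) (X : Type*) where
  /-- the dual iterate `ξ_n` -/
  ξ : X
  /-- the previous dual iterate `ξ_{n-1}` -/
  ξprev : X
  /-- the primal iterate `x_n` -/
  x : X
  /-- the estimate `γ̃_n` -/
  γ : ℝ
  /-- the set `I_n` of indices still to be tested -/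
  I : Finset (Fin N)

/-- The step size `t_n`, in terms of `‖r_n‖`, `‖g_n‖` and the noise level `d = δ_{i_n}`. -/
def stepSize (p : Params) (normr normg d : ℝ) : ℝ :=
  if p.τ * d < normr then
    min (p.μ₀ * ((1 - p.η) * normr - (1 + p.η) * d) * normr ^ (p.r - 1) / normg ^ 2)
      (p.μ₁ * normr ^ (2 - p.r))
  else 0

/-- The momentum coefficient `β_n`, in terms of `t = t_n`, `gm = ⟨g_n, m_n⟩`, `γ = γ̃_n`,
`normm = ‖m_n‖` and the noise level `d = δ_{i_n}`. -/
def momentum (p : Params) (t gm γ normm d : ℝ) : ℝ :=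
  if p.υ₀ * d < normm ∧ γ - t / (2 * p.σ) * gm < -(p.υ₁ * d * normm ^ 2) then
    min ((t * gm - 2 * p.σ * γ) / normm ^ 2) p.β
  else 0

section Method

variable {N : ℕ} {X : Type*} [NormedAddCommGroup X] [InnerProductSpace ℝ X] [CompleteSpace X]
  {Y : Fin N → Type*} [∀ i, NormedAddCommGroup (Y i)] [∀ i, NormedSpace ℝ (Y i)]

/-- One step of the method, with selected index `i`, data `yδ` and noise levels `δ`. -/
def step (p : Params) (Θ : X → EReal) (F : ∀ i, X → Y i) (L : ∀ i, X → X →L[ℝ] Y i)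
    (yδ : ∀ i, Y i) (δ : Fin N → ℝ) (i : Fin N) (s : State N X) : State N X :=
  let res : Y i := F i s.x - yδ i
  let g : X := adj (L i s.x) (dualityMap p.r res)
  let t : ℝ := stepSize p ‖res‖ ‖g‖ (δ i)
  let m : X := s.ξ - s.ξprev
  let b : ℝ := momentum p t (inner ℝ g m) s.γ ‖m‖ (δ i)
  let ξ' : X := s.ξ - t • g + b • m
  let x' : X := argminTilt Θ ξ'
  { ξ := ξ'
    ξprev := s.ξ
    x := x'
    γ := inner ℝ (ξ' - s.ξ) (x' - s.x) - (1 - p.η) * t * ‖res‖ ^ p.r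
      + (1 + p.η) * δ i * t * ‖res‖ ^ (p.r - 1) + b * s.γ
    I := if t = 0 ∧ b = 0 then s.I.erase i else Finset.univ }

/-- The state at the beginning of step `n` of the method started from `x₀` and `ξ₀`, along the
sample path `path 0, path 1, …` of selected indices. -/
def run (p : Params) (Θ : X → EReal) (F : ∀ i, X → Y i) (L : ∀ i, X → X →L[ℝ] Y i)
    (x₀ ξ₀ : X) (yδ : ∀ i, Y i) (δ : Fin N → ℝ) (path : ℕ → Fin N) : ℕ → State N X
  | 0 => { ξ := ξ₀, ξprev := ξ₀, x := x₀, γ := 0, I := Finset.univ }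
  | n + 1 => step p Θ F L yδ δ (path n) (run p Θ F L x₀ ξ₀ yδ δ path n)

/-- The method terminates along the given sample path. -/
def Terminates (p : Params) (Θ : X → EReal) (F : ∀ i, X → Y i) (L : ∀ i, X → X →L[ℝ] Y i)
    (x₀ ξ₀ : X) (yδ : ∀ i, Y i) (δ : Fin N → ℝ) (path : ℕ → Fin N) : Prop :=
  ∃ n, (run p Θ F L x₀ ξ₀ yδ δ path n).I = ∅

/-- The stopping index: the first `n` with `I_n = ∅` (meaningful when the method terminates). -/
def stopIndex (p : Params) (Θ : X → EReal) (F : ∀ i, X → Y i) (L : ∀ i, X → X →L[ℝ] Y i)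
    (x₀ ξ₀ : X) (yδ : ∀ i, Y i) (δ : Fin N → ℝ) (path : ℕ → Fin N) : ℕ :=
  sInf {n | (run p Θ F L x₀ ξ₀ yδ δ path n).I = ∅}

/-- The state at the stopping index. -/
def output (p : Params) (Θ : X → EReal) (F : ∀ i, X → Y i) (L : ∀ i, X → X →L[ℝ] Y i)
    (x₀ ξ₀ : X) (yδ : ∀ i, Y i) (δ : Fin N → ℝ) (path : ℕ → Fin N) : State N X :=
  run p Θ F L x₀ ξ₀ yδ δ path (stopIndex p Θ F L x₀ ξ₀ yδ δ path)

end Method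

end

end HeavyBall

/-!
The proof is pathwise except for one summability statement. Write
`Δ_n(z) = D_{ξ_n} Θ (z, x_n)` for a solution `z` in the ball of radius `2 ρ`.

*Descent.* Strong convexity of `Θ` bounds `Δ_{n+1}(z) - Δ_n(z)` by a quadratic in the momentum
coefficient, in which the unknown number `⟨m_n, x_n - z⟩` may be replaced by its upper bound `γ̃_n`.
The coefficient `β_n` is a clipped minimizer of that quadratic, and `t_n` is small enough for the
gradient step (`Problem.bregR_step_le`). Hence `Δ_n(z)` is decreasing, the iterates stay in the
ball, and with noise every step that is not a null step gains a fixed amount. As almost surely every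
index is selected infinitely often, the method stops (`Problem.terminates`).

*Exact data.* The run with noise levels `0` is the limit of the noisy runs. Descent gives
`∑ ‖F_{i_n}(x_n) - y_{i_n}‖² < ∞` along every path; since `i_n` is uniform and independent of `x_n`,
the sum over `n` of the full squared residuals `E_n = ∑_i ‖F_i(x_n) - y_i‖²` has finite expectation
(`Problem.lintegral_totalRes_ne_top`). If `E_k` is a running minimum, the tangential cone condition
gives `|⟨m_n, x_k - z⟩| ≤ V_n` for `n ≤ k + 1`, where `V_{n+1} = C E_n + β V_n` is summable. So the
iterates at the running minima form a Cauchy sequence, and monotonicity of `Δ_n(x_*)` for its limit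
`x_*` shows that `Δ_n(x_*) → 0` along the whole sequence (`Problem.exact_convergence`). The same
estimate bounds `D_{ξ_0} Θ (x_*, x_0)` by an integrable random variable.

*Stability.* For a fixed number of steps the noisy states converge to the exact one
(`Problem.stateTendsto_run`). The case distinctions of the method are harmless: where the exact
residual vanishes, `t_n g_n` tends to `0`, and where the exact `m_n` vanishes, so does `γ̃_n`. The
required continuity of the duality mappings follows from uniform smoothness
(`norm_sub_le_of_norming`).

*Conclusion.* If the method stops late, monotonicity and stability make `Δ_{n_l}(x_*)` small; if it
stops at the same step `k` for infinitely many `l`, then the exact `x_k` solves the system, so that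
`x_* = x_k` (`Problem.tendsto_bregR_output`). Expectations converge by dominated convergence. Under
the range condition `ξ_n - ξ_0` is orthogonal to `x_* - x†`, which forces `x_*` to be as good as
`x†` (`Problem.eq_of_range_condition`).
-/

namespace HeavyBall

/-! ### Strongly convex functions: real-valued form -/

lemma coe_toReal_of_mem {X : Type*} {Θ : X → EReal} (hp : IsProper Θ) {x : X} (hx : x ∈ effDom Θ) :
    (((Θ x).toReal : ℝ) : EReal) = Θ x :=
  EReal.coe_toReal (ne_of_lt hx) (hp.1 x)

/-- Sublevel sets of a lower semicontinuous function are closed. -/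
lemma mem_effDom_of_tendsto {X : Type*} [TopologicalSpace X] {Θ : X → EReal} (hp : IsProper Θ)
    (hl : LowerSemicontinuous Θ) {ι : Type*}
    {f : Filter ι} [f.NeBot] {u : ι → X} {x : X} (hu : Tendsto u f (𝓝 x)) {M : ℝ}
    (hM : ∀ᶠ n in f, u n ∈ effDom Θ ∧ (Θ (u n)).toReal ≤ M) :
    x ∈ effDom Θ ∧ (Θ x).toReal ≤ M := by
  have hcl : IsClosed (Θ ⁻¹' Set.Iic (M : EReal)) := hl.isClosed_preimage _
  have hx : Θ x ≤ (M : EReal) := hcl.mem_of_tendsto hu <| by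
    filter_upwards [hM] with n hn
    change Θ (u n) ≤ M
    rw [← coe_toReal_of_mem hp hn.1]
    exact_mod_cast hn.2
  have hmem : x ∈ effDom Θ := lt_of_le_of_lt hx (EReal.coe_lt_top M)
  refine ⟨hmem, ?_⟩
  rw [← coe_toReal_of_mem hp hmem] at hx
  exact_mod_cast hx

section Convex

variable {X : Type*} [NormedAddCommGroup X] [InnerProductSpace ℝ X] {Θ : X → EReal}

/-- The Bregman distance as a real number; it agrees with `bregman` when both points lie in the
effective domain of a proper function. -/
noncomputable def bregR (Θ : X → EReal) (ξ z x : X) : ℝ :=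
  (Θ z).toReal - (Θ x).toReal - inner ℝ ξ (z - x)

lemma bregman_eq_coe (hp : IsProper Θ) {z x : X} (hz : z ∈ effDom Θ) (hx : x ∈ effDom Θ)
    (ξ : X) : bregman Θ ξ z x = ((bregR Θ ξ z x : ℝ) : EReal) := by
  unfold bregman bregR
  rw [← coe_toReal_of_mem hp hz, ← coe_toReal_of_mem hp hx]
  norm_cast

lemma bregR_self (ξ x : X) : bregR Θ ξ x x = 0 := by simp [bregR]

lemma StronglyConvexWith.midpoint {κ : ℝ} (hc : StronglyConvexWith Θ κ) (hp : IsProper Θ)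
    {x z : X} (hx : x ∈ effDom Θ) (hz : z ∈ effDom Θ) :
    (1 / 2 : ℝ) • x + (1 / 2 : ℝ) • z ∈ effDom Θ ∧
      (Θ ((1 / 2 : ℝ) • x + (1 / 2 : ℝ) • z)).toReal + κ / 4 * ‖x - z‖ ^ 2
        ≤ ((Θ x).toReal + (Θ z).toReal) / 2 := by
  have h := hc x z (1 / 2) (by norm_num) (by norm_num)
  rw [show (1 - 1 / 2 : ℝ) = 1 / 2 by norm_num] at h
  rw [← coe_toReal_of_mem hp hx, ← coe_toReal_of_mem hp hz] at h
  have hmem : (1 / 2 : ℝ) • x + (1 / 2 : ℝ) • z ∈ effDom Θ := by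
    refine (lt_top_iff_ne_top (α := EReal)).2 fun htop => ?_
    rw [htop, EReal.top_add_coe] at h
    norm_cast at h
  refine ⟨hmem, ?_⟩
  rw [← coe_toReal_of_mem hp hmem] at h
  norm_cast at h
  linarith

/-- A minimizing sequence of a strongly convex function is a Cauchy sequence, so that a lower
semicontinuous one attains its minimum on closed midpoint convex sets. -/
lemma exists_minimizer_on [CompleteSpace X] (hp : IsProper Θ) (hl : LowerSemicontinuous Θ)
    {κ : ℝ} (hκ : 0 < κ) (hc : StronglyConvexWith Θ κ) (ξ : X) {C : Set X} (hC : IsClosed C)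
    (hmid : ∀ x ∈ C, ∀ z ∈ C, (1 / 2 : ℝ) • x + (1 / 2 : ℝ) • z ∈ C)
    (hne : (C ∩ effDom Θ).Nonempty) {m : ℝ}
    (hm : ∀ z ∈ C ∩ effDom Θ, m ≤ (Θ z).toReal - inner ℝ ξ z) :
    ∃ x ∈ C ∩ effDom Θ, ∀ z ∈ C ∩ effDom Θ,
      (Θ x).toReal - inner ℝ ξ x ≤ (Θ z).toReal - inner ℝ ξ z := by
  set f : X → ℝ := fun z => (Θ z).toReal - inner ℝ ξ z with hf
  set A : Set ℝ := f '' (C ∩ effDom Θ) with hA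
  have hbdd : BddBelow A := ⟨m, by rintro _ ⟨z, hz, rfl⟩; exact hm z hz⟩
  have hAne : A.Nonempty := hne.image f
  have hle : ∀ z ∈ C ∩ effDom Θ, sInf A ≤ f z := fun z hz => csInf_le hbdd ⟨z, hz, rfl⟩
  obtain ⟨v, -, hv, hvA⟩ := exists_seq_tendsto_sInf hAne hbdd
  choose u huC huv using hvA
  have hfu : Tendsto (fun n => f (u n)) atTop (𝓝 (sInf A)) := by simpa only [huv] using hv
  have key : ∀ n k, κ / 4 * ‖u n - u k‖ ^ 2 ≤ (f (u n) + f (u k)) / 2 - sInf A := by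
    intro n k
    obtain ⟨h1, h2⟩ := hc.midpoint hp (huC n).2 (huC k).2
    have h3 := hle _ ⟨hmid _ (huC n).1 _ (huC k).1, h1⟩
    simp only [hf, inner_add_right, inner_smul_right] at h3 ⊢
    linarith
  have hcau : CauchySeq u := by
    rw [Metric.cauchySeq_iff']
    intro ε hε
    have hev := hfu.eventually (gt_mem_nhds (show sInf A < sInf A + κ / 4 * ε ^ 2 by
      have : 0 < κ / 4 * ε ^ 2 := by positivity
      linarith))
    obtain ⟨n₀, hn₀⟩ := eventually_atTop.1 hev
    refine ⟨n₀, fun n hn => ?_⟩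
    have h1 := key n n₀
    have h2 := hn₀ n hn
    have h3 := hn₀ n₀ le_rfl
    rw [dist_eq_norm]
    have h4 : κ / 4 * ‖u n - u n₀‖ ^ 2 < κ / 4 * ε ^ 2 := by linarith
    exact lt_of_pow_lt_pow_left₀ 2 hε.le (lt_of_mul_lt_mul_left h4 (by positivity))
  obtain ⟨x, hx⟩ := cauchySeq_tendsto_of_complete hcau
  have hin : Tendsto (fun n => inner ℝ ξ (u n)) atTop (𝓝 (inner ℝ ξ x)) :=
    tendsto_const_nhds.inner hx
  have hθ : Tendsto (fun n => (Θ (u n)).toReal) atTop (𝓝 (sInf A + inner ℝ ξ x)) := by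
    simpa [hf] using hfu.add hin
  have hxd : ∀ ε > 0, x ∈ effDom Θ ∧ (Θ x).toReal ≤ sInf A + inner ℝ ξ x + ε := fun ε hε =>
    mem_effDom_of_tendsto hp hl hx <| by
      filter_upwards [hθ.eventually (ge_mem_nhds (lt_add_of_pos_right _ hε))] with n hn
      exact ⟨(huC n).2, hn⟩
  refine ⟨x, ⟨hC.mem_of_tendsto hx (Eventually.of_forall fun n => (huC n).1),
    (hxd 1 one_pos).1⟩, fun z hz => ?_⟩
  have h1 : (Θ x).toReal ≤ sInf A + inner ℝ ξ x := le_of_forall_pos_le_add fun ε hε => (hxd ε hε).2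
  have h2 := hle z hz
  simp only [hf] at h2
  linarith

/-- Uniqueness of the minimizer of a strongly convex function on a midpoint convex set. -/
lemma minimizer_on_unique (hp : IsProper Θ) {κ : ℝ} (hκ : 0 < κ) (hc : StronglyConvexWith Θ κ)
    (ξ : X) {C : Set X} (hmid : ∀ x ∈ C, ∀ z ∈ C, (1 / 2 : ℝ) • x + (1 / 2 : ℝ) • z ∈ C)
    {x x' : X} (hx : x ∈ C ∩ effDom Θ) (hx' : x' ∈ C ∩ effDom Θ)
    (hmin : ∀ z ∈ C ∩ effDom Θ, (Θ x).toReal - inner ℝ ξ x ≤ (Θ z).toReal - inner ℝ ξ z)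
    (hmin' : ∀ z ∈ C ∩ effDom Θ, (Θ x').toReal - inner ℝ ξ x' ≤ (Θ z).toReal - inner ℝ ξ z) :
    x = x' := by
  obtain ⟨h1, h2⟩ := hc.midpoint hp hx.2 hx'.2
  have h3 := hmin _ ⟨hmid _ hx.1 _ hx'.1, h1⟩
  have h4 := hmin' _ ⟨hmid _ hx.1 _ hx'.1, h1⟩
  simp only [inner_add_right, inner_smul_right] at h3 h4
  have h5 : κ / 4 * ‖x - x'‖ ^ 2 ≤ 0 := by linarith
  have h6 : ‖x - x'‖ ^ 2 ≤ 0 := nonpos_of_mul_nonpos_right h5 (by positivity)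
  exact sub_eq_zero.1 (norm_eq_zero.1 (pow_eq_zero_iff two_ne_zero |>.1
    (le_antisymm h6 (sq_nonneg _))))

lemma mem_subdiff_real (hp : IsProper Θ) {x ξ : X} (hx : x ∈ effDom Θ) :
    ξ ∈ subdiff Θ x ↔
      ∀ z ∈ effDom Θ, (Θ x).toReal + inner ℝ ξ (z - x) ≤ (Θ z).toReal := by
  constructor
  · intro h z hz
    have := h z
    rw [← coe_toReal_of_mem hp hx, ← coe_toReal_of_mem hp hz] at this
    exact_mod_cast this
  · intro h z
    by_cases hz : z ∈ effDom Θ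
    · rw [← coe_toReal_of_mem hp hx, ← coe_toReal_of_mem hp hz]
      exact_mod_cast h z hz
    · have : Θ z = ⊤ := not_lt_top_iff.1 hz
      rw [this]; exact le_top

lemma mem_minimizers_of_real (hp : IsProper Θ) {x ξ : X} (hx : x ∈ effDom Θ)
    (h : ∀ z ∈ effDom Θ, (Θ x).toReal - inner ℝ ξ x ≤ (Θ z).toReal - inner ℝ ξ z) :
    x ∈ minimizers Θ ξ := by
  intro z
  by_cases hz : z ∈ effDom Θ
  · rw [← coe_toReal_of_mem hp hx, ← coe_toReal_of_mem hp hz]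
    exact_mod_cast h z hz
  · have : Θ z = ⊤ := not_lt_top_iff.1 hz
    rw [this, EReal.top_sub_coe]; exact le_top

lemma mem_effDom_of_mem_minimizers (hp : IsProper Θ) {x ξ : X} (h : x ∈ minimizers Θ ξ) :
    x ∈ effDom Θ := by
  obtain ⟨z, hz⟩ := hp.2
  refine (lt_top_iff_ne_top (α := EReal)).2 fun htop => ?_
  have := h z
  rw [htop, EReal.top_sub_coe, ← coe_toReal_of_mem hp hz, top_le_iff, ← EReal.coe_sub] at this
  exact EReal.coe_ne_top _ this

lemma mem_subdiff_of_mem_minimizers (hp : IsProper Θ) {x ξ : X} (h : x ∈ minimizers Θ ξ) :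
    ξ ∈ subdiff Θ x := by
  have hx := mem_effDom_of_mem_minimizers hp h
  rw [mem_subdiff_real hp hx]
  intro z hz
  have := h z
  rw [← coe_toReal_of_mem hp hx, ← coe_toReal_of_mem hp hz] at this
  norm_cast at this
  rw [inner_sub_right]
  linarith

end Convex

/-! ### Duality mappings of uniformly smooth spaces -/

section Duality

variable {Y : Type*} [NormedAddCommGroup Y] [NormedSpace ℝ Y]

lemma dualitySet_nonempty {r : ℝ} (hr : 1 < r) (v : Y) :
    (dualitySet r v : Set (StrongDual ℝ Y)).Nonempty := by
  by_cases hv : v = 0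
  · refine ⟨0, ?_, ?_⟩
    · simp [hv, Real.zero_rpow (sub_pos.2 hr).ne']
    · simp [hv, Real.zero_rpow (one_pos.trans hr).ne']
  · obtain ⟨g, hg, hgv⟩ := exists_dual_vector ℝ v (norm_ne_zero_iff.2 hv)
    have hpos : 0 < ‖v‖ := norm_pos_iff.2 hv
    refine ⟨(‖v‖ ^ (r - 1)) • g, ?_, ?_⟩
    · rw [norm_smul, hg, mul_one, Real.norm_of_nonneg (by positivity)]
    · have : g v = ‖v‖ := by simpa using hgv
      rw [smul_apply, this, smul_eq_mul, Real.rpow_sub_one hpos.ne',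
        div_mul_cancel₀ _ hpos.ne']

lemma dualityMap_mem {r : ℝ} (hr : 1 < r) (v : Y) : dualityMap r v ∈ dualitySet r v :=
  Classical.epsilon_spec (dualitySet_nonempty hr v)

lemma norm_dualityMap {r : ℝ} (hr : 1 < r) (v : Y) : ‖dualityMap r v‖ = ‖v‖ ^ (r - 1) :=
  (dualityMap_mem hr v).1

lemma dualityMap_apply_self {r : ℝ} (hr : 1 < r) (v : Y) : dualityMap r v v = ‖v‖ ^ r :=
  (dualityMap_mem hr v).2

lemma le_modulusOfSmoothness {u w : Y} (hu : ‖u‖ = 1) (hw : ‖w‖ ≤ 1) {ε : ℝ} (hε : 0 ≤ ε) :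
    ‖u + ε • w‖ + ‖u - ε • w‖ - 2 ≤ 2 * modulusOfSmoothness Y ε := by
  unfold modulusOfSmoothness
  rw [← mul_assoc, show (2 : ℝ) * (1 / 2) = 1 by norm_num, one_mul]
  refine le_csSup ⟨2 * ε, ?_⟩ ⟨u, ε • w, hu, ?_, rfl⟩
  · rintro _ ⟨a, b, ha, hb, rfl⟩
    have h1 := norm_add_le a b
    have h2 := norm_sub_le a b
    linarith
  · rw [norm_smul, Real.norm_of_nonneg hε]
    exact mul_le_of_le_one_right hε hw

/-- Norming functionals of nearby unit vectors are close to each other; this single estimate gives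
both the uniqueness and the norm continuity of the duality mappings. -/
lemma norm_sub_le_of_norming {u u' : Y} (hu : ‖u‖ = 1) {f f' : StrongDual ℝ Y}
    (hf : ‖f‖ ≤ 1) (hf' : ‖f'‖ ≤ 1) (hfu : f u = 1) (hfu' : f' u' = 1) {ε : ℝ} (hε : 0 < ε) :
    ‖f' - f‖ ≤ 2 * (modulusOfSmoothness Y ε / ε) + ‖u' - u‖ / ε := by
  have key : ∀ w : Y, ‖w‖ ≤ 1 →
      (f' - f) w ≤ 2 * (modulusOfSmoothness Y ε / ε) + ‖u' - u‖ / ε := by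
    intro w hw
    have h1 : f' (u + ε • w) ≤ ‖u + ε • w‖ :=
      (le_abs_self _).trans ((f'.le_opNorm _).trans (mul_le_of_le_one_left (norm_nonneg _) hf'))
    have h2 : f (u - ε • w) ≤ ‖u - ε • w‖ :=
      (le_abs_self _).trans ((f.le_opNorm _).trans (mul_le_of_le_one_left (norm_nonneg _) hf))
    have h3 : f' (u' - u) ≤ ‖u' - u‖ :=
      (le_abs_self _).trans ((f'.le_opNorm _).trans (mul_le_of_le_one_left (norm_nonneg _) hf'))
    have h4 := le_modulusOfSmoothness hu hw hε.le
    simp only [map_add, map_sub, map_smul, smul_eq_mul, hfu, hfu'] at h1 h2 h3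
    have h5 : ε * (f' w - f w) ≤ 2 * modulusOfSmoothness Y ε + ‖u' - u‖ := by linarith
    rw [sub_apply]
    have h6 : f' w - f w ≤ (2 * modulusOfSmoothness Y ε + ‖u' - u‖) / ε := by
      rw [le_div_iff₀ hε]; linarith
    calc f' w - f w ≤ _ := h6
      _ = _ := by ring
  have h0 : 0 ≤ 2 * (modulusOfSmoothness Y ε / ε) + ‖u' - u‖ / ε := by
    simpa using key 0 (by simp)
  refine ContinuousLinearMap.opNorm_le_of_unit_norm h0 fun w hw => ?_
  rw [Real.norm_eq_abs, abs_le]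
  have h1 := key w hw.le
  have h2 := key (-w) (by rw [norm_neg]; exact hw.le)
  rw [map_neg] at h2
  exact ⟨by linarith, h1⟩

lemma tendsto_norming {ι : Type*} {l : Filter ι} (hY : IsUniformlySmooth Y) {u : Y}
    {uu : ι → Y} (hu : ‖u‖ = 1) (huu : Tendsto uu l (𝓝 u)) {f : StrongDual ℝ Y}
    {ff : ι → StrongDual ℝ Y} (hf : ‖f‖ ≤ 1) (hff : ∀ᶠ n in l, ‖ff n‖ ≤ 1) (hfu : f u = 1)
    (hffu : ∀ᶠ n in l, ff n (uu n) = 1) : Tendsto ff l (𝓝 f) := by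
  rw [Metric.tendsto_nhds]
  intro e he
  have h1 : ∀ᶠ ε : ℝ in 𝓝[>] 0, modulusOfSmoothness Y ε / ε < e / 4 :=
    hY.eventually (gt_mem_nhds (by positivity))
  obtain ⟨ε, h2, hε⟩ := (h1.and self_mem_nhdsWithin).exists
  have hε : 0 < ε := hε
  have h3 : ∀ᶠ n in l, dist (uu n) u < ε * (e / 2) :=
    (Metric.tendsto_nhds.1 huu) _ (by positivity)
  filter_upwards [hff, hffu, h3] with n h4 h5 h6
  rw [dist_eq_norm] at h6 ⊢
  have h7 := norm_sub_le_of_norming hu hf h4 hfu h5 hε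
  have h8 : ‖uu n - u‖ / ε < e / 2 := by
    rw [div_lt_iff₀ hε]; linarith
  linarith

/-- Duality mappings of a uniformly smooth space are norm continuous off the origin. -/
lemma tendsto_dualityMap {ι : Type*} {l : Filter ι} (hY : IsUniformlySmooth Y) {r : ℝ}
    (hr : 1 < r) {v : Y} (hv : v ≠ 0) {vv : ι → Y} (hvv : Tendsto vv l (𝓝 v)) :
    Tendsto (fun n => dualityMap r (vv n)) l (𝓝 (dualityMap r v)) := by
  have hvpos : 0 < ‖v‖ := norm_pos_iff.2 hv
  have hn : Tendsto (fun n => ‖vv n‖) l (𝓝 ‖v‖) := hvv.norm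
  have hpos : ∀ᶠ n in l, 0 < ‖vv n‖ := hn.eventually (lt_mem_nhds hvpos)
  have hrp : Tendsto (fun n => ‖vv n‖ ^ (r - 1)) l (𝓝 (‖v‖ ^ (r - 1))) :=
    hn.rpow_const (Or.inl hvpos.ne')
  have unit : ∀ w : Y, 0 < ‖w‖ → ‖(‖w‖ ^ (r - 1))⁻¹ • dualityMap r w‖ = 1 ∧
      ((‖w‖ ^ (r - 1))⁻¹ • dualityMap r w) (‖w‖⁻¹ • w) = 1 := by
    intro w hw
    have hp : 0 < ‖w‖ ^ (r - 1) := Real.rpow_pos_of_pos hw _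
    constructor
    · rw [norm_smul, norm_dualityMap hr, Real.norm_of_nonneg (inv_nonneg.2 hp.le),
        inv_mul_cancel₀ hp.ne']
    · rw [smul_apply, map_smul, dualityMap_apply_self hr, smul_eq_mul,
        smul_eq_mul, Real.rpow_sub_one hw.ne']
      have := Real.rpow_pos_of_pos hw r
      field_simp
  have h1 : Tendsto (fun n => (‖vv n‖ ^ (r - 1))⁻¹ • dualityMap r (vv n)) l
      (𝓝 ((‖v‖ ^ (r - 1))⁻¹ • dualityMap r v)) := by
    refine tendsto_norming hY (u := ‖v‖⁻¹ • v) (uu := fun n => ‖vv n‖⁻¹ • vv n) ?_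
      ((hn.inv₀ hvpos.ne').smul hvv) (unit v hvpos).1.le ?_ (unit v hvpos).2 ?_
    · rw [norm_smul, norm_inv, norm_norm, inv_mul_cancel₀ hvpos.ne']
    · filter_upwards [hpos] with n hn using (unit _ hn).1.le
    · filter_upwards [hpos] with n hn using (unit _ hn).2
  have h2 := hrp.smul h1
  rw [smul_inv_smul₀ (Real.rpow_pos_of_pos hvpos _).ne'] at h2
  refine h2.congr' ?_
  filter_upwards [hpos] with n hn
  rw [smul_inv_smul₀ (Real.rpow_pos_of_pos hn _).ne']

variable {X : Type*} [NormedAddCommGroup X] [InnerProductSpace ℝ X] [CompleteSpace X]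

lemma inner_adj (A : X →L[ℝ] Y) (φ : StrongDual ℝ Y) (w : X) : inner ℝ (adj A φ) w = φ (A w) := by
  simp [adj]

lemma norm_adj_le (A : X →L[ℝ] Y) (φ : StrongDual ℝ Y) : ‖adj A φ‖ ≤ ‖φ‖ * ‖A‖ := by
  unfold adj
  rw [LinearIsometryEquiv.norm_map]
  exact φ.opNorm_comp_le A

lemma tendsto_adj {ι : Type*} {l : Filter ι} {A : X →L[ℝ] Y} {φ : StrongDual ℝ Y}
    {AA : ι → X →L[ℝ] Y} {φφ : ι → StrongDual ℝ Y} (hA : Tendsto AA l (𝓝 A))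
    (hφ : Tendsto φφ l (𝓝 φ)) : Tendsto (fun n => adj (AA n) (φφ n)) l (𝓝 (adj A φ)) := by
  unfold adj
  exact ((InnerProductSpace.toDual ℝ X).symm.continuous.tendsto _).comp
    ((isBoundedBilinearMap_comp (𝕜 := ℝ)).continuous.tendsto (φ, A) |>.comp (hφ.prodMk_nhds hA))

end Duality

/-! ### The assumptions of the method -/

lemma mem_ball_of_near {E : Type*} [SeminormedAddCommGroup E] {x₀ z x : E} {ρ : ℝ}
    (hz : ‖z - x₀‖ ≤ ρ) (hx : ‖z - x‖ ≤ ρ) :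
    x ∈ Metric.closedBall x₀ (2 * ρ) := by
  rw [mem_closedBall_iff_norm]
  have := norm_sub_le (z - x₀) (z - x)
  rw [sub_sub_sub_cancel_left] at this
  linarith

section Setting

set_option linter.unusedSectionVars false

variable {N : ℕ} {X : Type*} [NormedAddCommGroup X] [InnerProductSpace ℝ X] [CompleteSpace X]
  {Y : Fin N → Type*} [∀ i, NormedAddCommGroup (Y i)] [∀ i, NormedSpace ℝ (Y i)]

/-- The standing assumptions on the problem and on the parameters of the method. The domains of
the operators do not occur, because only points of the ball of radius `2 ρ` matter. -/
structure Problem (p : Params) (Θ : X → EReal) (x₀ ξ₀ : X) (F : ∀ i, X → Y i)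
    (L : ∀ i, X → X →L[ℝ] Y i) (y : ∀ i, Y i) (ρ B₀ : ℝ) : Prop where
  σ_pos : 0 < p.σ
  proper : IsProper Θ
  lsc : LowerSemicontinuous Θ
  conv : ∃ κ : ℝ, 0 < κ ∧ StronglyConvexWith Θ κ
  strong : ∀ x ξ : X, x ∈ effDom Θ → ξ ∈ subdiff Θ x →
    ∀ z : X, ((p.σ * ‖z - x‖ ^ 2 : ℝ) : EReal) ≤ bregman Θ ξ z x
  x₀_mem : x₀ ∈ effDom Θ
  ξ₀_mem : ξ₀ ∈ subdiff Θ x₀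
  smooth : ∀ i, IsUniformlySmooth (Y i)
  ρ_pos : 0 < ρ
  sol : ∃ z ∈ effDom Θ, (∀ i, F i z = y i) ∧ bregR Θ ξ₀ z x₀ ≤ p.σ * ρ ^ 2
  Lcont : ∀ i, ContinuousOn (L i) (Metric.closedBall x₀ (2 * ρ))
  B₀_pos : 0 < B₀
  LB : ∀ i, ∀ x ∈ Metric.closedBall x₀ (2 * ρ), ‖L i x‖ ≤ B₀
  η_nonneg : 0 ≤ p.η
  η_lt : p.η < 1
  tcc : ∀ i, ∀ x ∈ Metric.closedBall x₀ (2 * ρ), ∀ z ∈ Metric.closedBall x₀ (2 * ρ),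
    ‖F i x - F i z - L i x (x - z)‖ ≤ p.η * ‖F i x - F i z‖
  one_lt_r : 1 < p.r
  μ₀_pos : 0 < p.μ₀
  μ₀_lt : p.μ₀ < 4 * p.σ
  μ₁_pos : 0 < p.μ₁
  υ₀_pos : 0 < p.υ₀
  υ₁_pos : 0 < p.υ₁
  β_nonneg : 0 ≤ p.β
  β_lt : p.β < 1
  lt_τ : (1 + p.η) / (1 - p.η) < p.τ

variable {p : Params} {Θ : X → EReal} {x₀ ξ₀ : X} {F : ∀ i, X → Y i}
  {L : ∀ i, X → X →L[ℝ] Y i} {y : ∀ i, Y i} {ρ B₀ : ℝ}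

/-- The solutions of the system in the ball of radius `2 ρ` where `Θ` is finite. -/
def solSet (Θ : X → EReal) (x₀ : X) (F : ∀ i, X → Y i) (y : ∀ i, Y i) (ρ : ℝ) : Set X :=
  {z | z ∈ Metric.closedBall x₀ (2 * ρ) ∧ z ∈ effDom Θ ∧ ∀ i, F i z = y i}

namespace Problem

variable (H : Problem p Θ x₀ ξ₀ F L y ρ B₀)
include H

lemma τ_pos : 0 < p.τ :=
  lt_trans (div_pos (by linarith [H.η_nonneg]) (by linarith [H.η_lt])) H.lt_τ

lemma le_bregR {x ξ z : X} (hx : x ∈ effDom Θ) (hξ : ξ ∈ subdiff Θ x) (hz : z ∈ effDom Θ) :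
    p.σ * ‖z - x‖ ^ 2 ≤ bregR Θ ξ z x := by
  have h := H.strong x ξ hx hξ z
  rw [bregman_eq_coe H.proper hz hx] at h
  exact_mod_cast h

lemma bregR_nonneg {x ξ z : X} (hx : x ∈ effDom Θ) (hξ : ξ ∈ subdiff Θ x) (hz : z ∈ effDom Θ) :
    0 ≤ bregR Θ ξ z x :=
  le_trans (by have := H.σ_pos; positivity) (H.le_bregR hx hξ hz)

/-- The subdifferential of `Θ` is strongly monotone. -/
lemma subdiff_monotone {x ξ x' ξ' : X} (hx : x ∈ effDom Θ) (hξ : ξ ∈ subdiff Θ x)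
    (hx' : x' ∈ effDom Θ) (hξ' : ξ' ∈ subdiff Θ x') :
    2 * p.σ * ‖x' - x‖ ^ 2 ≤ inner ℝ (ξ' - ξ) (x' - x) := by
  have h1 := H.le_bregR hx hξ hx'
  have h2 := H.le_bregR hx' hξ' hx
  rw [norm_sub_rev] at h2
  simp only [bregR, inner_sub_left, inner_sub_right] at h1 h2 ⊢
  linarith

lemma norm_sub_le_of_subdiff {x ξ x' ξ' : X} (hx : x ∈ effDom Θ) (hξ : ξ ∈ subdiff Θ x)
    (hx' : x' ∈ effDom Θ) (hξ' : ξ' ∈ subdiff Θ x') :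
    ‖x' - x‖ ≤ ‖ξ' - ξ‖ / (2 * p.σ) := by
  have hσ := H.σ_pos
  have h1 := H.subdiff_monotone hx hξ hx' hξ'
  have h2 := real_inner_le_norm (ξ' - ξ) (x' - x)
  rw [le_div_iff₀ (by positivity)]
  by_cases h : ‖x' - x‖ = 0
  · rw [h, zero_mul]; positivity
  · have hpos : 0 < ‖x' - x‖ := lt_of_le_of_ne (norm_nonneg _) (Ne.symm h)
    refine le_of_mul_le_mul_right ?_ hpos
    nlinarith

lemma argminTilt_mem_minimizers (ξ : X) : argminTilt Θ ξ ∈ minimizers Θ ξ := by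
  apply Classical.epsilon_spec (p := fun x => x ∈ minimizers Θ ξ)
  obtain ⟨κ, hκ, hc⟩ := H.conv
  have hσ := H.σ_pos
  obtain ⟨x, hx, hmin⟩ := exists_minimizer_on H.proper H.lsc hκ hc ξ (C := Set.univ)
    isClosed_univ (fun _ _ _ _ => trivial) ⟨x₀, trivial, H.x₀_mem⟩
    (m := (Θ x₀).toReal - inner ℝ ξ x₀ - ‖ξ - ξ₀‖ ^ 2 / (4 * p.σ)) (by
      rintro z ⟨-, hz⟩
      have h1 := H.le_bregR H.x₀_mem H.ξ₀_mem hz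
      have h2 := real_inner_le_norm (ξ - ξ₀) (z - x₀)
      have h3 : ‖ξ - ξ₀‖ * ‖z - x₀‖ - p.σ * ‖z - x₀‖ ^ 2 ≤ ‖ξ - ξ₀‖ ^ 2 / (4 * p.σ) := by
        rw [le_div_iff₀ (by positivity)]
        nlinarith [sq_nonneg (‖ξ - ξ₀‖ - 2 * p.σ * ‖z - x₀‖)]
      simp only [bregR, inner_sub_left, inner_sub_right] at h1 h2
      linarith)
  exact ⟨x, mem_minimizers_of_real H.proper hx.2 fun z hz => hmin z ⟨trivial, hz⟩⟩

lemma argminTilt_mem (ξ : X) : argminTilt Θ ξ ∈ effDom Θ :=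
  mem_effDom_of_mem_minimizers H.proper (H.argminTilt_mem_minimizers ξ)

lemma mem_subdiff_argminTilt (ξ : X) : ξ ∈ subdiff Θ (argminTilt Θ ξ) :=
  mem_subdiff_of_mem_minimizers H.proper (H.argminTilt_mem_minimizers ξ)

lemma argminTilt_eq {x ξ : X} (hx : x ∈ effDom Θ) (hξ : ξ ∈ subdiff Θ x) :
    argminTilt Θ ξ = x := by
  have h := H.norm_sub_le_of_subdiff hx hξ (H.argminTilt_mem ξ) (H.mem_subdiff_argminTilt ξ)
  rw [sub_self, norm_zero, zero_div] at h
  exact sub_eq_zero.1 (norm_le_zero_iff.1 h)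

/-- The conjugate function of `Θ` is smooth with constant `1 / (2 σ)`, expressed through Bregman
distances. -/
lemma bregR_sub_bregR_le {x ξ x' : X} (ξ' z : X) (hx : x ∈ effDom Θ) (hξ : ξ ∈ subdiff Θ x)
    (hx' : x' ∈ effDom Θ) :
    bregR Θ ξ' z x' - bregR Θ ξ z x ≤
      ‖ξ' - ξ‖ ^ 2 / (4 * p.σ) + inner ℝ (ξ' - ξ) (x - z) := by
  have hσ := H.σ_pos
  have h1 := H.le_bregR hx hξ hx'
  have h2 := real_inner_le_norm (ξ' - ξ) (x' - x)
  have h3 : ‖ξ' - ξ‖ * ‖x' - x‖ - p.σ * ‖x' - x‖ ^ 2 ≤ ‖ξ' - ξ‖ ^ 2 / (4 * p.σ) := by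
    rw [le_div_iff₀ (by positivity)]
    nlinarith [sq_nonneg (‖ξ' - ξ‖ - 2 * p.σ * ‖x' - x‖)]
  simp only [bregR, inner_sub_left, inner_sub_right] at h1 h2 ⊢
  linarith

/-! ### The tangential cone condition -/

lemma norm_L_le {i : Fin N} {x z : X} (hx : x ∈ Metric.closedBall x₀ (2 * ρ))
    (hz : z ∈ Metric.closedBall x₀ (2 * ρ)) :
    ‖L i x (x - z)‖ ≤ (1 + p.η) * ‖F i x - F i z‖ := by
  have h := H.tcc i x hx z hz
  have h2 := norm_sub_le (F i x - F i z) (F i x - F i z - L i x (x - z))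
  rw [sub_sub_cancel] at h2
  linarith

lemma norm_F_sub_le {i : Fin N} {x z : X} (hx : x ∈ Metric.closedBall x₀ (2 * ρ))
    (hz : z ∈ Metric.closedBall x₀ (2 * ρ)) :
    (1 - p.η) * ‖F i x - F i z‖ ≤ B₀ * ‖x - z‖ := by
  have h := H.tcc i x hx z hz
  have h2 := norm_add_le (F i x - F i z - L i x (x - z)) (L i x (x - z))
  rw [sub_add_cancel] at h2
  have h3 : ‖L i x (x - z)‖ ≤ B₀ * ‖x - z‖ :=
    (L i x).le_of_opNorm_le (H.LB i x hx) _
  linarith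

lemma tendsto_F {ι : Type*} {l : Filter ι} {i : Fin N} {u : ι → X} {x : X}
    (hu : ∀ᶠ n in l, u n ∈ Metric.closedBall x₀ (2 * ρ))
    (hx : x ∈ Metric.closedBall x₀ (2 * ρ)) (hux : Tendsto u l (𝓝 x)) :
    Tendsto (fun n => F i (u n)) l (𝓝 (F i x)) := by
  rw [tendsto_iff_norm_sub_tendsto_zero] at hux ⊢
  have hη : 0 < 1 - p.η := by linarith [H.η_lt]
  have h1 : Tendsto (fun n => B₀ * ‖u n - x‖ / (1 - p.η)) l (𝓝 0) := by
    simpa using (hux.const_mul B₀).div_const (1 - p.η)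
  refine squeeze_zero' (Eventually.of_forall fun _ => norm_nonneg _) ?_ h1
  filter_upwards [hu] with n hn
  rw [le_div_iff₀ hη]
  linarith [H.norm_F_sub_le (i := i) hn hx]

lemma tendsto_L {ι : Type*} {l : Filter ι} {i : Fin N} {u : ι → X} {x : X}
    (hu : ∀ᶠ n in l, u n ∈ Metric.closedBall x₀ (2 * ρ))
    (hx : x ∈ Metric.closedBall x₀ (2 * ρ)) (hux : Tendsto u l (𝓝 x)) :
    Tendsto (fun n => L i (u n)) l (𝓝 (L i x)) :=
  (H.Lcont i x hx).tendsto.comp (tendsto_nhdsWithin_iff.2 ⟨hux, hu⟩)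

lemma norm_sub_le_of_bregR_le {x ξ z : X} (hx : x ∈ effDom Θ) (hξ : ξ ∈ subdiff Θ x)
    (hz : z ∈ effDom Θ) (h : bregR Θ ξ z x ≤ p.σ * ρ ^ 2) : ‖z - x‖ ≤ ρ := by
  have h1 := (H.le_bregR hx hξ hz).trans h
  exact le_of_sq_le_sq (le_of_mul_le_mul_left h1 H.σ_pos) H.ρ_pos.le

/-- Solutions with a small initial Bregman distance lie in the ball. -/
lemma mem_solSet_of_bregR_le {z : X} (hz : z ∈ effDom Θ) (hF : ∀ i, F i z = y i)
    (h : bregR Θ ξ₀ z x₀ ≤ p.σ * ρ ^ 2) : z ∈ solSet Θ x₀ F y ρ := by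
  refine ⟨?_, hz, hF⟩
  have := H.norm_sub_le_of_bregR_le H.x₀_mem H.ξ₀_mem hz h
  rw [mem_closedBall_iff_norm]
  linarith [H.ρ_pos]

lemma exists_mem_solSet : ∃ z ∈ solSet Θ x₀ F y ρ, bregR Θ ξ₀ z x₀ ≤ p.σ * ρ ^ 2 := by
  obtain ⟨z, hz, hF, h⟩ := H.sol
  exact ⟨z, H.mem_solSet_of_bregR_le hz hF h, h⟩

end Problem

end Setting

/-! ### Step sizes and momentum coefficients -/

section Coefficients

lemma momentum_cond_iff {p : Params} (hσ : 0 < p.σ) {t gm γ normm d : ℝ} :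
    γ - t / (2 * p.σ) * gm < -(p.υ₁ * d * normm ^ 2) ↔
      2 * p.σ * p.υ₁ * d * normm ^ 2 < t * gm - 2 * p.σ * γ := by
  have h3 : t * gm - 2 * p.σ * γ = 2 * p.σ * -(γ - t / (2 * p.σ) * gm) := by
    field_simp; ring
  have h4 : 2 * p.σ * p.υ₁ * d * normm ^ 2 = 2 * p.σ * (p.υ₁ * d * normm ^ 2) := by ring
  rw [h3, h4, mul_lt_mul_iff_right₀ (by positivity)]
  exact lt_neg

lemma momentum_mem_Icc {p : Params} (hσ : 0 < p.σ) (hυ₁ : 0 < p.υ₁) (hβ : 0 ≤ p.β)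
    {t gm γ normm d : ℝ} (hd : 0 ≤ d) : momentum p t gm γ normm d ∈ Set.Icc 0 p.β := by
  unfold momentum
  split_ifs with h
  · refine ⟨le_min (div_nonneg ?_ (sq_nonneg _)) hβ, min_le_right _ _⟩
    exact le_trans (by positivity) ((momentum_cond_iff hσ).1 h.2).le
  · exact ⟨le_rfl, hβ⟩

/-- The momentum coefficient does not exceed the minimizer of the quadratic upper bound for the
Bregman distance after the step, so that the momentum term only improves that bound. -/
lemma momentum_mul_le {p : Params} (hσ : 0 < p.σ) (hυ₀ : 0 < p.υ₀) (hυ₁ : 0 < p.υ₁)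
    (hβ : 0 ≤ p.β) {t gm γ normm d : ℝ} (hd : 0 ≤ d) :
    momentum p t gm γ normm d * (momentum p t gm γ normm d * normm ^ 2)
      ≤ momentum p t gm γ normm d * (t * gm - 2 * p.σ * γ) := by
  by_cases h : p.υ₀ * d < normm ∧ γ - t / (2 * p.σ) * gm < -(p.υ₁ * d * normm ^ 2)
  · refine mul_le_mul_of_nonneg_left ?_ (momentum_mem_Icc hσ hυ₁ hβ hd).1
    have hm : 0 < normm := lt_of_le_of_lt (by positivity) h.1
    unfold momentum
    rw [if_pos h, ← le_div_iff₀ (by positivity)]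
    exact min_le_left _ _
  · simp [momentum, h]

lemma momentum_active {p : Params} (hσ : 0 < p.σ) (hυ₀ : 0 < p.υ₀) {t gm γ normm d : ℝ}
    (hd : 0 ≤ d) (h : momentum p t gm γ normm d ≠ 0) :
    p.υ₀ * d < normm ∧ min (2 * p.σ * p.υ₁ * d) p.β ≤ momentum p t gm γ normm d := by
  unfold momentum at h ⊢
  split_ifs at h ⊢ with h1
  · refine ⟨h1.1, min_le_min_right _ ?_⟩
    have hm : 0 < normm := lt_of_le_of_lt (by positivity) h1.1
    rw [le_div_iff₀ (by positivity)]
    exact ((momentum_cond_iff hσ).1 h1.2).le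
  · exact absurd rfl h

/-- The constant `(1 - η) - (1 + η) / τ`, which the discrepancy parameter makes positive. -/
noncomputable def cτ (p : Params) : ℝ := (1 - p.η) - (1 + p.η) / p.τ

/-- The constant `c` of the lower bound `t_n ≥ c ‖r_n‖ ^ (2 - r)` for active step sizes. -/
noncomputable def cstep (p : Params) (B₀ : ℝ) : ℝ := min (p.μ₀ * cτ p / B₀ ^ 2) p.μ₁

/-- The constant `c` of the descent inequality `Δ_{n+1} + c ‖r_n‖ ^ 2 ≤ Δ_n`. -/
noncomputable def cdesc (p : Params) (B₀ : ℝ) : ℝ :=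
  (1 - p.μ₀ / (4 * p.σ)) * (cτ p * cstep p B₀)

lemma rpow_eq_mul_sub_one {r R : ℝ} (hr : 1 < r) (hR : 0 ≤ R) : R ^ r = R * R ^ (r - 1) := by
  rcases hR.eq_or_lt with rfl | h
  · rw [Real.zero_rpow (by linarith), zero_mul]
  · rw [Real.rpow_sub_one h.ne']; field_simp

lemma rpow_two_sub_mul {r R : ℝ} (hr : 1 < r) (hR : 0 ≤ R) :
    R ^ (2 - r) * R ^ (r - 1) = R := by
  rcases hR.eq_or_lt with rfl | h
  · rw [Real.zero_rpow (show r - 1 ≠ 0 by linarith), mul_zero]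
  · rw [← Real.rpow_add h]; norm_num

lemma stepSize_eq_zero {p : Params} {R G d : ℝ} (h : ¬ p.τ * d < R) : stepSize p R G d = 0 :=
  if_neg h

lemma stepSize_mul_rpow_le {p : Params} (hr : 1 < p.r) (hμ₁ : 0 < p.μ₁) {R G d : ℝ}
    (hR : 0 ≤ R) : stepSize p R G d * R ^ (p.r - 1) ≤ p.μ₁ * R := by
  unfold stepSize
  split_ifs
  · calc _ ≤ (p.μ₁ * R ^ (2 - p.r)) * R ^ (p.r - 1) :=
          mul_le_mul_of_nonneg_right (min_le_right _ _) (by positivity)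
      _ = p.μ₁ * R := by rw [mul_assoc, rpow_two_sub_mul hr hR]
  · rw [zero_mul]; positivity

lemma cτ_mul_le {p : Params} (hη : 0 ≤ p.η) (hτ : 0 < p.τ) {R d : ℝ} (h : p.τ * d < R) :
    cτ p * R ≤ (1 - p.η) * R - (1 + p.η) * d := by
  have : (1 + p.η) / p.τ * R ≥ (1 + p.η) / p.τ * (p.τ * d) :=
    mul_le_mul_of_nonneg_left h.le (by positivity)
  have h2 : (1 + p.η) / p.τ * (p.τ * d) = (1 + p.η) * d := by field_simp
  unfold cτ
  linarith

lemma stepSize_nonneg {p : Params} (hη : 0 ≤ p.η) (hτ : 0 < p.τ) (hc : 0 < cτ p)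
    (hμ₀ : 0 < p.μ₀) (hμ₁ : 0 < p.μ₁) {R G d : ℝ} (hR : 0 ≤ R) : 0 ≤ stepSize p R G d := by
  unfold stepSize
  split_ifs with h
  · have h1 : 0 ≤ (1 - p.η) * R - (1 + p.η) * d := le_trans (by positivity) (cτ_mul_le hη hτ h)
    exact le_min (by positivity) (by positivity)
  · exact le_rfl

lemma stepSize_mul_sq_le {p : Params} {R G d : ℝ} (hG : 0 < G) (h : p.τ * d < R) :
    stepSize p R G d * G ^ 2 ≤ p.μ₀ * ((1 - p.η) * R - (1 + p.η) * d) * R ^ (p.r - 1) := by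
  unfold stepSize
  rw [if_pos h, ← le_div_iff₀ (by positivity)]
  exact min_le_left _ _

lemma le_stepSize_mul_rpow {p : Params} (hη : 0 ≤ p.η) (hτ : 0 < p.τ) (hc : 0 < cτ p)
    (hμ₀ : 0 < p.μ₀) {B₀ : ℝ} (hB : 0 < B₀) (hr : 1 < p.r)
    {R G d : ℝ} (hR : 0 < R) (hG : 0 < G) (hGB : G ≤ B₀ * R ^ (p.r - 1)) (h : p.τ * d < R) :
    cstep p B₀ * R ^ 2 ≤ stepSize p R G d * R ^ p.r := by
  have hq : 0 < R ^ (p.r - 1) := Real.rpow_pos_of_pos hR _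
  have h2 : R ^ (2 - p.r) = R / R ^ (p.r - 1) := by
    rw [eq_div_iff hq.ne', rpow_two_sub_mul hr hR.le]
  rw [rpow_eq_mul_sub_one hr hR.le]
  unfold stepSize
  rw [if_pos h, h2]
  set q := R ^ (p.r - 1)
  have h3 : cstep p B₀ * (R / q) ≤ min (p.μ₀ * ((1 - p.η) * R - (1 + p.η) * d) * q / G ^ 2)
      (p.μ₁ * (R / q)) := by
    refine le_min ?_ (mul_le_mul_of_nonneg_right (min_le_right _ _) (by positivity))
    calc cstep p B₀ * (R / q) ≤ p.μ₀ * cτ p / B₀ ^ 2 * (R / q) :=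
          mul_le_mul_of_nonneg_right (min_le_left _ _) (by positivity)
      _ = p.μ₀ * (cτ p * R) * q / (B₀ * q) ^ 2 := by field_simp
      _ ≤ p.μ₀ * ((1 - p.η) * R - (1 + p.η) * d) * q / G ^ 2 := by
          have := cτ_mul_le hη hτ h
          have h0 : 0 ≤ cτ p * R := by positivity
          have h5 : 0 ≤ (1 - p.η) * R - (1 + p.η) * d := h0.trans this
          gcongr
  calc cstep p B₀ * R ^ 2 = cstep p B₀ * (R / q) * (R * q) := by field_simp
    _ ≤ _ := mul_le_mul_of_nonneg_right h3 (by positivity)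

end Coefficients

/-! ### One step of the method -/

section Step

set_option linter.unusedSectionVars false

variable {N : ℕ} {X : Type*} [NormedAddCommGroup X] [InnerProductSpace ℝ X] [CompleteSpace X]
  {Y : Fin N → Type*} [∀ i, NormedAddCommGroup (Y i)] [∀ i, NormedSpace ℝ (Y i)]

/-- The increment `m_n = ξ_n - ξ_{n-1}`. -/
def State.m (s : State N X) : X := s.ξ - s.ξprev

/-- The gradient `g_n` of the step with index `i`. -/
noncomputable def grad (p : Params) (F : ∀ i, X → Y i) (L : ∀ i, X → X →L[ℝ] Y i) (yδ : ∀ i, Y i)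
    (i : Fin N) (s : State N X) : X :=
  adj (L i s.x) (dualityMap p.r (F i s.x - yδ i))

/-- The step size `t_n` of the step with index `i`. -/
noncomputable def tcoef (p : Params) (F : ∀ i, X → Y i) (L : ∀ i, X → X →L[ℝ] Y i)
    (yδ : ∀ i, Y i) (δ : Fin N → ℝ) (i : Fin N) (s : State N X) : ℝ :=
  stepSize p ‖F i s.x - yδ i‖ ‖grad p F L yδ i s‖ (δ i)

/-- The momentum coefficient `β_n` of the step with index `i`. -/
noncomputable def bcoef (p : Params) (F : ∀ i, X → Y i) (L : ∀ i, X → X →L[ℝ] Y i)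
    (yδ : ∀ i, Y i) (δ : Fin N → ℝ) (i : Fin N) (s : State N X) : ℝ :=
  momentum p (tcoef p F L yδ δ i s) (inner ℝ (grad p F L yδ i s) s.m) s.γ ‖s.m‖ (δ i)

variable {p : Params} {Θ : X → EReal} {x₀ ξ₀ : X} {F : ∀ i, X → Y i}
  {L : ∀ i, X → X →L[ℝ] Y i} {y : ∀ i, Y i} {ρ B₀ : ℝ} {yδ : ∀ i, Y i} {δ : Fin N → ℝ}
  {i : Fin N} {s : State N X}

lemma step_ξ : (step p Θ F L yδ δ i s).ξ =
    s.ξ - tcoef p F L yδ δ i s • grad p F L yδ i s + bcoef p F L yδ δ i s • s.m := rfl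

lemma step_ξprev : (step p Θ F L yδ δ i s).ξprev = s.ξ := rfl

lemma step_m : (step p Θ F L yδ δ i s).m =
    -(tcoef p F L yδ δ i s • grad p F L yδ i s) + bcoef p F L yδ δ i s • s.m := by
  rw [State.m, step_ξprev, step_ξ]; abel

lemma step_x : (step p Θ F L yδ δ i s).x = argminTilt Θ (step p Θ F L yδ δ i s).ξ := rfl

lemma step_γ : (step p Θ F L yδ δ i s).γ =
    inner ℝ (step p Θ F L yδ δ i s).m ((step p Θ F L yδ δ i s).x - s.x)
      - (1 - p.η) * tcoef p F L yδ δ i s * ‖F i s.x - yδ i‖ ^ p.r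
      + (1 + p.η) * δ i * tcoef p F L yδ δ i s * ‖F i s.x - yδ i‖ ^ (p.r - 1)
      + bcoef p F L yδ δ i s * s.γ := rfl

lemma step_I : (step p Θ F L yδ δ i s).I =
    if tcoef p F L yδ δ i s = 0 ∧ bcoef p F L yδ δ i s = 0 then s.I.erase i
    else Finset.univ := rfl

/-- What every state of the method satisfies: `ξ` is a subgradient at `x`, the iterate is close to
the solutions with small initial Bregman distance, and `γ` dominates `⟨m, x - z⟩` for all solutions
`z`. -/
structure Inv (p : Params) (Θ : X → EReal) (x₀ ξ₀ : X) (F : ∀ i, X → Y i) (y : ∀ i, Y i)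
    (ρ : ℝ) (s : State N X) : Prop where
  mem : s.x ∈ effDom Θ
  sub : s.ξ ∈ subdiff Θ s.x
  gam : ∀ z ∈ solSet Θ x₀ F y ρ, inner ℝ s.m (s.x - z) ≤ s.γ
  near : ∀ z ∈ solSet Θ x₀ F y ρ, bregR Θ ξ₀ z x₀ ≤ p.σ * ρ ^ 2 →
    bregR Θ s.ξ z s.x ≤ p.σ * ρ ^ 2

namespace Problem

variable (H : Problem p Θ x₀ ξ₀ F L y ρ B₀)
include H

lemma cτ_pos : 0 < cτ p := by
  have h := H.lt_τ
  have hη : 0 < 1 - p.η := by linarith [H.η_lt]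
  have hτ := H.τ_pos
  unfold cτ
  rw [sub_pos, div_lt_iff₀ hτ]
  rw [div_lt_iff₀ hη] at h
  linarith

lemma cstep_pos : 0 < cstep p B₀ := by
  have := H.cτ_pos
  have := H.B₀_pos
  have := H.μ₀_pos
  exact lt_min (by positivity) H.μ₁_pos

lemma one_sub_pos : 0 < 1 - p.μ₀ / (4 * p.σ) := by
  have := H.σ_pos
  rw [sub_pos, div_lt_one (by positivity)]
  exact H.μ₀_lt

lemma cdesc_pos : 0 < cdesc p B₀ :=
  mul_pos H.one_sub_pos (mul_pos H.cτ_pos H.cstep_pos)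

lemma ball_of_inv (hs : Inv p Θ x₀ ξ₀ F y ρ s) : s.x ∈ Metric.closedBall x₀ (2 * ρ) := by
  obtain ⟨z, hz, hzρ⟩ := H.exists_mem_solSet
  exact mem_ball_of_near (H.norm_sub_le_of_bregR_le H.x₀_mem H.ξ₀_mem hz.2.1 hzρ)
    (H.norm_sub_le_of_bregR_le hs.mem hs.sub hz.2.1 (hs.near z hz hzρ))

lemma inv_init : Inv p Θ x₀ ξ₀ F y ρ
    { ξ := ξ₀, ξprev := ξ₀, x := x₀, γ := 0, I := Finset.univ } :=
  ⟨H.x₀_mem, H.ξ₀_mem, fun z _ => by simp [State.m], fun _ _ h => h⟩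

lemma norm_grad_le (hs : s.x ∈ Metric.closedBall x₀ (2 * ρ)) :
    ‖grad p F L yδ i s‖ ≤ B₀ * ‖F i s.x - yδ i‖ ^ (p.r - 1) := by
  refine (norm_adj_le _ _).trans ?_
  rw [norm_dualityMap H.one_lt_r, mul_comm]
  exact mul_le_mul_of_nonneg_right (H.LB i _ hs) (by positivity)

lemma tcoef_nonneg : 0 ≤ tcoef p F L yδ δ i s :=
  stepSize_nonneg H.η_nonneg H.τ_pos H.cτ_pos H.μ₀_pos H.μ₁_pos (norm_nonneg _)

lemma bcoef_mem (hδ : 0 ≤ δ i) : bcoef p F L yδ δ i s ∈ Set.Icc 0 p.β :=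
  momentum_mem_Icc H.σ_pos H.υ₁_pos H.β_nonneg hδ

lemma tcoef_mul_rpow_le :
    tcoef p F L yδ δ i s * ‖F i s.x - yδ i‖ ^ (p.r - 1) ≤ p.μ₁ * ‖F i s.x - yδ i‖ :=
  stepSize_mul_rpow_le H.one_lt_r H.μ₁_pos (norm_nonneg _)

/-- The direction `-g_n` points towards all solutions, up to the noise level. -/
lemma le_inner_grad {z : X} (hs : s.x ∈ Metric.closedBall x₀ (2 * ρ))
    (hz : z ∈ solSet Θ x₀ F y ρ) (hyδ : ‖yδ i - y i‖ ≤ δ i) :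
    ((1 - p.η) * ‖F i s.x - yδ i‖ - (1 + p.η) * δ i) * ‖F i s.x - yδ i‖ ^ (p.r - 1)
      ≤ inner ℝ (grad p F L yδ i s) (s.x - z) := by
  unfold grad
  rw [inner_adj]
  set J := dualityMap p.r (F i s.x - yδ i) with hJ
  set q := ‖F i s.x - yδ i‖ ^ (p.r - 1) with hq
  set R := ‖F i s.x - yδ i‖ with hR
  set e := F i s.x - F i z - L i s.x (s.x - z) with he
  have hJn : ‖J‖ = q := norm_dualityMap H.one_lt_r _
  have hq0 : 0 ≤ q := by positivity
  have hJr : J (F i s.x - yδ i) = R * q := by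
    rw [hJ, dualityMap_apply_self H.one_lt_r, rpow_eq_mul_sub_one H.one_lt_r (norm_nonneg _)]
  have h1 : L i s.x (s.x - z) = (F i s.x - yδ i) + (yδ i - y i) - e := by
    rw [he, hz.2.2 i]; abel
  have h2 : F i s.x - F i z = (F i s.x - yδ i) + (yδ i - y i) := by rw [hz.2.2 i]; abel
  have h3 : ‖e‖ ≤ p.η * (R + δ i) := by
    refine (H.tcc i _ hs _ hz.1).trans (mul_le_mul_of_nonneg_left ?_ H.η_nonneg)
    rw [h2]
    exact (norm_add_le _ _).trans (by gcongr)
  have h4 : -(q * δ i) ≤ J (yδ i - y i) := by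
    have := (abs_le.1 (Real.norm_eq_abs _ ▸ J.le_opNorm (yδ i - y i))).1
    rw [hJn] at this
    have h5 : q * ‖yδ i - y i‖ ≤ q * δ i := mul_le_mul_of_nonneg_left hyδ hq0
    linarith
  have h6 : J e ≤ q * (p.η * (R + δ i)) := by
    have := (abs_le.1 (Real.norm_eq_abs _ ▸ J.le_opNorm e)).2
    rw [hJn] at this
    exact this.trans (mul_le_mul_of_nonneg_left h3 hq0)
  rw [h1, map_sub, map_add, hJr]
  nlinarith

lemma grad_ne_zero (hs : Inv p Θ x₀ ξ₀ F y ρ s) (hyδ : ‖yδ i - y i‖ ≤ δ i)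
    (h : p.τ * δ i < ‖F i s.x - yδ i‖) : 0 < ‖grad p F L yδ i s‖ := by
  obtain ⟨z, hz, -⟩ := H.exists_mem_solSet
  have h1 := H.le_inner_grad (i := i) (yδ := yδ) (H.ball_of_inv hs) hz hyδ
  have hR : 0 < ‖F i s.x - yδ i‖ :=
    lt_of_le_of_lt (mul_nonneg H.τ_pos.le ((norm_nonneg _).trans hyδ)) h
  have h2 := cτ_mul_le H.η_nonneg H.τ_pos h
  have h3 : 0 < ‖F i s.x - yδ i‖ ^ (p.r - 1) := Real.rpow_pos_of_pos hR _
  have h4 := mul_pos H.cτ_pos hR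
  have h5 := lt_of_lt_of_le (mul_pos (h4.trans_le h2) h3) h1
  rw [norm_pos_iff]
  intro h0
  rw [h0, inner_zero_left] at h5
  exact lt_irrefl _ h5

/-- An active step size is bounded below in terms of the residual. -/
lemma le_tcoef_mul_rpow (hs : Inv p Θ x₀ ξ₀ F y ρ s) (hyδ : ‖yδ i - y i‖ ≤ δ i)
    (h : p.τ * δ i < ‖F i s.x - yδ i‖) :
    cstep p B₀ * ‖F i s.x - yδ i‖ ^ 2 ≤ tcoef p F L yδ δ i s * ‖F i s.x - yδ i‖ ^ p.r := by
  have hR : 0 < ‖F i s.x - yδ i‖ :=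
    lt_of_le_of_lt (mul_nonneg H.τ_pos.le ((norm_nonneg _).trans hyδ)) h
  exact le_stepSize_mul_rpow H.η_nonneg H.τ_pos H.cτ_pos H.μ₀_pos H.B₀_pos H.one_lt_r hR
    (H.grad_ne_zero hs hyδ h) (H.norm_grad_le (H.ball_of_inv hs)) h

lemma tcoef_eq_zero_iff (hs : Inv p Θ x₀ ξ₀ F y ρ s) (hyδ : ‖yδ i - y i‖ ≤ δ i) :
    tcoef p F L yδ δ i s = 0 ↔ ‖F i s.x - yδ i‖ ≤ p.τ * δ i := by
  constructor
  · intro h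
    by_contra! h1
    have h2 := H.le_tcoef_mul_rpow hs hyδ h1
    have hR : 0 < ‖F i s.x - yδ i‖ :=
      lt_of_le_of_lt (mul_nonneg H.τ_pos.le ((norm_nonneg _).trans hyδ)) h1
    rw [h, zero_mul] at h2
    have := mul_pos H.cstep_pos (pow_pos hR 2)
    linarith
  · intro h
    exact stepSize_eq_zero (not_lt.2 h)

lemma inner_step_m_le (hs : Inv p Θ x₀ ξ₀ F y ρ s) (hyδ : ‖yδ i - y i‖ ≤ δ i) {z : X}
    (hz : z ∈ solSet Θ x₀ F y ρ) :
    inner ℝ (step p Θ F L yδ δ i s).m (s.x - z) ≤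
      -(tcoef p F L yδ δ i s * (((1 - p.η) * ‖F i s.x - yδ i‖ - (1 + p.η) * δ i) *
        ‖F i s.x - yδ i‖ ^ (p.r - 1))) + bcoef p F L yδ δ i s * s.γ := by
  have h1 := H.le_inner_grad (i := i) (yδ := yδ) (H.ball_of_inv hs) hz hyδ
  have h2 := mul_le_mul_of_nonneg_left h1
    (H.tcoef_nonneg (yδ := yδ) (δ := δ) (i := i) (s := s))
  have h3 := mul_le_mul_of_nonneg_left (hs.gam z hz)
    (H.bcoef_mem (yδ := yδ) (s := s) ((norm_nonneg _).trans hyδ)).1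
  rw [step_m, inner_add_left, inner_neg_left, real_inner_smul_left, real_inner_smul_left]
  linarith

/-- The descent inequality: the Bregman distance to any solution decreases, by an amount that
bounds the active step sizes and momentum coefficients. -/
lemma bregR_step_le (hs : Inv p Θ x₀ ξ₀ F y ρ s) (hyδ : ‖yδ i - y i‖ ≤ δ i) {z : X}
    (hz : z ∈ solSet Θ x₀ F y ρ) :
    bregR Θ (step p Θ F L yδ δ i s).ξ z (step p Θ F L yδ δ i s).x +
      (1 - p.μ₀ / (4 * p.σ)) * (tcoef p F L yδ δ i s *
        (((1 - p.η) * ‖F i s.x - yδ i‖ - (1 + p.η) * δ i) * ‖F i s.x - yδ i‖ ^ (p.r - 1))) +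
      (bcoef p F L yδ δ i s * ‖s.m‖) ^ 2 / (4 * p.σ) ≤ bregR Θ s.ξ z s.x := by
  have hσ := H.σ_pos
  have h1 := H.bregR_sub_bregR_le (step p Θ F L yδ δ i s).ξ z hs.mem hs.sub
    (H.argminTilt_mem (step p Θ F L yδ δ i s).ξ)
  have h2 := H.inner_step_m_le hs hyδ hz
  have h3 : (step p Θ F L yδ δ i s).ξ - s.ξ = (step p Θ F L yδ δ i s).m := rfl
  have h4 : tcoef p F L yδ δ i s * (tcoef p F L yδ δ i s * ‖grad p F L yδ i s‖ ^ 2) ≤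
      tcoef p F L yδ δ i s * (p.μ₀ * (((1 - p.η) * ‖F i s.x - yδ i‖ - (1 + p.η) * δ i) *
        ‖F i s.x - yδ i‖ ^ (p.r - 1))) := by
    by_cases h : p.τ * δ i < ‖F i s.x - yδ i‖
    · refine mul_le_mul_of_nonneg_left ?_ H.tcoef_nonneg
      rw [← mul_assoc]
      exact stepSize_mul_sq_le (H.grad_ne_zero hs hyδ h) h
    · have : tcoef p F L yδ δ i s = 0 := stepSize_eq_zero h
      rw [this, zero_mul, zero_mul]
  have h5 : bcoef p F L yδ δ i s * (bcoef p F L yδ δ i s * ‖s.m‖ ^ 2) ≤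
      bcoef p F L yδ δ i s * (tcoef p F L yδ δ i s * inner ℝ (grad p F L yδ i s) s.m
        - 2 * p.σ * s.γ) :=
    momentum_mul_le H.σ_pos H.υ₀_pos H.υ₁_pos H.β_nonneg ((norm_nonneg _).trans hyδ)
  have h6 : ‖(step p Θ F L yδ δ i s).m‖ ^ 2 =
      tcoef p F L yδ δ i s * (tcoef p F L yδ δ i s * ‖grad p F L yδ i s‖ ^ 2)
      - 2 * (bcoef p F L yδ δ i s * (tcoef p F L yδ δ i s * inner ℝ (grad p F L yδ i s) s.m))
      + bcoef p F L yδ δ i s * (bcoef p F L yδ δ i s * ‖s.m‖ ^ 2) := by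
    rw [step_m, norm_add_sq_real, norm_neg, inner_neg_left, real_inner_smul_left,
      real_inner_smul_right, norm_smul, norm_smul, mul_pow, mul_pow, Real.norm_eq_abs,
      Real.norm_eq_abs, sq_abs, sq_abs]
    ring
  rw [h3, h6] at h1
  rw [← step_x] at h1
  generalize tcoef p F L yδ δ i s = t at *
  generalize bcoef p F L yδ δ i s = b at *
  generalize ((1 - p.η) * ‖F i s.x - yδ i‖ - (1 + p.η) * δ i) *
        ‖F i s.x - yδ i‖ ^ (p.r - 1) = E at *
  generalize (inner ℝ (grad p F L yδ i s) s.m : ℝ) = gm at *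
  generalize inner ℝ (step p Θ F L yδ δ i s).m (s.x - z) = w at *
  have h7 : (t * (t * ‖grad p F L yδ i s‖ ^ 2) - 2 * (b * (t * gm)) + b * (b * ‖s.m‖ ^ 2)) /
      (4 * p.σ) ≤ (t * (p.μ₀ * E) - 4 * p.σ * (b * s.γ) - (b * ‖s.m‖) ^ 2) / (4 * p.σ) := by
    gcongr
    nlinarith
  have h8 : (t * (p.μ₀ * E) - 4 * p.σ * (b * s.γ) - (b * ‖s.m‖) ^ 2) / (4 * p.σ) =
      p.μ₀ / (4 * p.σ) * (t * E) - b * s.γ - (b * ‖s.m‖) ^ 2 / (4 * p.σ) := by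
    field_simp
  linarith

lemma le_gain (hs : Inv p Θ x₀ ξ₀ F y ρ s) (hyδ : ‖yδ i - y i‖ ≤ δ i)
    (h : p.τ * δ i < ‖F i s.x - yδ i‖) :
    cdesc p B₀ * ‖F i s.x - yδ i‖ ^ 2 ≤ (1 - p.μ₀ / (4 * p.σ)) * (tcoef p F L yδ δ i s *
        (((1 - p.η) * ‖F i s.x - yδ i‖ - (1 + p.η) * δ i) * ‖F i s.x - yδ i‖ ^ (p.r - 1))) := by
  unfold cdesc
  rw [mul_assoc]
  refine mul_le_mul_of_nonneg_left ?_ H.one_sub_pos.le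
  calc cτ p * cstep p B₀ * ‖F i s.x - yδ i‖ ^ 2
      = cτ p * (cstep p B₀ * ‖F i s.x - yδ i‖ ^ 2) := by ring
    _ ≤ cτ p * (tcoef p F L yδ δ i s * ‖F i s.x - yδ i‖ ^ p.r) :=
        mul_le_mul_of_nonneg_left (H.le_tcoef_mul_rpow hs hyδ h) H.cτ_pos.le
    _ = tcoef p F L yδ δ i s * ((cτ p * ‖F i s.x - yδ i‖) * ‖F i s.x - yδ i‖ ^ (p.r - 1)) := by
        rw [rpow_eq_mul_sub_one H.one_lt_r (norm_nonneg _)]; ring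
    _ ≤ _ := by
        refine mul_le_mul_of_nonneg_left ?_ H.tcoef_nonneg
        exact mul_le_mul_of_nonneg_right (cτ_mul_le H.η_nonneg H.τ_pos h) (by positivity)

lemma gain_nonneg (hs : Inv p Θ x₀ ξ₀ F y ρ s) (hyδ : ‖yδ i - y i‖ ≤ δ i) :
    0 ≤ (1 - p.μ₀ / (4 * p.σ)) * (tcoef p F L yδ δ i s *
        (((1 - p.η) * ‖F i s.x - yδ i‖ - (1 + p.η) * δ i) * ‖F i s.x - yδ i‖ ^ (p.r - 1))) := by
  by_cases h : p.τ * δ i < ‖F i s.x - yδ i‖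
  · exact (mul_nonneg H.cdesc_pos.le (sq_nonneg _)).trans (H.le_gain hs hyδ h)
  · have : tcoef p F L yδ δ i s = 0 := stepSize_eq_zero h
    rw [this, zero_mul, mul_zero]

lemma bregR_step_le_self (hs : Inv p Θ x₀ ξ₀ F y ρ s) (hyδ : ‖yδ i - y i‖ ≤ δ i) {z : X}
    (hz : z ∈ solSet Θ x₀ F y ρ) :
    bregR Θ (step p Θ F L yδ δ i s).ξ z (step p Θ F L yδ δ i s).x ≤ bregR Θ s.ξ z s.x := by
  have h1 := H.bregR_step_le hs hyδ hz
  have h2 := H.gain_nonneg hs hyδ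
  have h3 : 0 ≤ (bcoef p F L yδ δ i s * ‖s.m‖) ^ 2 / (4 * p.σ) := by
    have := H.σ_pos; positivity
  linarith

lemma inv_step (hs : Inv p Θ x₀ ξ₀ F y ρ s) (hyδ : ‖yδ i - y i‖ ≤ δ i) :
    Inv p Θ x₀ ξ₀ F y ρ (step p Θ F L yδ δ i s) where
  mem := H.argminTilt_mem _
  sub := H.mem_subdiff_argminTilt _
  gam z hz := by
    have h1 := H.inner_step_m_le hs hyδ hz
    rw [step_γ, rpow_eq_mul_sub_one H.one_lt_r (norm_nonneg (F i s.x - yδ i)),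
      ← sub_add_sub_cancel (step p Θ F L yδ δ i s).x s.x z, inner_add_right]
    linarith
  near z hz h := (H.bregR_step_le_self hs hyδ hz).trans (hs.near z hz h)

end Problem

end Step

/-! ### Runs of the method: monotonicity and termination -/

section Run

set_option linter.unusedSectionVars false

variable {N : ℕ} {X : Type*} [NormedAddCommGroup X] [InnerProductSpace ℝ X] [CompleteSpace X]
  {Y : Fin N → Type*} [∀ i, NormedAddCommGroup (Y i)] [∀ i, NormedSpace ℝ (Y i)]
  {p : Params} {Θ : X → EReal} {x₀ ξ₀ : X} {F : ∀ i, X → Y i}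
  {L : ∀ i, X → X →L[ℝ] Y i} {y : ∀ i, Y i} {ρ B₀ : ℝ} {yδ : ∀ i, Y i} {δ : Fin N → ℝ}
  {i : Fin N} {s : State N X} {path : ℕ → Fin N}

lemma run_succ (n : ℕ) : run p Θ F L x₀ ξ₀ yδ δ path (n + 1) =
    step p Θ F L yδ δ (path n) (run p Θ F L x₀ ξ₀ yδ δ path n) := rfl

/-- The state at step `n` depends only on the first `n` selected indices. -/
lemma run_congr {path' : ℕ → Fin N} {n : ℕ} (h : ∀ j < n, path j = path' j) :
    run p Θ F L x₀ ξ₀ yδ δ path n = run p Θ F L x₀ ξ₀ yδ δ path' n := by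
  induction n with
  | zero => rfl
  | succ n ih => rw [run_succ, run_succ, ih fun j hj => h j (hj.trans n.lt_succ_self),
      h n n.lt_succ_self]

namespace Problem

variable (H : Problem p Θ x₀ ξ₀ F L y ρ B₀)
include H

lemma inv_run (hyδ : ∀ i, ‖yδ i - y i‖ ≤ δ i) (n : ℕ) :
    Inv p Θ x₀ ξ₀ F y ρ (run p Θ F L x₀ ξ₀ yδ δ path n) := by
  induction n with
  | zero => exact H.inv_init
  | succ n ih => exact H.inv_step ih (hyδ _)

lemma antitone_bregR_run (hyδ : ∀ i, ‖yδ i - y i‖ ≤ δ i) {z : X} (hz : z ∈ solSet Θ x₀ F y ρ) :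
    Antitone fun n => bregR Θ (run p Θ F L x₀ ξ₀ yδ δ path n).ξ z
      (run p Θ F L x₀ ξ₀ yδ δ path n).x :=
  antitone_nat_of_succ_le fun n => H.bregR_step_le_self (H.inv_run hyδ n) (hyδ _) hz

lemma bregR_run_nonneg (hyδ : ∀ i, ‖yδ i - y i‖ ≤ δ i) {z : X} (hz : z ∈ effDom Θ) (n : ℕ) :
    0 ≤ bregR Θ (run p Θ F L x₀ ξ₀ yδ δ path n).ξ z (run p Θ F L x₀ ξ₀ yδ δ path n).x :=
  H.bregR_nonneg (H.inv_run hyδ n).mem (H.inv_run hyδ n).sub hz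

lemma step_ξ_of_null (h : tcoef p F L yδ δ i s = 0 ∧ bcoef p F L yδ δ i s = 0) :
    (step p Θ F L yδ δ i s).ξ = s.ξ := by
  rw [step_ξ, h.1, h.2, zero_smul, zero_smul, sub_zero, add_zero]

lemma step_x_of_null (hs : Inv p Θ x₀ ξ₀ F y ρ s)
    (h : tcoef p F L yδ δ i s = 0 ∧ bcoef p F L yδ δ i s = 0) :
    (step p Θ F L yδ δ i s).x = s.x := by
  rw [step_x, H.step_ξ_of_null h, H.argminTilt_eq hs.mem hs.sub]

/-- An index that has been discarded satisfies the discrepancy principle. -/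
lemma norm_residual_le_of_notMem (hyδ : ∀ i, ‖yδ i - y i‖ ≤ δ i) (n : ℕ) :
    ∀ i ∉ (run p Θ F L x₀ ξ₀ yδ δ path n).I,
      ‖F i (run p Θ F L x₀ ξ₀ yδ δ path n).x - yδ i‖ ≤ p.τ * δ i := by
  induction n with
  | zero => exact fun i hi => absurd (Finset.mem_univ i) hi
  | succ n ih =>
    intro i hi
    have hs := H.inv_run (path := path) hyδ n
    rw [run_succ] at hi ⊢
    rw [step_I] at hi
    split_ifs at hi with hnull
    · rw [H.step_x_of_null hs hnull]
      by_cases hin : i = path n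
      · subst hin
        exact (H.tcoef_eq_zero_iff hs (hyδ _)).1 hnull.1
      · exact ih i fun hmem => hi (Finset.mem_erase.2 ⟨hin, hmem⟩)
    · exact absurd (Finset.mem_univ i) hi

/-- Every step that is not a null step decreases the Bregman distance to the solutions by a
positive amount that does not depend on the state. -/
lemma exists_gain (hyδ : ∀ i, ‖yδ i - y i‖ ≤ δ i) (hδ : ∀ i, 0 < δ i) {z : X}
    (hz : z ∈ solSet Θ x₀ F y ρ) (i : Fin N) :
    ∃ c : ℝ, 0 < c ∧ ∀ s : State N X, Inv p Θ x₀ ξ₀ F y ρ s →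
      ¬(tcoef p F L yδ δ i s = 0 ∧ bcoef p F L yδ δ i s = 0) →
      bregR Θ (step p Θ F L yδ δ i s).ξ z (step p Θ F L yδ δ i s).x + c ≤ bregR Θ s.ξ z s.x := by
  have hσ := H.σ_pos
  have hd := hδ i
  have hυ₀ := H.υ₀_pos
  have hυ₁ := H.υ₁_pos
  have hτ := H.τ_pos
  have hc := H.cdesc_pos
  -- For `p.β = 0` the momentum never acts, so that the value of the second constant is irrelevant.
  set c₁ : ℝ := cdesc p B₀ * (p.τ * δ i) ^ 2 with hc₁
  set c₂ : ℝ := (if p.β = 0 then 1 else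
    (min (2 * p.σ * p.υ₁ * δ i) p.β * (p.υ₀ * δ i)) ^ 2 / (4 * p.σ)) with hc₂
  have hc₂pos : 0 < c₂ := by
    rw [hc₂]
    split_ifs with h
    · exact one_pos
    · have hβ : 0 < p.β := lt_of_le_of_ne H.β_nonneg (Ne.symm h)
      have : 0 < min (2 * p.σ * p.υ₁ * δ i) p.β := lt_min (by positivity) hβ
      positivity
  refine ⟨min c₁ c₂, lt_min (by positivity) hc₂pos, fun s hs hact => ?_⟩
  have h1 := H.bregR_step_le hs (hyδ i) hz
  by_cases ht : p.τ * δ i < ‖F i s.x - yδ i‖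
  · have h2 := H.le_gain hs (hyδ i) ht
    have h3 : c₁ ≤ cdesc p B₀ * ‖F i s.x - yδ i‖ ^ 2 := by
      refine mul_le_mul_of_nonneg_left ?_ hc.le
      gcongr
    have h4 : 0 ≤ (bcoef p F L yδ δ i s * ‖s.m‖) ^ 2 / (4 * p.σ) := by positivity
    have h5 := min_le_left c₁ c₂
    linarith
  · have ht0 := (H.tcoef_eq_zero_iff hs (hyδ i)).2 (not_lt.1 ht)
    have hb : bcoef p F L yδ δ i s ≠ 0 := fun h => hact ⟨ht0, h⟩
    have h2 := H.gain_nonneg hs (hyδ i)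
    have h3 := momentum_active H.σ_pos H.υ₀_pos hd.le hb
    have hb2 := H.bcoef_mem (yδ := yδ) (s := s) hd.le
    have hβ : p.β ≠ 0 := fun h => hb (le_antisymm (hb2.2.trans_eq h) hb2.1)
    have h4 : c₂ ≤ (bcoef p F L yδ δ i s * ‖s.m‖) ^ 2 / (4 * p.σ) := by
      rw [hc₂, if_neg hβ]
      have h0 : 0 ≤ min (2 * p.σ * p.υ₁ * δ i) p.β := le_min (by positivity) H.β_nonneg
      have h5 := mul_le_mul h3.2 h3.1.le (by positivity) hb2.1
      have h6 : 0 ≤ min (2 * p.σ * p.υ₁ * δ i) p.β * (p.υ₀ * δ i) := mul_nonneg h0 (by positivity)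
      exact div_le_div_of_nonneg_right (pow_le_pow_left₀ h6 h5 2) (by positivity)
    have h5 := min_le_right c₁ c₂
    linarith

/-- The method terminates along every path on which each index occurs infinitely often. -/
lemma terminates (hyδ : ∀ i, ‖yδ i - y i‖ ≤ δ i) (hδ : ∀ i, 0 < δ i)
    (hpath : ∀ i, ∃ᶠ n in atTop, path n = i) : Terminates p Θ F L x₀ ξ₀ yδ δ path := by
  obtain ⟨z, hz, -⟩ := H.exists_mem_solSet
  set S := run p Θ F L x₀ ξ₀ yδ δ path with hS
  choose c hc hgain using fun i => H.exists_gain hyδ hδ hz i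
  have : Nonempty (Fin N) := ⟨path 0⟩
  obtain ⟨i₀, hi₀⟩ := Finite.exists_min c
  have hanti := H.antitone_bregR_run (path := path) hyδ hz
  have hlim := tendsto_atTop_ciInf hanti ⟨0, by
    rintro _ ⟨n, rfl⟩; exact H.bregR_run_nonneg hyδ hz.2.1 n⟩
  have hdiff := hlim.sub (hlim.comp (tendsto_add_atTop_nat 1))
  rw [sub_self] at hdiff
  have hnull : ∀ᶠ n in atTop, tcoef p F L yδ δ (path n) (S n) = 0 ∧
      bcoef p F L yδ δ (path n) (S n) = 0 := by
    filter_upwards [hdiff.eventually (gt_mem_nhds (hc i₀))] with n hn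
    by_contra hact
    have h1 := hgain (path n) (S n) (H.inv_run hyδ n) hact
    have h2 := hi₀ (path n)
    have h3 : S (n + 1) = step p Θ F L yδ δ (path n) (S n) := rfl
    simp only [Function.comp_apply] at hn
    rw [← hS, h3] at hn
    linarith
  obtain ⟨n₀, hn₀⟩ := eventually_atTop.1 hnull
  have hI : ∀ n ≥ n₀, (S (n + 1)).I = (S n).I.erase (path n) := fun n hn => by
    rw [hS, run_succ, step_I, if_pos (hn₀ n hn)]
  have hout : ∀ i, ∀ᶠ n in atTop, i ∉ (S n).I := by
    intro i
    obtain ⟨k, hk, hki⟩ := frequently_atTop.1 (hpath i) n₀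
    refine eventually_atTop.2 ⟨k + 1, fun n hn => ?_⟩
    induction n, hn using Nat.le_induction with
    | base => rw [hI k hk, hki]; exact Finset.notMem_erase _ _
    | succ n hn ih =>
      rw [hI n (by omega)]
      exact fun h => ih (Finset.mem_of_mem_erase h)
  obtain ⟨n, hn⟩ := (eventually_all.2 hout).exists
  exact ⟨n, Finset.eq_empty_of_forall_notMem hn⟩

lemma norm_residual_output_le (hyδ : ∀ i, ‖yδ i - y i‖ ≤ δ i)
    (hterm : Terminates p Θ F L x₀ ξ₀ yδ δ path) (i : Fin N) :
    ‖F i (output p Θ F L x₀ ξ₀ yδ δ path).x - yδ i‖ ≤ p.τ * δ i := by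
  refine H.norm_residual_le_of_notMem hyδ _ i ?_
  have : (run p Θ F L x₀ ξ₀ yδ δ path (stopIndex p Θ F L x₀ ξ₀ yδ δ path)).I = ∅ :=
    Nat.sInf_mem hterm
  rw [this]
  exact Finset.notMem_empty i

/-- Once an iterate solves the system, all later iterates coincide with it. -/
lemma run_x_eq_of_isSolution (hyδ : ∀ i, ‖yδ i - y i‖ ≤ δ i) {k n : ℕ} (hkn : k ≤ n)
    (hk : ∀ i, F i (run p Θ F L x₀ ξ₀ yδ δ path k).x = y i) :
    (run p Θ F L x₀ ξ₀ yδ δ path n).x = (run p Θ F L x₀ ξ₀ yδ δ path k).x := by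
  have hinv := H.inv_run (path := path) hyδ
  have hz : (run p Θ F L x₀ ξ₀ yδ δ path k).x ∈ solSet Θ x₀ F y ρ :=
    ⟨H.ball_of_inv (hinv k), (hinv k).mem, hk⟩
  have h1 := H.antitone_bregR_run (path := path) hyδ hz hkn
  have h2 := H.le_bregR (hinv n).mem (hinv n).sub (hinv k).mem
  simp only [bregR_self] at h1
  have h3 := H.σ_pos
  have h4 : ‖(run p Θ F L x₀ ξ₀ yδ δ path k).x - (run p Θ F L x₀ ξ₀ yδ δ path n).x‖ ^ 2 ≤ 0 :=
    nonpos_of_mul_nonpos_right (h2.trans h1) h3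
  exact (sub_eq_zero.1 (norm_eq_zero.1 (pow_eq_zero_iff two_ne_zero |>.1
    (le_antisymm h4 (sq_nonneg _))))).symm

end Problem

end Run

/-! ### Convergence of the method with exact data -/

/-- Lower semicontinuity of the Bregman distance in its first argument. -/
lemma bregR_le_of_tendsto {X : Type*} [NormedAddCommGroup X] [InnerProductSpace ℝ X]
    {Θ : X → EReal} (hp : IsProper Θ) (hl : LowerSemicontinuous Θ) {ι : Type*} {f : Filter ι}
    [f.NeBot] {u : ι → X} {x : X} (hu : Tendsto u f (𝓝 x)) {ξ a : X} {c : ℝ}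
    (h : ∀ ε > 0, ∀ᶠ n in f, u n ∈ effDom Θ ∧ bregR Θ ξ (u n) a ≤ c + ε) :
    x ∈ effDom Θ ∧ bregR Θ ξ x a ≤ c := by
  have hin : Tendsto (fun n => inner ℝ ξ (u n - a)) f (𝓝 (inner ℝ ξ (x - a))) :=
    tendsto_const_nhds.inner (hu.sub_const a)
  have hM : ∀ ε > 0, x ∈ effDom Θ ∧
      (Θ x).toReal ≤ (Θ a).toReal + inner ℝ ξ (x - a) + c + ε := fun ε hε =>
    mem_effDom_of_tendsto hp hl hu <| by
      filter_upwards [h (ε / 2) (by positivity),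
        hin.eventually (gt_mem_nhds (lt_add_of_pos_right _ (half_pos hε)))] with n hn hn2
      refine ⟨hn.1, ?_⟩
      have := hn.2
      unfold bregR at this
      linarith
  refine ⟨(hM 1 one_pos).1, le_of_forall_pos_le_add fun ε hε => ?_⟩
  have := (hM ε hε).2
  unfold bregR
  linarith

/-- A nonnegative null sequence which stays zero once it is zero attains a running minimum
infinitely often. -/
lemma frequently_running_min {E : ℕ → ℝ} (hE : ∀ n, 0 ≤ E n) (hlim : Tendsto E atTop (𝓝 0))
    (hzero : ∀ m n, m ≤ n → E m = 0 → E n = 0) : ∃ᶠ k in atTop, ∀ j ≤ k, E k ≤ E j := by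
  rw [frequently_atTop]
  intro M
  by_cases h0 : ∃ m, E m = 0
  · obtain ⟨m, hm⟩ := h0
    refine ⟨max M m, le_max_left _ _, fun j _ => ?_⟩
    rw [hzero m _ (le_max_right _ _) hm]
    exact hE j
  · push Not at h0
    obtain ⟨a, haM, ha⟩ := Finset.exists_min_image (Finset.range (M + 1)) E ⟨0, by simp⟩
    have hpos : 0 < E a := lt_of_le_of_ne (hE a) (Ne.symm (h0 a))
    have hex : ∃ n, E n < E a := (hlim.eventually (gt_mem_nhds hpos)).exists
    classical
    refine ⟨Nat.find hex, ?_, fun j hj => ?_⟩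
    · by_contra hlt
      have := ha (Nat.find hex) (Finset.mem_range.2 (by omega))
      exact absurd (Nat.find_spec hex) (not_lt.2 this)
    · rcases hj.lt_or_eq with hlt | rfl
      · exact (Nat.find_spec hex).le.trans (not_lt.1 (Nat.find_min hex hlt))
      · exact le_rfl

/-- The sequence `V_{n+1} = C E_n + β V_n` that dominates the increments of the dual iterates. -/
def geomConv (C β : ℝ) (E : ℕ → ℝ) : ℕ → ℝ
  | 0 => 0
  | n + 1 => C * E n + β * geomConv C β E n

lemma geomConv_nonneg {C β : ℝ} {E : ℕ → ℝ} (hC : 0 ≤ C) (hβ : 0 ≤ β) (hE : ∀ n, 0 ≤ E n)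
    (n : ℕ) : 0 ≤ geomConv C β E n := by
  induction n with
  | zero => exact le_rfl
  | succ n ih => exact add_nonneg (mul_nonneg hC (hE n)) (mul_nonneg hβ ih)

lemma sum_geomConv_le {C β : ℝ} {E : ℕ → ℝ} (hC : 0 ≤ C) (hβ : 0 ≤ β) (hβ1 : β < 1)
    (hE : ∀ n, 0 ≤ E n) (hs : Summable E) (n : ℕ) :
    ∑ j ∈ Finset.range n, geomConv C β E (j + 1) ≤ C / (1 - β) * ∑' j, E j := by
  have h1 : ∑ j ∈ Finset.range n, geomConv C β E (j + 1) =
      C * ∑ j ∈ Finset.range n, E j + β * ∑ j ∈ Finset.range n, geomConv C β E j := by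
    rw [Finset.mul_sum, Finset.mul_sum, ← Finset.sum_add_distrib]
    exact Finset.sum_congr rfl fun j _ => rfl
  have h2 : ∑ j ∈ Finset.range n, geomConv C β E j ≤
      ∑ j ∈ Finset.range n, geomConv C β E (j + 1) := by
    have h3 := Finset.sum_range_succ' (geomConv C β E) n
    have h4 := Finset.sum_range_succ (geomConv C β E) n
    have h5 : geomConv C β E 0 = 0 := rfl
    have h6 := geomConv_nonneg hC hβ hE n
    linarith
  have h3 : C * ∑ j ∈ Finset.range n, E j ≤ C * ∑' j, E j :=
    mul_le_mul_of_nonneg_left (hs.sum_le_tsum _ fun j _ => hE j) hC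
  have h4 := mul_le_mul_of_nonneg_left h2 hβ
  have hb : 0 < 1 - β := by linarith
  rw [div_mul_eq_mul_div, le_div_iff₀ hb]
  linarith

section Exact

set_option linter.unusedSectionVars false

variable {N : ℕ} {X : Type*} [NormedAddCommGroup X] [InnerProductSpace ℝ X] [CompleteSpace X]
  {Y : Fin N → Type*} [∀ i, NormedAddCommGroup (Y i)] [∀ i, NormedSpace ℝ (Y i)]
  {p : Params} {Θ : X → EReal} {x₀ ξ₀ : X} {F : ∀ i, X → Y i}
  {L : ∀ i, X → X →L[ℝ] Y i} {y : ∀ i, Y i} {ρ B₀ : ℝ} {path : ℕ → Fin N}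
  {i : Fin N} {s : State N X}

/-- The run of the method with exact data, that is, with noise levels `0`. -/
noncomputable def exactRun (p : Params) (Θ : X → EReal) (F : ∀ i, X → Y i)
    (L : ∀ i, X → X →L[ℝ] Y i) (x₀ ξ₀ : X) (y : ∀ i, Y i) (path : ℕ → Fin N) (n : ℕ) :
    State N X :=
  run p Θ F L x₀ ξ₀ y (fun _ => 0) path n

/-- The squared residual of the whole system. -/
def resSq (F : ∀ i, X → Y i) (y : ∀ i, Y i) (x : X) : ℝ := ∑ i, ‖F i x - y i‖ ^ 2

lemma resSq_nonneg (x : X) : 0 ≤ resSq F y x := Finset.sum_nonneg fun _ _ => sq_nonneg _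

lemma norm_sq_le_resSq (i : Fin N) (x : X) : ‖F i x - y i‖ ^ 2 ≤ resSq F y x :=
  Finset.single_le_sum (f := fun i => ‖F i x - y i‖ ^ 2) (fun _ _ => sq_nonneg _)
    (Finset.mem_univ i)

lemma resSq_eq_zero_iff (x : X) : resSq F y x = 0 ↔ ∀ i, F i x = y i := by
  unfold resSq
  rw [Finset.sum_eq_zero_iff_of_nonneg fun _ _ => sq_nonneg _]
  simp [sub_eq_zero]

namespace Problem

variable (H : Problem p Θ x₀ ξ₀ F L y ρ B₀)
include H

lemma inv_exactRun (n : ℕ) : Inv p Θ x₀ ξ₀ F y ρ (exactRun p Θ F L x₀ ξ₀ y path n) :=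
  H.inv_run (fun i => by simp) n

lemma exactRun_mem_ball (n : ℕ) :
    (exactRun p Θ F L x₀ ξ₀ y path n).x ∈ Metric.closedBall x₀ (2 * ρ) :=
  H.ball_of_inv (H.inv_exactRun n)

lemma antitone_bregR_exactRun {z : X} (hz : z ∈ solSet Θ x₀ F y ρ) :
    Antitone fun n => bregR Θ (exactRun p Θ F L x₀ ξ₀ y path n).ξ z
      (exactRun p Θ F L x₀ ξ₀ y path n).x :=
  H.antitone_bregR_run (fun i => by simp) hz

lemma bregR_exact_step_le (hs : Inv p Θ x₀ ξ₀ F y ρ s) {z : X} (hz : z ∈ solSet Θ x₀ F y ρ) :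
    bregR Θ (step p Θ F L y (fun _ => 0) i s).ξ z (step p Θ F L y (fun _ => 0) i s).x +
      cdesc p B₀ * ‖F i s.x - y i‖ ^ 2 ≤ bregR Θ s.ξ z s.x := by
  have hy : ‖y i - y i‖ ≤ (fun _ : Fin N => (0 : ℝ)) i := by simp
  have h1 := H.bregR_step_le (yδ := y) (δ := fun _ => 0) (i := i) hs hy hz
  have hσ := H.σ_pos
  have h2 : 0 ≤ (bcoef p F L y (fun _ => 0) i s * ‖s.m‖) ^ 2 / (4 * p.σ) := by positivity
  by_cases h : p.τ * (fun _ : Fin N => (0 : ℝ)) i < ‖F i s.x - y i‖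
  · have h3 := H.le_gain (yδ := y) (δ := fun _ => 0) (i := i) hs hy h
    linarith
  · have h3 : ‖F i s.x - y i‖ = 0 := by
      simp only [mul_zero, not_lt] at h
      exact le_antisymm h (norm_nonneg _)
    have h4 := H.gain_nonneg (yδ := y) (δ := fun _ => 0) (i := i) hs hy
    rw [h3] at h1 h4 ⊢
    linarith

/-- The residuals selected along a path are square summable. -/
lemma sum_selected_residuals_le {z : X} (hz : z ∈ solSet Θ x₀ F y ρ) (n : ℕ) :
    cdesc p B₀ * ∑ j ∈ Finset.range n,
      ‖F (path j) (exactRun p Θ F L x₀ ξ₀ y path j).x - y (path j)‖ ^ 2 ≤ bregR Θ ξ₀ z x₀ := by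
  suffices h : bregR Θ (exactRun p Θ F L x₀ ξ₀ y path n).ξ z
      (exactRun p Θ F L x₀ ξ₀ y path n).x + cdesc p B₀ * ∑ j ∈ Finset.range n,
      ‖F (path j) (exactRun p Θ F L x₀ ξ₀ y path j).x - y (path j)‖ ^ 2 ≤ bregR Θ ξ₀ z x₀ by
    have h1 := H.bregR_nonneg (H.inv_exactRun (path := path) n).mem (H.inv_exactRun n).sub hz.2.1
    linarith
  induction n with
  | zero => simp [exactRun, run]
  | succ n ih =>
    have h1 := H.bregR_exact_step_le (i := path n) (H.inv_exactRun (path := path) n) hz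
    rw [Finset.sum_range_succ, mul_add]
    unfold exactRun at h1 ih ⊢
    rw [run_succ]
    linarith

/-- With exact data the increment of the dual iterate vanishes only if the residual, the step size
and the momentum coefficient do, so that `γ` vanishes too. -/
lemma exact_γ_eq_zero (hs : Inv p Θ x₀ ξ₀ F y ρ s)
    (hm : (step p Θ F L y (fun _ => 0) i s).m = 0) :
    (step p Θ F L y (fun _ => 0) i s).γ = 0 := by
  obtain ⟨z, hz, -⟩ := H.exists_mem_solSet
  have hξ : (step p Θ F L y (fun _ => 0) i s).ξ = s.ξ := sub_eq_zero.1 hm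
  have hx : (step p Θ F L y (fun _ => 0) i s).x = s.x := by
    rw [step_x, hξ, H.argminTilt_eq hs.mem hs.sub]
  have h1 := H.bregR_exact_step_le (i := i) hs hz
  rw [hξ, hx] at h1
  have h2 : ‖F i s.x - y i‖ ^ 2 ≤ 0 :=
    nonpos_of_mul_nonpos_right (by linarith) H.cdesc_pos
  have h3 : ‖F i s.x - y i‖ = 0 := pow_eq_zero_iff two_ne_zero |>.1 (le_antisymm h2 (sq_nonneg _))
  have ht : tcoef p F L y (fun _ => 0) i s = 0 := stepSize_eq_zero (by simp [h3])
  have hb : bcoef p F L y (fun _ => 0) i s = 0 := by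
    rw [step_m, ht, zero_smul, neg_zero, zero_add, smul_eq_zero] at hm
    rcases hm with hm | hm
    · exact hm
    · simp [bcoef, momentum, hm]
  rw [step_γ, hx, ht, hb, sub_self, inner_zero_right]
  simp

/-- If the residual at `x_k` is not larger than the one at the current iterate, then the gradient
step is almost orthogonal to `x_k - z` for all solutions `z`. -/
lemma abs_inner_tcoef_grad_le (hs : Inv p Θ x₀ ξ₀ F y ρ s) {z u : X}
    (hz : z ∈ solSet Θ x₀ F y ρ) (hu : u ∈ Metric.closedBall x₀ (2 * ρ))
    (hle : resSq F y u ≤ resSq F y s.x) :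
    |inner ℝ (tcoef p F L y (fun _ => 0) i s • grad p F L y i s) (u - z)| ≤
      3 * p.μ₁ * (1 + p.η) * resSq F y s.x := by
  have hb := H.ball_of_inv hs
  set R := ‖F i s.x - y i‖ with hR
  have h1 : ‖L i s.x (u - z)‖ ≤ (1 + p.η) * (‖F i u - y i‖ + 2 * R) := by
    have h2 : L i s.x (u - z) = L i s.x (s.x - z) - L i s.x (s.x - u) := by
      rw [← map_sub]; congr 1; abel
    have h3 := H.norm_L_le (i := i) hb hz.1
    have h4 := H.norm_L_le (i := i) hb hu
    rw [hz.2.2 i] at h3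
    have h5 : ‖F i s.x - F i u‖ ≤ R + ‖F i u - y i‖ := by
      rw [← sub_sub_sub_cancel_right _ _ (y i)]; exact norm_sub_le _ _
    have h6 : 0 ≤ 1 + p.η := by linarith [H.η_nonneg]
    have h7 := mul_le_mul_of_nonneg_left h5 h6
    rw [h2]
    have h8 := norm_sub_le (L i s.x (s.x - z)) (L i s.x (s.x - u))
    linarith
  have h2 : |inner ℝ (grad p F L y i s) (u - z)| ≤ R ^ (p.r - 1) * ‖L i s.x (u - z)‖ := by
    unfold grad
    rw [inner_adj, ← Real.norm_eq_abs]
    refine (ContinuousLinearMap.le_opNorm _ _).trans ?_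
    rw [norm_dualityMap H.one_lt_r]
  have ht := H.tcoef_nonneg (yδ := y) (δ := fun _ => 0) (i := i) (s := s)
  rw [real_inner_smul_left, abs_mul, abs_of_nonneg ht]
  have h3 := H.tcoef_mul_rpow_le (yδ := y) (δ := fun _ => 0) (i := i) (s := s)
  have h4 : ‖F i u - y i‖ ^ 2 ≤ resSq F y s.x := (norm_sq_le_resSq i u).trans hle
  have h5 : R ^ 2 ≤ resSq F y s.x := norm_sq_le_resSq i s.x
  have h6 : 0 ≤ R := norm_nonneg _
  have hμ := H.μ₁_pos
  have hη := H.η_nonneg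
  have h7 : R * (‖F i u - y i‖ + 2 * R) ≤ 3 * resSq F y s.x := by
    nlinarith [sq_nonneg (R - ‖F i u - y i‖)]
  calc _ ≤ tcoef p F L y (fun _ => 0) i s * (R ^ (p.r - 1) * ‖L i s.x (u - z)‖) :=
        mul_le_mul_of_nonneg_left h2 ht
    _ = (tcoef p F L y (fun _ => 0) i s * R ^ (p.r - 1)) * ‖L i s.x (u - z)‖ := by ring
    _ ≤ (p.μ₁ * R) * ((1 + p.η) * (‖F i u - y i‖ + 2 * R)) :=
        mul_le_mul h3 h1 (norm_nonneg _) (by positivity)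
    _ = p.μ₁ * (1 + p.η) * (R * (‖F i u - y i‖ + 2 * R)) := by ring
    _ ≤ p.μ₁ * (1 + p.η) * (3 * resSq F y s.x) :=
        mul_le_mul_of_nonneg_left h7 (by positivity)
    _ = _ := by ring

lemma abs_inner_m_le {z : X} (hz : z ∈ solSet Θ x₀ F y ρ) {k : ℕ}
    (hk : ∀ j ≤ k, resSq F y (exactRun p Θ F L x₀ ξ₀ y path k).x ≤
      resSq F y (exactRun p Θ F L x₀ ξ₀ y path j).x) (n : ℕ) (hn : n ≤ k + 1) :
    |inner ℝ (exactRun p Θ F L x₀ ξ₀ y path n).m ((exactRun p Θ F L x₀ ξ₀ y path k).x - z)| ≤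
      geomConv (3 * p.μ₁ * (1 + p.η)) p.β
        (fun j => resSq F y (exactRun p Θ F L x₀ ξ₀ y path j).x) n := by
  induction n with
  | zero => simp [exactRun, run, State.m, geomConv]
  | succ n ih =>
    have h1 := H.abs_inner_tcoef_grad_le (i := path n) (H.inv_exactRun (path := path) n) hz
      (H.exactRun_mem_ball k) (hk n (by omega))
    have h2 := ih (by omega)
    have hb := H.bcoef_mem (yδ := y) (δ := fun _ => 0) (i := path n)
      (s := exactRun p Θ F L x₀ ξ₀ y path n) le_rfl
    have h3 : (exactRun p Θ F L x₀ ξ₀ y path (n + 1)).m =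
      -(tcoef p F L y (fun _ => 0) (path n) (exactRun p Θ F L x₀ ξ₀ y path n) •
        grad p F L y (path n) (exactRun p Θ F L x₀ ξ₀ y path n)) +
      bcoef p F L y (fun _ => 0) (path n) (exactRun p Θ F L x₀ ξ₀ y path n) •
        (exactRun p Θ F L x₀ ξ₀ y path n).m := step_m
    rw [h3, inner_add_left, inner_neg_left]
    refine (abs_add_le _ _).trans (add_le_add ((abs_neg _).trans_le h1) ?_)
    rw [real_inner_smul_left, abs_mul, abs_of_nonneg hb.1]
    exact mul_le_mul hb.2 h2 (abs_nonneg _) H.β_nonneg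

/-- The dual iterates between two steps are almost orthogonal to `x_k - z`, when the residual at
`x_k` is the smallest so far. -/
lemma inner_ξ_sub_le {z : X} (hz : z ∈ solSet Θ x₀ F y ρ) {a k : ℕ} (hak : a ≤ k)
    (hk : ∀ j ≤ k, resSq F y (exactRun p Θ F L x₀ ξ₀ y path k).x ≤
      resSq F y (exactRun p Θ F L x₀ ξ₀ y path j).x) :
    inner ℝ ((exactRun p Θ F L x₀ ξ₀ y path k).ξ - (exactRun p Θ F L x₀ ξ₀ y path a).ξ)
      ((exactRun p Θ F L x₀ ξ₀ y path k).x - z) ≤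
      ∑ j ∈ Finset.range k, geomConv (3 * p.μ₁ * (1 + p.η)) p.β
        (fun j => resSq F y (exactRun p Θ F L x₀ ξ₀ y path j).x) (j + 1) -
      ∑ j ∈ Finset.range a, geomConv (3 * p.μ₁ * (1 + p.η)) p.β
        (fun j => resSq F y (exactRun p Θ F L x₀ ξ₀ y path j).x) (j + 1) := by
  rw [← Finset.sum_Ico_eq_sub _ hak,
    ← Finset.sum_Ico_sub (fun j => (exactRun p Θ F L x₀ ξ₀ y path j).ξ) hak, sum_inner]
  refine Finset.sum_le_sum fun j hj => ?_
  exact (le_abs_self _).trans (H.abs_inner_m_le hz hk (j + 1) (by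
    have := (Finset.mem_Ico.1 hj).2; omega))

end Problem

end Exact

section ExactConvergence

set_option linter.unusedSectionVars false

variable {N : ℕ} {X : Type*} [NormedAddCommGroup X] [InnerProductSpace ℝ X] [CompleteSpace X]
  {Y : Fin N → Type*} [∀ i, NormedAddCommGroup (Y i)] [∀ i, NormedSpace ℝ (Y i)]
  {p : Params} {Θ : X → EReal} {x₀ ξ₀ : X} {F : ∀ i, X → Y i}
  {L : ∀ i, X → X →L[ℝ] Y i} {y : ∀ i, Y i} {ρ B₀ : ℝ} {path : ℕ → Fin N}

lemma bregR_eq_sub_add (ξ ξ' z a b : X) :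
    bregR Θ ξ b a = bregR Θ ξ z a - bregR Θ ξ' z b + inner ℝ (ξ' - ξ) (b - z) := by
  simp only [bregR, inner_sub_left, inner_sub_right]
  ring

namespace Problem

variable (H : Problem p Θ x₀ ξ₀ F L y ρ B₀)
include H

lemma exact_ξ_sub_perp {w : X}
    (hw : ∀ i, ∀ x ∈ Metric.closedBall x₀ (2 * ρ), ∀ φ, inner ℝ (adj (L i x) φ) w = 0) (n : ℕ) :
    inner ℝ (exactRun p Θ F L x₀ ξ₀ y path n).m w = 0 ∧
      inner ℝ ((exactRun p Θ F L x₀ ξ₀ y path n).ξ - ξ₀) w = 0 := by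
  induction n with
  | zero => simp [exactRun, run, State.m]
  | succ n ih =>
    have h1 := hw (path n) _ (H.exactRun_mem_ball (path := path) n)
      (dualityMap p.r (F (path n) (exactRun p Θ F L x₀ ξ₀ y path n).x - y (path n)))
    have h2 : (exactRun p Θ F L x₀ ξ₀ y path (n + 1)).m =
      -(tcoef p F L y (fun _ => 0) (path n) (exactRun p Θ F L x₀ ξ₀ y path n) •
        grad p F L y (path n) (exactRun p Θ F L x₀ ξ₀ y path n)) +
      bcoef p F L y (fun _ => 0) (path n) (exactRun p Θ F L x₀ ξ₀ y path n) •
        (exactRun p Θ F L x₀ ξ₀ y path n).m := step_m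
    have h3 : inner ℝ (exactRun p Θ F L x₀ ξ₀ y path (n + 1)).m w = 0 := by
      rw [h2, inner_add_left, inner_neg_left, real_inner_smul_left, real_inner_smul_left, ih.1,
        grad, h1]
      simp
    refine ⟨h3, ?_⟩
    have h4 : (exactRun p Θ F L x₀ ξ₀ y path (n + 1)).ξ - ξ₀ =
      (exactRun p Θ F L x₀ ξ₀ y path (n + 1)).m +
        ((exactRun p Θ F L x₀ ξ₀ y path n).ξ - ξ₀) := by
      change _ = ((exactRun p Θ F L x₀ ξ₀ y path (n + 1)).ξ -
        (exactRun p Θ F L x₀ ξ₀ y path n).ξ) + _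
      abel
    rw [h4, inner_add_left, h3, ih.2, add_zero]

/-- With exact data the iterates converge to a solution along every path with square summable
residuals. Along the running minima of the residuals the iterates form a Cauchy sequence; by the
monotonicity of the Bregman distance to the limit, convergence extends to the whole sequence. -/
theorem exact_convergence
    (hsum : Summable fun n => resSq F y (exactRun p Θ F L x₀ ξ₀ y path n).x) :
    ∃ xs ∈ solSet Θ x₀ F y ρ,
      Tendsto (fun n => bregR Θ (exactRun p Θ F L x₀ ξ₀ y path n).ξ xs
        (exactRun p Θ F L x₀ ξ₀ y path n).x) atTop (𝓝 0) ∧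
      (∀ z ∈ solSet Θ x₀ F y ρ, bregR Θ ξ₀ xs x₀ ≤ bregR Θ ξ₀ z x₀ +
        3 * p.μ₁ * (1 + p.η) / (1 - p.β) *
          ∑' n, resSq F y (exactRun p Θ F L x₀ ξ₀ y path n).x) ∧
      ∀ z ∈ solSet Θ x₀ F y ρ,
        (∀ i, ∀ x ∈ Metric.closedBall x₀ (2 * ρ), ∀ φ, inner ℝ (adj (L i x) φ) (xs - z) = 0) →
        bregR Θ ξ₀ xs x₀ ≤ bregR Θ ξ₀ z x₀ := by
  have hσ := H.σ_pos
  set S := exactRun p Θ F L x₀ ξ₀ y path with hS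
  set E : ℕ → ℝ := fun n => resSq F y (S n).x with hE
  set C : ℝ := 3 * p.μ₁ * (1 + p.η) with hC
  have hC0 : 0 ≤ C := by
    have := H.μ₁_pos
    have := H.η_nonneg
    positivity
  set V : ℕ → ℝ := fun n => ∑ j ∈ Finset.range n, geomConv C p.β E (j + 1) with hV
  have hE0 : ∀ n, 0 ≤ E n := fun n => resSq_nonneg _
  have hVmono : Monotone V := monotone_nat_of_le_succ fun n => by
    simp only [hV, Finset.sum_range_succ]
    exact le_add_of_nonneg_right (geomConv_nonneg hC0 H.β_nonneg hE0 _)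
  have hVle : ∀ n, V n ≤ C / (1 - p.β) * ∑' j, E j :=
    sum_geomConv_le hC0 H.β_nonneg H.β_lt hE0 hsum
  have hVlim := tendsto_atTop_ciSup hVmono ⟨_, by rintro _ ⟨n, rfl⟩; exact hVle n⟩
  set V' : ℝ := ⨆ n, V n with hV'
  have hVV' : ∀ n, V n ≤ V' := hVmono.ge_of_tendsto hVlim
  have hinv : ∀ n, Inv p Θ x₀ ξ₀ F y ρ (S n) := H.inv_exactRun
  obtain ⟨z₀, hz₀, -⟩ := H.exists_mem_solSet
  -- the running minima of the residuals
  have hfreq : ∃ᶠ k in atTop, ∀ j ≤ k, E k ≤ E j := by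
    refine frequently_running_min hE0 hsum.tendsto_atTop_zero fun m n hmn hm => ?_
    have hm' := (resSq_eq_zero_iff _).1 hm
    have : (S n).x = (S m).x := H.run_x_eq_of_isSolution (by simp) hmn hm'
    simpa only [hE, this] using hm
  obtain ⟨κ, hκ, hrec⟩ := extraction_of_frequently_atTop hfreq
  have hκt := hκ.tendsto_atTop
  -- `Q` is decreasing and controls the Bregman distances between iterates
  set Q : X → ℕ → ℝ := fun z n => bregR Θ (S n).ξ z (S n).x - V n with hQ
  have hkey : ∀ z ∈ solSet Θ x₀ F y ρ, ∀ a n, a ≤ κ n →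
      bregR Θ (S a).ξ (S (κ n)).x (S a).x ≤ Q z a - Q z (κ n) := by
    intro z hz a n han
    have h1 := H.inner_ξ_sub_le hz han (hrec n)
    rw [bregR_eq_sub_add (S a).ξ (S (κ n)).ξ z]
    simp only [hQ]
    have h2 : inner ℝ ((S (κ n)).ξ - (S a).ξ) ((S (κ n)).x - z) ≤ V (κ n) - V a := h1
    linarith
  have hQanti : Antitone (Q z₀) := fun a b hab =>
    sub_le_sub (H.antitone_bregR_exactRun hz₀ hab) (hVmono hab)
  have hQlim := tendsto_atTop_ciInf hQanti ⟨-V', by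
    rintro _ ⟨n, rfl⟩
    have h1 := H.bregR_nonneg (hinv n).mem (hinv n).sub hz₀.2.1
    have h2 := hVV' n
    simp only [hQ]
    linarith⟩
  set q : ℝ := ⨅ n, Q z₀ n with hq
  have hqQ : ∀ n, q ≤ Q z₀ n := hQanti.le_of_tendsto hQlim
  have hkey' : ∀ a n, a ≤ κ n → bregR Θ (S a).ξ (S (κ n)).x (S a).x ≤ Q z₀ a - q :=
    fun a n han => (hkey z₀ hz₀ a n han).trans (sub_le_sub_left (hqQ _) _)
  have hcau : CauchySeq fun n => (S (κ n)).x := by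
    rw [Metric.cauchySeq_iff']
    intro ε hε
    have hev := (hQlim.comp hκt).eventually (gt_mem_nhds (show q < q + p.σ * ε ^ 2 by
      have : 0 < p.σ * ε ^ 2 := by positivity
      linarith))
    obtain ⟨n₀, hn₀⟩ := hev.exists
    refine ⟨n₀, fun n hn => ?_⟩
    have h1 := hkey' (κ n₀) n (hκ.monotone hn)
    have h2 := H.le_bregR (hinv (κ n₀)).mem (hinv (κ n₀)).sub (hinv (κ n)).mem
    rw [dist_eq_norm]
    have h4 : p.σ * ‖(S (κ n)).x - (S (κ n₀)).x‖ ^ 2 < p.σ * ε ^ 2 := by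
      simp only [Function.comp_apply] at hn₀
      linarith
    exact lt_of_pow_lt_pow_left₀ 2 hε.le (lt_of_mul_lt_mul_left h4 hσ.le)
  obtain ⟨xs, hxs⟩ := cauchySeq_tendsto_of_complete hcau
  have hlim : ∀ a, xs ∈ effDom Θ ∧ bregR Θ (S a).ξ xs (S a).x ≤ Q z₀ a - q := fun a =>
    bregR_le_of_tendsto H.proper H.lsc hxs fun ε hε => by
      filter_upwards [hκt.eventually_ge_atTop a] with n hn
      exact ⟨(hinv _).mem, (hkey' a n hn).trans (le_add_of_nonneg_right hε.le)⟩
  have hball : xs ∈ Metric.closedBall x₀ (2 * ρ) :=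
    Metric.isClosed_closedBall.mem_of_tendsto hxs
      (Eventually.of_forall fun n => H.exactRun_mem_ball _)
  have hsolves : ∀ i, F i xs = y i := by
    intro i
    have h1 : Tendsto (fun n => F i (S (κ n)).x) atTop (𝓝 (F i xs)) :=
      H.tendsto_F (Eventually.of_forall fun n => H.exactRun_mem_ball _) hball hxs
    have h2 : Tendsto (fun n => ‖F i (S n).x - y i‖ ^ 2) atTop (𝓝 0) :=
      squeeze_zero (fun _ => sq_nonneg _) (fun n => norm_sq_le_resSq i _)
        hsum.tendsto_atTop_zero
    have h3 : Tendsto (fun n => ‖F i (S n).x - y i‖) atTop (𝓝 0) := by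
      have := h2.sqrt
      simpa [Real.sqrt_sq] using this
    exact tendsto_nhds_unique h1 (tendsto_iff_norm_sub_tendsto_zero.2 (h3.comp hκt))
  have hsol : xs ∈ solSet Θ x₀ F y ρ := ⟨hball, (hlim 0).1, hsolves⟩
  have hS0ξ : (S 0).ξ = ξ₀ := rfl
  have hS0x : (S 0).x = x₀ := rfl
  refine ⟨xs, hsol, ?_, ?_, ?_⟩
  · rw [tendsto_iff_tendsto_subseq_of_antitone (H.antitone_bregR_exactRun hsol) hκt]
    have h1 : Tendsto (fun n => Q z₀ (κ n) - q) atTop (𝓝 0) := by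
      simpa using (hQlim.comp hκt).sub_const q
    exact squeeze_zero (fun n => H.bregR_nonneg (hinv _).mem (hinv _).sub hsol.2.1)
      (fun n => (hlim (κ n)).2) h1
  · intro z hz
    refine (bregR_le_of_tendsto H.proper H.lsc hxs (ξ := ξ₀) (a := x₀) fun ε hε => ?_).2
    filter_upwards with n
    refine ⟨(hinv _).mem, ?_⟩
    have h1 := hkey z hz 0 n (Nat.zero_le _)
    have h2 := H.bregR_nonneg (hinv (κ n)).mem (hinv (κ n)).sub hz.2.1
    have h3 := hVle (κ n)
    have h4 : V 0 = 0 := by simp [hV]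
    simp only [hQ, h4, hS0ξ, hS0x] at h1
    linarith
  · intro z hz hperp
    refine (bregR_le_of_tendsto H.proper H.lsc hxs (ξ := ξ₀) (a := x₀) fun ε hε => ?_).2
    obtain ⟨a, ha⟩ := (hVlim.eventually (lt_mem_nhds
      (show V' - ε / 2 < V' by linarith))).exists
    -- for fixed `a` the vector `ξ_a - ξ₀` is orthogonal to `xs - z`
    have h0 : Tendsto (fun n => inner ℝ ((S a).ξ - ξ₀) ((S (κ n)).x - z)) atTop (𝓝 0) := by
      have h1 : Tendsto (fun n => inner ℝ ((S a).ξ - ξ₀) ((S (κ n)).x - z)) atTop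
          (𝓝 (inner ℝ ((S a).ξ - ξ₀) (xs - z))) := tendsto_const_nhds.inner (hxs.sub_const z)
      rwa [(H.exact_ξ_sub_perp hperp a).2] at h1
    filter_upwards [hκt.eventually_ge_atTop a,
      h0.eventually (gt_mem_nhds (half_pos hε))] with n hn hn2
    refine ⟨(hinv _).mem, ?_⟩
    have h1 := H.inner_ξ_sub_le hz hn (hrec n)
    have h2 : inner ℝ ((S (κ n)).ξ - (S a).ξ) ((S (κ n)).x - z) ≤ V (κ n) - V a := h1
    have h3 := hVV' (κ n)
    have h4 := H.bregR_nonneg (hinv (κ n)).mem (hinv (κ n)).sub hz.2.1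
    have h5 : inner ℝ ((S (κ n)).ξ - ξ₀) ((S (κ n)).x - z) =
        inner ℝ ((S (κ n)).ξ - (S a).ξ) ((S (κ n)).x - z) +
          inner ℝ ((S a).ξ - ξ₀) ((S (κ n)).x - z) := by
      rw [← inner_add_left]; congr 1; abel
    rw [bregR_eq_sub_add ξ₀ (S (κ n)).ξ z]
    linarith

end Problem

end ExactConvergence

/-! ### Stability with respect to the noise -/

/-- The momentum coefficient depends continuously on its arguments as the noise level tends to `0`,
as long as the increment does not degenerate. -/
lemma tendsto_momentum {p : Params} (hσ : 0 < p.σ) (hυ₁ : 0 < p.υ₁) (hβ : 0 ≤ p.β)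
    {t gm γ normm d : ℕ → ℝ} {t' gm' γ' normm' : ℝ}
    (htgm : Tendsto (fun l => t l * gm l) atTop (𝓝 (t' * gm'))) (hγ : Tendsto γ atTop (𝓝 γ'))
    (hm : Tendsto normm atTop (𝓝 normm')) (hm' : 0 < normm') (hd : ∀ l, 0 ≤ d l)
    (hd0 : Tendsto d atTop (𝓝 0)) :
    Tendsto (fun l => momentum p (t l) (gm l) (γ l) (normm l) (d l)) atTop
      (𝓝 (momentum p t' gm' γ' normm' 0)) := by
  -- the clipped value of the minimizer, to which the momentum coefficient is close
  let φ : ℝ → ℝ → ℝ := fun a M => min (max (a / M ^ 2) 0) p.β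
  have hclose : ∀ t gm γ M d : ℝ, 0 ≤ d → 0 < M → p.υ₀ * d < M →
      momentum p t gm γ M d ≤ φ (t * gm - 2 * p.σ * γ) M ∧
      φ (t * gm - 2 * p.σ * γ) M - 2 * p.σ * p.υ₁ * d ≤ momentum p t gm γ M d := by
    intro t gm γ M d hd hM hυd
    have hpos : 0 ≤ 2 * p.σ * p.υ₁ * d := by positivity
    unfold momentum
    split_ifs with h
    · have h1 : 0 ≤ (t * gm - 2 * p.σ * γ) / M ^ 2 :=
        div_nonneg (le_trans (by positivity) ((momentum_cond_iff hσ).1 h.2).le) (sq_nonneg _)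
      simp only [φ, max_eq_left h1]
      exact ⟨le_rfl, by linarith⟩
    · have h2 : t * gm - 2 * p.σ * γ ≤ 2 * p.σ * p.υ₁ * d * M ^ 2 := by
        by_contra! h3
        exact h ⟨hυd, (momentum_cond_iff hσ).2 h3⟩
      have h3 : (t * gm - 2 * p.σ * γ) / M ^ 2 ≤ 2 * p.σ * p.υ₁ * d := by
        rwa [div_le_iff₀ (by positivity)]
      refine ⟨le_min (le_max_right _ _) hβ, ?_⟩
      have h4 : φ (t * gm - 2 * p.σ * γ) M ≤ 2 * p.σ * p.υ₁ * d :=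
        (min_le_left _ _).trans (max_le h3 hpos)
      linarith
  have hφ : Tendsto (fun l => φ (t l * gm l - 2 * p.σ * γ l) (normm l)) atTop
      (𝓝 (φ (t' * gm' - 2 * p.σ * γ') normm')) :=
    (((htgm.sub (hγ.const_mul _)).div (hm.pow 2) (by positivity)).max tendsto_const_nhds).min
      tendsto_const_nhds
  have hlimit : momentum p t' gm' γ' normm' 0 = φ (t' * gm' - 2 * p.σ * γ') normm' := by
    have h := hclose t' gm' γ' normm' 0 le_rfl hm' (by simpa using hm')
    simp only [mul_zero, sub_zero] at h
    exact le_antisymm h.1 h.2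
  rw [hlimit]
  have hlow : Tendsto (fun l => φ (t l * gm l - 2 * p.σ * γ l) (normm l)
      - 2 * p.σ * p.υ₁ * d l) atTop (𝓝 (φ (t' * gm' - 2 * p.σ * γ') normm')) := by
    simpa using hφ.sub (hd0.const_mul (2 * p.σ * p.υ₁))
  have hυd : Tendsto (fun l => normm l - p.υ₀ * d l) atTop (𝓝 normm') := by
    simpa using hm.sub (hd0.const_mul p.υ₀)
  have hev : ∀ᶠ l in atTop, 0 < normm l ∧ p.υ₀ * d l < normm l := by
    filter_upwards [hm.eventually (lt_mem_nhds hm'), hυd.eventually (lt_mem_nhds hm')] with l h1 h2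
    exact ⟨h1, by linarith⟩
  refine tendsto_of_tendsto_of_tendsto_of_le_of_le' hlow hφ ?_ ?_
  · filter_upwards [hev] with l hl using (hclose _ _ _ _ _ (hd l) hl.1 hl.2).2
  · filter_upwards [hev] with l hl using (hclose _ _ _ _ _ (hd l) hl.1 hl.2).1

section Stability

set_option linter.unusedSectionVars false

variable {N : ℕ} {X : Type*} [NormedAddCommGroup X] [InnerProductSpace ℝ X] [CompleteSpace X]
  {Y : Fin N → Type*} [∀ i, NormedAddCommGroup (Y i)] [∀ i, NormedSpace ℝ (Y i)]
  {p : Params} {Θ : X → EReal} {x₀ ξ₀ : X} {F : ∀ i, X → Y i}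
  {L : ∀ i, X → X →L[ℝ] Y i} {y : ∀ i, Y i} {ρ B₀ : ℝ} {yδ : ℕ → ∀ i, Y i}
  {δ : ℕ → Fin N → ℝ} {path : ℕ → Fin N} {i : Fin N} {s : State N X} {ss : ℕ → State N X}

/-- Convergence of the numerical components of a sequence of states. -/
structure StateTendsto (ss : ℕ → State N X) (s : State N X) : Prop where
  ξ : Tendsto (fun l => (ss l).ξ) atTop (𝓝 s.ξ)
  m : Tendsto (fun l => (ss l).m) atTop (𝓝 s.m)
  x : Tendsto (fun l => (ss l).x) atTop (𝓝 s.x)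
  γ : Tendsto (fun l => (ss l).γ) atTop (𝓝 s.γ)

lemma tendsto_data (hyδ : ∀ l i, ‖yδ l i - y i‖ ≤ δ l i)
    (hδ0 : ∀ i, Tendsto (fun l => δ l i) atTop (𝓝 0)) (i : Fin N) :
    Tendsto (fun l => yδ l i) atTop (𝓝 (y i)) :=
  tendsto_iff_norm_sub_tendsto_zero.2
    (squeeze_zero (fun _ => norm_nonneg _) (fun l => hyδ l i) (hδ0 i))

namespace Problem

variable (H : Problem p Θ x₀ ξ₀ F L y ρ B₀)
include H

lemma tendsto_residual (hyδ : ∀ l i, ‖yδ l i - y i‖ ≤ δ l i)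
    (hδ0 : ∀ i, Tendsto (fun l => δ l i) atTop (𝓝 0)) (hs : Inv p Θ x₀ ξ₀ F y ρ s)
    (hss : ∀ l, Inv p Θ x₀ ξ₀ F y ρ (ss l))
    (hlim : Tendsto (fun l => (ss l).x) atTop (𝓝 s.x)) (i : Fin N) :
    Tendsto (fun l => F i (ss l).x - yδ l i) atTop (𝓝 (F i s.x - y i)) :=
  (H.tendsto_F (Eventually.of_forall fun l => H.ball_of_inv (hss l)) (H.ball_of_inv hs) hlim).sub
    (tendsto_data hyδ hδ0 i)

/-- The gradient step is stable. Where the exact residual vanishes, the step size itself need not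
converge, but its products with the gradient and with powers of the residual do. -/
lemma tendsto_tcoef_mul (hyδ : ∀ l i, ‖yδ l i - y i‖ ≤ δ l i)
    (hδ0 : ∀ i, Tendsto (fun l => δ l i) atTop (𝓝 0)) (hs : Inv p Θ x₀ ξ₀ F y ρ s)
    (hss : ∀ l, Inv p Θ x₀ ξ₀ F y ρ (ss l))
    (hlim : Tendsto (fun l => (ss l).x) atTop (𝓝 s.x)) :
    Tendsto (fun l => tcoef p F L (yδ l) (δ l) i (ss l) • grad p F L (yδ l) i (ss l)) atTop
        (𝓝 (tcoef p F L y (fun _ => 0) i s • grad p F L y i s)) ∧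
      Tendsto (fun l => tcoef p F L (yδ l) (δ l) i (ss l) *
        ‖F i (ss l).x - yδ l i‖ ^ (p.r - 1)) atTop
        (𝓝 (tcoef p F L y (fun _ => 0) i s * ‖F i s.x - y i‖ ^ (p.r - 1))) := by
  have hres := H.tendsto_residual hyδ hδ0 hs hss hlim i
  have hR := hres.norm
  have hball : ∀ l, (ss l).x ∈ Metric.closedBall x₀ (2 * ρ) := fun l => H.ball_of_inv (hss l)
  by_cases h0 : F i s.x - y i = 0
  · have ht : tcoef p F L y (fun _ => 0) i s = 0 := stepSize_eq_zero (by simp [h0])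
    rw [ht, zero_smul, zero_mul]
    rw [h0, norm_zero] at hR
    have h2 : Tendsto (fun l => tcoef p F L (yδ l) (δ l) i (ss l) *
        ‖F i (ss l).x - yδ l i‖ ^ (p.r - 1)) atTop (𝓝 0) :=
      squeeze_zero (fun l => mul_nonneg H.tcoef_nonneg (by positivity))
        (fun l => H.tcoef_mul_rpow_le) (by simpa using hR.const_mul p.μ₁)
    refine ⟨squeeze_zero_norm (fun l => ?_) (by simpa using h2.const_mul B₀), h2⟩
    rw [norm_smul, Real.norm_of_nonneg H.tcoef_nonneg]
    calc _ ≤ tcoef p F L (yδ l) (δ l) i (ss l) *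
          (B₀ * ‖F i (ss l).x - yδ l i‖ ^ (p.r - 1)) :=
          mul_le_mul_of_nonneg_left (H.norm_grad_le (hball l)) H.tcoef_nonneg
      _ = _ := by ring
  · have hRpos : 0 < ‖F i s.x - y i‖ := norm_pos_iff.2 h0
    have hg : Tendsto (fun l => grad p F L (yδ l) i (ss l)) atTop (𝓝 (grad p F L y i s)) :=
      tendsto_adj (H.tendsto_L (Eventually.of_forall hball) (H.ball_of_inv hs) hlim)
        (tendsto_dualityMap (H.smooth i) H.one_lt_r h0 hres)
    have hact : p.τ * (fun _ : Fin N => (0 : ℝ)) i < ‖F i s.x - y i‖ := by simpa using hRpos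
    have hgpos : 0 < ‖grad p F L y i s‖ :=
      H.grad_ne_zero (δ := fun _ => 0) hs (by simp) hact
    have hq : Tendsto (fun l => ‖F i (ss l).x - yδ l i‖ ^ (p.r - 1)) atTop
        (𝓝 (‖F i s.x - y i‖ ^ (p.r - 1))) := hR.rpow_const (Or.inl hRpos.ne')
    have hev : ∀ᶠ l in atTop, p.τ * δ l i < ‖F i (ss l).x - yδ l i‖ := by
      have h1 : Tendsto (fun l => ‖F i (ss l).x - yδ l i‖ - p.τ * δ l i) atTop
          (𝓝 ‖F i s.x - y i‖) := by simpa using hR.sub ((hδ0 i).const_mul p.τ)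
      filter_upwards [h1.eventually (lt_mem_nhds hRpos)] with l hl
      linarith
    have ht : Tendsto (fun l => tcoef p F L (yδ l) (δ l) i (ss l)) atTop
        (𝓝 (tcoef p F L y (fun _ => 0) i s)) := by
      have h1 : Tendsto (fun l => min (p.μ₀ * ((1 - p.η) * ‖F i (ss l).x - yδ l i‖
            - (1 + p.η) * δ l i) * ‖F i (ss l).x - yδ l i‖ ^ (p.r - 1) /
              ‖grad p F L (yδ l) i (ss l)‖ ^ 2)
            (p.μ₁ * ‖F i (ss l).x - yδ l i‖ ^ (2 - p.r))) atTop
          (𝓝 (min (p.μ₀ * ((1 - p.η) * ‖F i s.x - y i‖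
            - (1 + p.η) * 0) * ‖F i s.x - y i‖ ^ (p.r - 1) / ‖grad p F L y i s‖ ^ 2)
            (p.μ₁ * ‖F i s.x - y i‖ ^ (2 - p.r)))) :=
        ((((((hR.const_mul _).sub ((hδ0 i).const_mul _)).const_mul _).mul hq).div
          (hg.norm.pow 2) (by positivity))).min
          ((hR.rpow_const (Or.inl hRpos.ne')).const_mul _)
      have h2 : tcoef p F L y (fun _ => 0) i s = min (p.μ₀ * ((1 - p.η) * ‖F i s.x - y i‖
            - (1 + p.η) * 0) * ‖F i s.x - y i‖ ^ (p.r - 1) / ‖grad p F L y i s‖ ^ 2)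
            (p.μ₁ * ‖F i s.x - y i‖ ^ (2 - p.r)) := if_pos hact
      rw [h2]
      refine h1.congr' ?_
      filter_upwards [hev] with l hl
      exact (if_pos hl).symm
    exact ⟨ht.smul hg, ht.mul hq⟩

/-- The momentum term is stable: where the exact increment vanishes, so does the exact `γ`. -/
lemma tendsto_bcoef_mul (hyδ : ∀ l i, ‖yδ l i - y i‖ ≤ δ l i)
    (hδ0 : ∀ i, Tendsto (fun l => δ l i) atTop (𝓝 0)) (hs : Inv p Θ x₀ ξ₀ F y ρ s)
    (hss : ∀ l, Inv p Θ x₀ ξ₀ F y ρ (ss l)) (hlim : StateTendsto ss s)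
    (hγ : s.m = 0 → s.γ = 0) :
    Tendsto (fun l => bcoef p F L (yδ l) (δ l) i (ss l) • (ss l).m) atTop
        (𝓝 (bcoef p F L y (fun _ => 0) i s • s.m)) ∧
      Tendsto (fun l => bcoef p F L (yδ l) (δ l) i (ss l) * (ss l).γ) atTop
        (𝓝 (bcoef p F L y (fun _ => 0) i s * s.γ)) := by
  have hδ : ∀ l, 0 ≤ δ l i := fun l => (norm_nonneg _).trans (hyδ l i)
  have hb : ∀ l, bcoef p F L (yδ l) (δ l) i (ss l) ∈ Set.Icc 0 p.β :=
    fun l => H.bcoef_mem (hδ l)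
  by_cases h0 : s.m = 0
  · have hγ0 := hγ h0
    have h1 := hlim.m.norm
    have h2 := hlim.γ.norm
    rw [h0, norm_zero] at h1
    rw [hγ0, norm_zero] at h2
    rw [h0, hγ0, smul_zero, mul_zero]
    constructor
    · refine squeeze_zero_norm (fun l => ?_) (by simpa using h1.const_mul p.β)
      rw [norm_smul, Real.norm_of_nonneg (hb l).1]
      exact mul_le_mul_of_nonneg_right (hb l).2 (norm_nonneg _)
    · refine squeeze_zero_norm (fun l => ?_) (by simpa using h2.const_mul p.β)
      rw [norm_mul, Real.norm_of_nonneg (hb l).1]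
      exact mul_le_mul_of_nonneg_right (hb l).2 (norm_nonneg _)
  · have htgm : Tendsto (fun l => tcoef p F L (yδ l) (δ l) i (ss l) *
        inner ℝ (grad p F L (yδ l) i (ss l)) (ss l).m) atTop
        (𝓝 (tcoef p F L y (fun _ => 0) i s * inner ℝ (grad p F L y i s) s.m)) := by
      simp only [← real_inner_smul_left]
      exact (H.tendsto_tcoef_mul hyδ hδ0 hs hss hlim.x).1.inner hlim.m
    have hbl : Tendsto (fun l => bcoef p F L (yδ l) (δ l) i (ss l)) atTop
        (𝓝 (bcoef p F L y (fun _ => 0) i s)) :=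
      tendsto_momentum H.σ_pos H.υ₁_pos H.β_nonneg htgm hlim.γ hlim.m.norm (norm_pos_iff.2 h0)
        hδ (hδ0 i)
    exact ⟨hbl.smul hlim.m, hbl.mul hlim.γ⟩

lemma stateTendsto_step (hyδ : ∀ l i, ‖yδ l i - y i‖ ≤ δ l i)
    (hδ0 : ∀ i, Tendsto (fun l => δ l i) atTop (𝓝 0)) (hs : Inv p Θ x₀ ξ₀ F y ρ s)
    (hss : ∀ l, Inv p Θ x₀ ξ₀ F y ρ (ss l)) (hlim : StateTendsto ss s)
    (hγ : s.m = 0 → s.γ = 0) :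
    StateTendsto (fun l => step p Θ F L (yδ l) (δ l) i (ss l))
      (step p Θ F L y (fun _ => 0) i s) := by
  obtain ⟨htg, htq⟩ := H.tendsto_tcoef_mul (i := i) hyδ hδ0 hs hss hlim.x
  obtain ⟨hbm, hbγ⟩ := H.tendsto_bcoef_mul (i := i) hyδ hδ0 hs hss hlim hγ
  have hσ := H.σ_pos
  have hξ : Tendsto (fun l => (step p Θ F L (yδ l) (δ l) i (ss l)).ξ) atTop
      (𝓝 (step p Θ F L y (fun _ => 0) i s).ξ) := by
    simp only [step_ξ]
    exact (hlim.ξ.sub htg).add hbm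
  have hm : Tendsto (fun l => (step p Θ F L (yδ l) (δ l) i (ss l)).m) atTop
      (𝓝 (step p Θ F L y (fun _ => 0) i s).m) := by
    simp only [step_m]
    exact htg.neg.add hbm
  have hx : Tendsto (fun l => (step p Θ F L (yδ l) (δ l) i (ss l)).x) atTop
      (𝓝 (step p Θ F L y (fun _ => 0) i s).x) := by
    have h1 := tendsto_iff_norm_sub_tendsto_zero.1 hξ
    rw [tendsto_iff_norm_sub_tendsto_zero]
    refine squeeze_zero (fun _ => norm_nonneg _) (fun l => ?_)
      (by simpa using h1.div_const (2 * p.σ))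
    exact H.norm_sub_le_of_subdiff (H.argminTilt_mem _) (H.mem_subdiff_argminTilt _)
      (H.argminTilt_mem _) (H.mem_subdiff_argminTilt _)
  refine ⟨hξ, hm, hx, ?_⟩
  have hR := (H.tendsto_residual hyδ hδ0 hs hss hlim.x i).norm
  have hlast : Tendsto (fun l => δ l i * (tcoef p F L (yδ l) (δ l) i (ss l) *
      ‖F i (ss l).x - yδ l i‖ ^ (p.r - 1))) atTop (𝓝 0) := by
    simpa using (hδ0 i).mul htq
  have hall := (((hm.inner (hx.sub hlim.x)).sub ((hR.mul htq).const_mul (1 - p.η))).add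
    (hlast.const_mul (1 + p.η))).add hbγ
  convert hall using 2
  · rw [step_γ, rpow_eq_mul_sub_one H.one_lt_r (norm_nonneg _)]
    ring
  · rw [step_γ, rpow_eq_mul_sub_one H.one_lt_r (norm_nonneg _)]
    ring

/-- For a fixed number of steps, the method depends continuously on the data at noise level `0`. -/
lemma stateTendsto_run (hyδ : ∀ l i, ‖yδ l i - y i‖ ≤ δ l i)
    (hδ0 : ∀ i, Tendsto (fun l => δ l i) atTop (𝓝 0)) (n : ℕ) :
    StateTendsto (fun l => run p Θ F L x₀ ξ₀ (yδ l) (δ l) path n)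
      (exactRun p Θ F L x₀ ξ₀ y path n) := by
  induction n with
  | zero => exact ⟨tendsto_const_nhds, tendsto_const_nhds, tendsto_const_nhds, tendsto_const_nhds⟩
  | succ n ih =>
    refine H.stateTendsto_step hyδ hδ0 (H.inv_exactRun n) (fun l => H.inv_run (hyδ l) n) ih ?_
    rcases n with _ | n
    · exact fun _ => rfl
    · exact H.exact_γ_eq_zero (H.inv_exactRun n)

lemma tendsto_bregR (hs : Inv p Θ x₀ ξ₀ F y ρ s) (hss : ∀ l, Inv p Θ x₀ ξ₀ F y ρ (ss l))
    (hlim : StateTendsto ss s) (z : X) :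
    Tendsto (fun l => bregR Θ (ss l).ξ z (ss l).x) atTop (𝓝 (bregR Θ s.ξ z s.x)) := by
  have hx0 := hlim.x.sub_const s.x
  rw [sub_self] at hx0
  have hθ : Tendsto (fun l => (Θ (ss l).x).toReal - (Θ s.x).toReal) atTop (𝓝 0) := by
    have h1 : Tendsto (fun l => inner ℝ s.ξ ((ss l).x - s.x)) atTop (𝓝 0) := by
      simpa using (tendsto_const_nhds (x := s.ξ)).inner hx0
    have h2 : Tendsto (fun l => inner ℝ (ss l).ξ ((ss l).x - s.x)) atTop (𝓝 0) := by
      simpa using hlim.ξ.inner hx0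
    refine tendsto_of_tendsto_of_tendsto_of_le_of_le h1 h2 (fun l => ?_) (fun l => ?_)
    · have := H.bregR_nonneg hs.mem hs.sub (hss l).mem
      simp only [bregR] at this
      linarith
    · have := H.bregR_nonneg (hss l).mem (hss l).sub hs.mem
      rw [bregR, ← neg_sub (ss l).x, inner_neg_right] at this
      linarith
  have h3 : Tendsto (fun l => (Θ (ss l).x).toReal) atTop (𝓝 (Θ s.x).toReal) := by
    simpa using hθ.add_const (Θ s.x).toReal
  exact (tendsto_const_nhds.sub h3).sub (hlim.ξ.inner (tendsto_const_nhds.sub hlim.x))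

lemma tendsto_of_bregR_tendsto (hss : ∀ l, Inv p Θ x₀ ξ₀ F y ρ (ss l)) {z : X}
    (hz : z ∈ effDom Θ) (h : Tendsto (fun l => bregR Θ (ss l).ξ z (ss l).x) atTop (𝓝 0)) :
    Tendsto (fun l => (ss l).x) atTop (𝓝 z) := by
  have h1 : Tendsto (fun l => ‖(ss l).x - z‖ ^ 2) atTop (𝓝 0) := by
    refine squeeze_zero (fun _ => sq_nonneg _) (fun l => ?_) (by simpa using h.div_const p.σ)
    rw [le_div_iff₀ H.σ_pos, norm_sub_rev, mul_comm]
    exact H.le_bregR (hss l).mem (hss l).sub hz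
  rw [tendsto_iff_norm_sub_tendsto_zero]
  simpa [Real.sqrt_sq] using h1.sqrt

/-- Convergence of the stopped iterates along a path. Late stopping is controlled by monotonicity
and stability; if the method stops infinitely often at the same step, then the exact iterate of
that step solves the system. -/
theorem tendsto_bregR_output (hyδ : ∀ l i, ‖yδ l i - y i‖ ≤ δ l i)
    (hδ0 : ∀ i, Tendsto (fun l => δ l i) atTop (𝓝 0))
    (hterm : ∀ l, Terminates p Θ F L x₀ ξ₀ (yδ l) (δ l) path) {xs : X}
    (hxs : xs ∈ solSet Θ x₀ F y ρ)
    (hconv : Tendsto (fun n => bregR Θ (exactRun p Θ F L x₀ ξ₀ y path n).ξ xs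
        (exactRun p Θ F L x₀ ξ₀ y path n).x) atTop (𝓝 0)) :
    Tendsto (fun l => bregR Θ (output p Θ F L x₀ ξ₀ (yδ l) (δ l) path).ξ xs
      (output p Θ F L x₀ ξ₀ (yδ l) (δ l) path).x) atTop (𝓝 0) := by
  set S := exactRun p Θ F L x₀ ξ₀ y path with hS
  set T : ℕ → ℕ → State N X := fun l => run p Θ F L x₀ ξ₀ (yδ l) (δ l) path with hT
  set k : ℕ → ℕ := fun l => stopIndex p Θ F L x₀ ξ₀ (yδ l) (δ l) path with hk
  have hTinv : ∀ l n, Inv p Θ x₀ ξ₀ F y ρ (T l n) := fun l n => H.inv_run (hyδ l) n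
  have hSinv : ∀ n, Inv p Θ x₀ ξ₀ F y ρ (S n) := H.inv_exactRun
  have hst : ∀ n, StateTendsto (fun l => T l n) (S n) := H.stateTendsto_run hyδ hδ0
  have hbr : ∀ n, Tendsto (fun l => bregR Θ (T l n).ξ xs (T l n).x) atTop
      (𝓝 (bregR Θ (S n).ξ xs (S n).x)) := fun n =>
    H.tendsto_bregR (hSinv n) (fun l => hTinv l n) (hst n) xs
  have hxlim : Tendsto (fun n => (S n).x) atTop (𝓝 xs) :=
    H.tendsto_of_bregR_tendsto hSinv hxs.2.1 hconv
  have hrepeat : ∀ j, (∃ᶠ l in atTop, k l = j) → bregR Θ (S j).ξ xs (S j).x = 0 := by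
    intro j hj
    have hsolves : ∀ i, F i (S j).x = y i := by
      intro i
      have h1 := (H.tendsto_residual hyδ hδ0 (hSinv j) (fun l => hTinv l j) (hst j).x i).norm
      have h2 : Tendsto (fun l => ‖F i (T l j).x - yδ l i‖ - p.τ * δ l i) atTop
          (𝓝 ‖F i (S j).x - y i‖) := by simpa using h1.sub ((hδ0 i).const_mul p.τ)
      have h3 : ‖F i (S j).x - y i‖ ≤ 0 := le_of_tendsto_of_frequently h2 <| hj.mono fun l hl => by
        have h4 := H.norm_residual_output_le (hyδ l) (hterm l) i
        have h5 : output p Θ F L x₀ ξ₀ (yδ l) (δ l) path = T l j := by rw [← hl]; rfl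
        rw [h5] at h4
        linarith
      exact sub_eq_zero.1 (norm_le_zero_iff.1 h3)
    have hconst : ∀ᶠ n in atTop, (S n).x = (S j).x := by
      filter_upwards [eventually_ge_atTop j] with n hn
      exact H.run_x_eq_of_isSolution (by simp) hn hsolves
    have : xs = (S j).x := tendsto_nhds_unique_of_eventuallyEq hxlim tendsto_const_nhds hconst
    rw [this, bregR_self]
  rw [Metric.tendsto_nhds]
  intro ε hε
  obtain ⟨n, hn⟩ := (hconv.eventually (gt_mem_nhds hε)).exists
  have hearly : ∀ j, ∀ᶠ l in atTop, k l = j → bregR Θ (T l j).ξ xs (T l j).x < ε := by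
    intro j
    by_cases hj : ∃ᶠ l in atTop, k l = j
    · have := hbr j
      rw [hrepeat j hj] at this
      filter_upwards [this.eventually (gt_mem_nhds hε)] with l hl using fun _ => hl
    · filter_upwards [not_frequently.1 hj] with l hl using fun h => absurd h hl
  have hearly' : ∀ᶠ l in atTop, ∀ j ∈ Finset.range n,
      k l = j → bregR Θ (T l j).ξ xs (T l j).x < ε :=
    (Finset.eventually_all _).2 fun j _ => hearly j
  filter_upwards [hearly', (hbr n).eventually (gt_mem_nhds hn)] with l h1 h2
  have hout : output p Θ F L x₀ ξ₀ (yδ l) (δ l) path = T l (k l) := rfl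
  rw [hout, Real.dist_eq, sub_zero,
    abs_of_nonneg (H.bregR_nonneg (hTinv l _).mem (hTinv l _).sub hxs.2.1)]
  rcases lt_or_ge (k l) n with h | h
  · exact h1 (k l) (Finset.mem_range.2 h) rfl
  · exact (H.antitone_bregR_run (path := path) (hyδ l) hxs h).trans_lt h2

end Problem

end Stability

/-! ### The minimal solution -/

section Minimal

set_option linter.unusedSectionVars false

variable {N : ℕ} {X : Type*} [NormedAddCommGroup X] [InnerProductSpace ℝ X] [CompleteSpace X]
  {Y : Fin N → Type*} [∀ i, NormedAddCommGroup (Y i)] [∀ i, NormedSpace ℝ (Y i)]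
  {p : Params} {Θ : X → EReal} {x₀ ξ₀ : X} {F : ∀ i, X → Y i}
  {L : ∀ i, X → X →L[ℝ] Y i} {y : ∀ i, Y i} {ρ B₀ : ℝ} {domF : Fin N → Set X}

namespace Problem

variable (H : Problem p Θ x₀ ξ₀ F L y ρ B₀)
include H

lemma L_sub_eq_zero {i : Fin N} {x z : X} (hx : x ∈ Metric.closedBall x₀ (2 * ρ))
    (hz : z ∈ Metric.closedBall x₀ (2 * ρ)) (h : F i x = F i z) : L i x (x - z) = 0 := by
  have := H.norm_L_le (i := i) hx hz
  rw [h, sub_self, norm_zero, mul_zero] at this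
  exact norm_le_zero_iff.1 this

/-- By the tangential cone condition the solutions in the ball form a convex set. -/
lemma midpoint_mem {x z : X}
    (hx : x ∈ {w | w ∈ Metric.closedBall x₀ (2 * ρ) ∧ ∀ i, F i w = y i})
    (hz : z ∈ {w | w ∈ Metric.closedBall x₀ (2 * ρ) ∧ ∀ i, F i w = y i}) :
    (1 / 2 : ℝ) • x + (1 / 2 : ℝ) • z ∈
      {w | w ∈ Metric.closedBall x₀ (2 * ρ) ∧ ∀ i, F i w = y i} := by
  have hw : (1 / 2 : ℝ) • x + (1 / 2 : ℝ) • z ∈ Metric.closedBall x₀ (2 * ρ) :=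
    convex_closedBall x₀ (2 * ρ) hx.1 hz.1 (by norm_num) (by norm_num) (by norm_num)
  refine ⟨hw, fun i => ?_⟩
  have h1 : L i x (x - z) = 0 := H.L_sub_eq_zero hx.1 hz.1 ((hx.2 i).trans (hz.2 i).symm)
  have h2 : x - ((1 / 2 : ℝ) • x + (1 / 2 : ℝ) • z) = (1 / 2 : ℝ) • (x - z) := by module
  have h3 := H.tcc i x hx.1 _ hw
  rw [h2, map_smul, h1, smul_zero, sub_zero] at h3
  have h4 : ‖F i x - F i ((1 / 2 : ℝ) • x + (1 / 2 : ℝ) • z)‖ ≤ 0 := by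
    nlinarith [H.η_lt, norm_nonneg (F i x - F i ((1 / 2 : ℝ) • x + (1 / 2 : ℝ) • z))]
  rw [← sub_eq_zero.1 (norm_le_zero_iff.1 h4)]
  exact hx.2 i

lemma isClosed_solutions :
    IsClosed {w | w ∈ Metric.closedBall x₀ (2 * ρ) ∧ ∀ i, F i w = y i} := by
  refine isClosed_of_closure_subset fun w hw => ?_
  obtain ⟨u, hu, huw⟩ := mem_closure_iff_seq_limit.1 hw
  have hball : w ∈ Metric.closedBall x₀ (2 * ρ) :=
    Metric.isClosed_closedBall.mem_of_tendsto huw (Eventually.of_forall fun n => (hu n).1)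
  refine ⟨hball, fun i => ?_⟩
  have h1 : Tendsto (fun n => F i (u n)) atTop (𝓝 (F i w)) :=
    H.tendsto_F (Eventually.of_forall fun n => (hu n).1) hball huw
  simp only [fun n => (hu n).2 i] at h1
  exact tendsto_nhds_unique h1 tendsto_const_nhds

/-- Minimality among all solutions only needs to be tested in the ball of radius `2 ρ`. -/
lemma isMinimalSolution_iff (hball : ∀ i, Metric.closedBall x₀ (2 * ρ) ⊆ domF i) {x : X} :
    IsMinimalSolution domF F y Θ x₀ ξ₀ x ↔ x ∈ solSet Θ x₀ F y ρ ∧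
      ∀ z ∈ solSet Θ x₀ F y ρ, bregR Θ ξ₀ x x₀ ≤ bregR Θ ξ₀ z x₀ := by
  obtain ⟨z₀, hz₀, hz₀ρ⟩ := H.exists_mem_solSet
  have hsol : ∀ z ∈ solSet Θ x₀ F y ρ, IsSolution domF F y z :=
    fun z hz i => ⟨hball i hz.1, hz.2.2 i⟩
  constructor
  · rintro ⟨hx, hxs, hmin⟩
    have hmin' : ∀ z ∈ solSet Θ x₀ F y ρ, bregR Θ ξ₀ x x₀ ≤ bregR Θ ξ₀ z x₀ := by
      intro z hz
      have := hmin z hz.2.1 (hsol z hz)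
      rw [bregman_eq_coe H.proper hx H.x₀_mem, bregman_eq_coe H.proper hz.2.1 H.x₀_mem] at this
      exact_mod_cast this
    exact ⟨H.mem_solSet_of_bregR_le hx (fun i => (hxs i).2) ((hmin' z₀ hz₀).trans hz₀ρ), hmin'⟩
  · rintro ⟨hx, hmin⟩
    refine ⟨hx.2.1, hsol x hx, fun z hz hzs => ?_⟩
    rw [bregman_eq_coe H.proper hx.2.1 H.x₀_mem, bregman_eq_coe H.proper hz H.x₀_mem]
    norm_cast
    rcases le_or_gt (bregR Θ ξ₀ z x₀) (p.σ * ρ ^ 2) with h | h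
    · exact hmin z (H.mem_solSet_of_bregR_le hz (fun i => (hzs i).2) h)
    · exact (hmin z₀ hz₀).trans (hz₀ρ.trans h.le)

theorem existsUnique_isMinimalSolution (hball : ∀ i, Metric.closedBall x₀ (2 * ρ) ⊆ domF i) :
    ∃! x, IsMinimalSolution domF F y Θ x₀ ξ₀ x := by
  obtain ⟨κ, hκ, hc⟩ := H.conv
  obtain ⟨z₀, hz₀, -⟩ := H.exists_mem_solSet
  have hσ := H.σ_pos
  set C : Set X := {w | w ∈ Metric.closedBall x₀ (2 * ρ) ∧ ∀ i, F i w = y i} with hC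
  have hmem : ∀ z, z ∈ solSet Θ x₀ F y ρ ↔ z ∈ C ∩ effDom Θ := fun z =>
    ⟨fun h => ⟨⟨h.1, h.2.2⟩, h.2.1⟩, fun h => ⟨h.1.1, h.2, h.1.2⟩⟩
  have hbr : ∀ x z : X, bregR Θ ξ₀ x x₀ ≤ bregR Θ ξ₀ z x₀ ↔
      (Θ x).toReal - inner ℝ ξ₀ x ≤ (Θ z).toReal - inner ℝ ξ₀ z := by
    intro x z
    simp only [bregR, inner_sub_right]
    constructor <;> intro h <;> linarith
  have hchar : ∀ x, IsMinimalSolution domF F y Θ x₀ ξ₀ x ↔ x ∈ C ∩ effDom Θ ∧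
      ∀ z ∈ C ∩ effDom Θ, (Θ x).toReal - inner ℝ ξ₀ x ≤ (Θ z).toReal - inner ℝ ξ₀ z := by
    intro x
    rw [H.isMinimalSolution_iff hball]
    simp only [hmem, hbr]
  obtain ⟨x, hx, hmin⟩ := exists_minimizer_on H.proper H.lsc hκ hc ξ₀ H.isClosed_solutions
    (fun _ h1 _ h2 => H.midpoint_mem h1 h2) ⟨z₀, (hmem z₀).1 hz₀⟩
    (m := (Θ x₀).toReal - inner ℝ ξ₀ x₀) (fun z hz => by
      have h1 := H.bregR_nonneg H.x₀_mem H.ξ₀_mem hz.2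
      simp only [bregR, inner_sub_right] at h1
      linarith)
  refine ⟨x, (hchar x).2 ⟨hx, hmin⟩, fun x' hx' => ?_⟩
  obtain ⟨h1, h2⟩ := (hchar x').1 hx'
  exact minimizer_on_unique H.proper hκ hc ξ₀ (fun _ h1 _ h2 => H.midpoint_mem h1 h2) h1 hx h2 hmin

/-- Under the range condition a solution `xs` differs from the minimal solution by a vector that is
orthogonal to all the ranges of the adjoints. If `xs` is at least as good as every solution from
which it differs in this way, then `xs` is the minimal solution. -/
lemma eq_of_range_condition (hball : ∀ i, Metric.closedBall x₀ (2 * ρ) ⊆ domF i) {xs xdag : X}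
    (hxs : xs ∈ solSet Θ x₀ F y ρ)
    (hperp : ∀ z ∈ solSet Θ x₀ F y ρ,
        (∀ i, ∀ x ∈ Metric.closedBall x₀ (2 * ρ), ∀ φ, inner ℝ (adj (L i x) φ) (xs - z) = 0) →
        bregR Θ ξ₀ xs x₀ ≤ bregR Θ ξ₀ z x₀)
    (hdag : IsMinimalSolution domF F y Θ x₀ ξ₀ xdag)
    (hrange : ∀ i, ∀ x ∈ Metric.closedBall x₀ (2 * ρ),
      Set.range (adj (L i x)) ⊆ closure (Set.range (adj (L i xdag)))) : xs = xdag := by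
  obtain ⟨hd, hdmin⟩ := (H.isMinimalSolution_iff hball).1 hdag
  have h1 : bregR Θ ξ₀ xs x₀ ≤ bregR Θ ξ₀ xdag x₀ := by
    refine hperp xdag hd fun i x hx φ => ?_
    have hcl : IsClosed {v : X | inner ℝ v (xs - xdag) = (0 : ℝ)} :=
      isClosed_eq (continuous_id.inner continuous_const) continuous_const
    refine closure_minimal ?_ hcl (hrange i x hx ⟨φ, rfl⟩)
    rintro _ ⟨ψ, rfl⟩
    have h2 : L i xdag (xdag - xs) = 0 :=
      H.L_sub_eq_zero hd.1 hxs.1 ((hd.2.2 i).trans (hxs.2.2 i).symm)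
    change inner ℝ (adj (L i xdag) ψ) (xs - xdag) = 0
    rw [inner_adj, ← neg_sub, map_neg, h2, neg_zero, map_zero]
  have h2 : IsMinimalSolution domF F y Θ x₀ ξ₀ xs :=
    (H.isMinimalSolution_iff hball).2 ⟨hxs, fun z hz => h1.trans (hdmin z hz)⟩
  exact (H.existsUnique_isMinimalSolution hball).unique h2 hdag

end Problem

end Minimal

/-! ### Random index paths -/

section RandomPath

variable {N : ℕ} {Ω : Type*} [MeasurableSpace Ω] {P : Measure Ω} {idx : ℕ → Ω → Fin N}

lemma exists_factor_of_dependsOn [Nonempty (Fin N)] {α : Type*} {n : ℕ} {g : (ℕ → Fin N) → α}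
    (hg : DependsOn g (Set.Iio n)) :
    ∃ g' : (Finset.range n → Fin N) → α, ∀ path, g path = g' fun j => path j := by
  classical
  refine ⟨fun v => g fun j => if h : j ∈ Finset.range n then v ⟨j, h⟩
    else Classical.arbitrary _, fun path => hg fun j hj => ?_⟩
  have : j ∈ Finset.range n := Finset.mem_range.2 hj
  simp only [this, dite_true]

lemma measurable_prefix (hidx : ∀ n, Measurable (idx n)) (n : ℕ) :
    Measurable fun ω => fun j : Finset.range n => idx j ω :=
  measurable_pi_lambda _ fun j => hidx j

lemma measurable_of_dependsOn [Nonempty (Fin N)] (hidx : ∀ n, Measurable (idx n)) {α : Type*}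
    [MeasurableSpace α] {n : ℕ} {g : (ℕ → Fin N) → α} (hg : DependsOn g (Set.Iio n)) :
    Measurable fun ω => g fun j => idx j ω := by
  obtain ⟨g', hg'⟩ := exists_factor_of_dependsOn hg
  simp only [hg']
  exact (measurable_of_countable g').comp (measurable_prefix hidx n)

lemma stronglyMeasurable_of_dependsOn [Nonempty (Fin N)] (hidx : ∀ n, Measurable (idx n))
    {α : Type*} [TopologicalSpace α] {n : ℕ} {g : (ℕ → Fin N) → α}
    (hg : DependsOn g (Set.Iio n)) : StronglyMeasurable fun ω => g fun j => idx j ω := by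
  obtain ⟨g', hg'⟩ := exists_factor_of_dependsOn hg
  simp only [hg']
  exact (StronglyMeasurable.of_discrete (f := g')).comp_measurable (measurable_prefix hidx n)

/-- By the second Borel-Cantelli lemma every index is selected infinitely often. -/
lemma ae_frequently_eq [IsProbabilityMeasure P] (hidx : ∀ n, Measurable (idx n))
    (hindep : iIndepFun idx P) (hunif : ∀ n i, P {ω | idx n ω = i} = (N : ENNReal)⁻¹) :
    ∀ᵐ ω ∂P, ∀ i, ∃ᶠ n in atTop, idx n ω = i := by
  rw [ae_all_iff]
  intro i
  have hmeas : ∀ n, MeasurableSet {ω | idx n ω = i} := fun n =>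
    hidx n (measurableSet_singleton i)
  have hset : iIndepSet (fun n => {ω | idx n ω = i}) P := by
    rw [iIndepSet_iff_meas_biInter hmeas]
    intro s
    exact (iIndepFun_iff_measure_inter_preimage_eq_mul.1 hindep) s (sets := fun _ => {i})
      fun _ _ => measurableSet_singleton i
  have h1 := measure_limsup_eq_one hmeas hset (by
    simp only [hunif]
    exact ENNReal.tsum_const_eq_top_of_ne_zero
      (ENNReal.inv_ne_zero.2 (ENNReal.natCast_ne_top N)))
  have h2 : ∀ᵐ ω ∂P, ω ∈ limsup (fun n => {ω | idx n ω = i}) atTop :=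
    (prob_compl_eq_zero_iff (MeasurableSet.measurableSet_limsup hmeas)).2 h1
  filter_upwards [h2] with ω hω
  rw [mem_limsup_iff_frequently_mem] at hω
  exact hω

/-- Averaging over the selected index: it is independent of the previous ones and uniformly
distributed. -/
lemma lintegral_selected [Nonempty (Fin N)] (hidx : ∀ n, Measurable (idx n))
    (hindep : iIndepFun idx P) (hunif : ∀ n i, P {ω | idx n ω = i} = (N : ENNReal)⁻¹) (n : ℕ)
    {h : Fin N → (ℕ → Fin N) → ENNReal} (hh : ∀ i, DependsOn (h i) (Set.Iio n)) :
    ∫⁻ ω, ∑ i, h i (fun j => idx j ω) ∂P = N * ∫⁻ ω, h (idx n ω) (fun j => idx j ω) ∂P := by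
  have hm : ∀ i, Measurable fun ω => h i fun j => idx j ω :=
    fun i => measurable_of_dependsOn hidx (hh i)
  have hset : ∀ i, MeasurableSet {ω | idx n ω = i} := fun i => hidx n (measurableSet_singleton i)
  have hsel : ∀ i, ∫⁻ ω, Set.indicator {ω | idx n ω = i} (1 : Ω → ENNReal) ω * h i (fun j => idx j ω) ∂P =
      (N : ENNReal)⁻¹ * ∫⁻ ω, h i (fun j => idx j ω) ∂P := by
    intro i
    obtain ⟨g', hg'⟩ := exists_factor_of_dependsOn (hh i)
    have hind : IndepFun (Set.indicator {ω | idx n ω = i} (1 : Ω → ENNReal))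
        (fun ω => h i fun j => idx j ω) P := by
      have h1 := hindep.indepFun_finset {n} (Finset.range n)
        (Finset.disjoint_singleton_left.2 Finset.notMem_range_self) hidx
      have h2 := h1.comp
        (φ := fun v : (({n} : Finset ℕ) → Fin N) =>
          Set.indicator {i} (1 : Fin N → ENNReal) (v ⟨n, Finset.mem_singleton_self n⟩))
        (ψ := g') (measurable_of_countable _) (measurable_of_countable _)
      convert h2 using 1
      · rfl
      · exact funext fun ω => hg' _
    rw [lintegral_mul_eq_lintegral_mul_lintegral_of_indepFun''
      (measurable_one.indicator (hset i)).aemeasurable (hm i).aemeasurable hind,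
      lintegral_indicator_one (hset i), hunif]
  have hsplit : ∀ ω, h (idx n ω) (fun j => idx j ω) =
      ∑ i, Set.indicator {ω | idx n ω = i} (1 : Ω → ENNReal) ω * h i (fun j => idx j ω) := by
    intro ω
    rw [Finset.sum_eq_single (idx n ω)]
    · simp
    · intro i _ hi
      have : ω ∉ {ω | idx n ω = i} := fun h => hi h.symm
      rw [Set.indicator_of_notMem this, zero_mul]
    · simp
  have hN : (N : ENNReal) ≠ 0 := by
    have : 0 < N := Fin.pos_iff_nonempty.2 inferInstance
    exact_mod_cast this.ne'
  simp only [hsplit]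
  have hprod : ∀ i, Measurable fun ω => Set.indicator {ω | idx n ω = i} (1 : Ω → ENNReal) ω *
      h i fun j => idx j ω := fun i => (measurable_one.indicator (hset i)).mul (hm i)
  rw [lintegral_finsetSum _ fun i _ => hm i, lintegral_finsetSum _ fun i _ => hprod i]
  simp only [hsel]
  rw [← Finset.mul_sum, ← mul_assoc, ENNReal.mul_inv_cancel hN (ENNReal.natCast_ne_top N), one_mul]

lemma stronglyMeasurable_stopped {α : Type*} [NormedAddCommGroup α] {k : Ω → ℕ}
    (hk : Measurable k) {u : ℕ → Ω → α} (hu : ∀ n, StronglyMeasurable (u n)) :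
    StronglyMeasurable fun ω => u (k ω) ω := by
  refine stronglyMeasurable_of_tendsto atTop
    (f := fun M => ∑ n ∈ Finset.range M, Set.indicator {ω | k ω = n} (u n))
    (fun M => Finset.stronglyMeasurable_sum _ fun n _ =>
      (hu n).indicator (hk (measurableSet_singleton n))) ?_
  rw [tendsto_pi_nhds]
  intro ω
  refine tendsto_const_nhds.congr' ?_
  filter_upwards [eventually_gt_atTop (k ω)] with M hM
  rw [Finset.sum_apply, Finset.sum_eq_single (k ω)]
  · simp
  · intro n _ hn
    exact Set.indicator_of_notMem (s := {ω | k ω = n}) (fun h => hn (Eq.symm h)) _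
  · exact fun h => absurd (Finset.mem_range.2 hM) h

lemma measurable_sInf_nat {Q : ℕ → Ω → Prop} (hQ : ∀ n, MeasurableSet {ω | Q n ω}) :
    Measurable fun ω => sInf {n | Q n ω} := by
  refine measurable_of_Iic fun n => ?_
  have : (fun ω => sInf {n | Q n ω}) ⁻¹' Set.Iic n =
      (⋃ m ∈ Finset.range (n + 1), {ω | Q m ω}) ∪ ⋂ m, {ω | Q m ω}ᶜ := by
    ext ω
    simp only [Set.mem_preimage, Set.mem_Iic, Set.mem_union, Set.mem_iUnion, Finset.mem_range,
      Set.mem_iInter, Set.mem_compl_iff]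
    constructor
    · intro h
      by_cases hne : {n | Q n ω}.Nonempty
      · exact Or.inl ⟨_, Nat.lt_succ_of_le h, Nat.sInf_mem hne⟩
      · exact Or.inr fun m hm => hne ⟨m, hm⟩
    · rintro (⟨m, hm, hQm⟩ | h)
      · exact (Nat.sInf_le hQm).trans (Nat.le_of_lt_succ hm)
      · have : {n | Q n ω} = ∅ := Set.eq_empty_of_forall_notMem h
        rw [this, Nat.sInf_empty]
        exact Nat.zero_le _
  rw [this]
  exact (Finset.measurableSet_biUnion _ fun m _ => hQ m).union
    (MeasurableSet.iInter fun m => (hQ m).compl)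

end RandomPath

section Random

set_option linter.unusedSectionVars false

variable {N : ℕ} {X : Type*} [NormedAddCommGroup X] [InnerProductSpace ℝ X] [CompleteSpace X]
  {Y : Fin N → Type*} [∀ i, NormedAddCommGroup (Y i)] [∀ i, NormedSpace ℝ (Y i)]
  {p : Params} {Θ : X → EReal} {x₀ ξ₀ : X} {F : ∀ i, X → Y i}
  {L : ∀ i, X → X →L[ℝ] Y i} {y : ∀ i, Y i} {ρ B₀ : ℝ} {yδ : ∀ i, Y i} {δ : Fin N → ℝ}
  {Ω : Type*} [MeasurableSpace Ω] {P : Measure Ω} {idx : ℕ → Ω → Fin N}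

lemma dependsOn_run (n : ℕ) :
    DependsOn (fun path => run p Θ F L x₀ ξ₀ yδ δ path n) (Set.Iio n) :=
  fun _ _ h => run_congr fun j hj => h j hj

lemma measurable_stopIndex [Nonempty (Fin N)] (hidx : ∀ n, Measurable (idx n)) :
    Measurable fun ω => stopIndex p Θ F L x₀ ξ₀ yδ δ fun n => idx n ω := by
  refine measurable_sInf_nat fun n => measurableSet_setOfPred.2 ?_
  exact measurable_of_dependsOn hidx
    (g := fun path => (run p Θ F L x₀ ξ₀ yδ δ path n).I = ∅) (n := n)
    fun _ _ h => congrArg (fun s : State N X => s.I = ∅) (dependsOn_run n h)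

lemma stronglyMeasurable_output [Nonempty (Fin N)] (hidx : ∀ n, Measurable (idx n))
    (f : State N X → X) :
    StronglyMeasurable fun ω => f (output p Θ F L x₀ ξ₀ yδ δ fun n => idx n ω) :=
  stronglyMeasurable_stopped
    (u := fun n ω => f (run p Θ F L x₀ ξ₀ yδ δ (fun j => idx j ω) n))
    (measurable_stopIndex hidx) fun n => stronglyMeasurable_of_dependsOn hidx
      (g := fun path => f (run p Θ F L x₀ ξ₀ yδ δ path n)) (n := n)
      fun _ _ h => congrArg f (dependsOn_run n h)

/-- The sum of the squared residuals of the exact iterates along a path. -/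
noncomputable def totalRes (p : Params) (Θ : X → EReal) (F : ∀ i, X → Y i)
    (L : ∀ i, X → X →L[ℝ] Y i) (x₀ ξ₀ : X) (y : ∀ i, Y i) (path : ℕ → Fin N) : ENNReal :=
  ∑' n, ENNReal.ofReal (resSq F y (exactRun p Θ F L x₀ ξ₀ y path n).x)

lemma measurable_totalRes [Nonempty (Fin N)] (hidx : ∀ n, Measurable (idx n)) :
    Measurable fun ω => totalRes p Θ F L x₀ ξ₀ y fun n => idx n ω := by
  unfold totalRes
  refine Measurable.tsum fun n => measurable_of_dependsOn hidx
    (g := fun path => ENNReal.ofReal (resSq F y (exactRun p Θ F L x₀ ξ₀ y path n).x)) (n := n)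
    fun _ _ h => congrArg (fun s : State N X => ENNReal.ofReal (resSq F y s.x)) (dependsOn_run n h)

lemma summable_of_totalRes_ne_top {path : ℕ → Fin N}
    (h : totalRes p Θ F L x₀ ξ₀ y path ≠ ⊤) :
    Summable (fun n => resSq F y (exactRun p Θ F L x₀ ξ₀ y path n).x) ∧
      ∑' n, resSq F y (exactRun p Θ F L x₀ ξ₀ y path n).x =
        (totalRes p Θ F L x₀ ξ₀ y path).toReal := by
  have h1 := ENNReal.summable_toReal h
  have h2 := ENNReal.tsum_toReal_eq
    (f := fun n => ENNReal.ofReal (resSq F y (exactRun p Θ F L x₀ ξ₀ y path n).x))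
    fun n => ENNReal.ofReal_ne_top
  simp only [ENNReal.toReal_ofReal (resSq_nonneg _)] at h1 h2
  exact ⟨h1, h2.symm⟩

/-- The residuals of the full system are square summable in expectation, since those of the
selected equations are square summable along every path. -/
lemma Problem.lintegral_totalRes_ne_top (H : Problem p Θ x₀ ξ₀ F L y ρ B₀)
    [IsProbabilityMeasure P] [Nonempty (Fin N)] (hidx : ∀ n, Measurable (idx n))
    (hindep : iIndepFun idx P) (hunif : ∀ n i, P {ω | idx n ω = i} = (N : ENNReal)⁻¹) :
    ∫⁻ ω, totalRes p Θ F L x₀ ξ₀ y (fun n => idx n ω) ∂P ≠ ⊤ := by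
  obtain ⟨z, hz, -⟩ := H.exists_mem_solSet
  have hc := H.cdesc_pos
  set h : ℕ → Fin N → (ℕ → Fin N) → ENNReal := fun n i path =>
    ENNReal.ofReal (‖F i (exactRun p Θ F L x₀ ξ₀ y path n).x - y i‖ ^ 2) with hh
  have hdep : ∀ n i, DependsOn (h n i) (Set.Iio n) := fun n i _ _ hp =>
    congrArg (fun s : State N X => ENNReal.ofReal (‖F i s.x - y i‖ ^ 2)) (dependsOn_run n hp)
  have hsum : ∀ n path, ENNReal.ofReal (resSq F y (exactRun p Θ F L x₀ ξ₀ y path n).x) =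
      ∑ i, h n i path := fun n path =>
    ENNReal.ofReal_sum_of_nonneg fun i _ => sq_nonneg _
  have hmeas : ∀ n, Measurable fun ω => h n (idx n ω) fun j => idx j ω := fun n =>
    measurable_of_dependsOn hidx (g := fun path => h n (path n) path) (n := n + 1)
      fun a b hp => by
        have h1 : a n = b n := hp n (Nat.lt_succ_self n)
        have h2 := hdep n (b n) fun j hj => hp j (Nat.lt_succ_of_lt hj)
        simp only [h1, h2]
  have hmeas' : ∀ n, Measurable fun ω => ∑ i, h n i fun j => idx j ω := fun n =>
    Finset.measurable_sum _ fun i _ => measurable_of_dependsOn hidx (hdep n i)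
  have hpath : ∀ ω, ∑' n, h n (idx n ω) (fun j => idx j ω) ≤
      ENNReal.ofReal (bregR Θ ξ₀ z x₀ / cdesc p B₀) := by
    intro ω
    rw [ENNReal.tsum_eq_iSup_nat]
    refine iSup_le fun n => ?_
    rw [hh, ← ENNReal.ofReal_sum_of_nonneg fun i _ => sq_nonneg _]
    refine ENNReal.ofReal_le_ofReal ?_
    rw [le_div_iff₀ hc, mul_comm]
    exact H.sum_selected_residuals_le (path := fun j => idx j ω) hz n
  unfold totalRes
  simp only [hsum]
  rw [lintegral_tsum fun n => (hmeas' n).aemeasurable]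
  simp only [fun n => lintegral_selected hidx hindep hunif n (hdep n)]
  rw [ENNReal.tsum_mul_left, ← lintegral_tsum fun n => (hmeas n).aemeasurable]
  refine ENNReal.mul_ne_top (ENNReal.natCast_ne_top N) (ne_top_of_le_ne_top ?_
    (lintegral_mono hpath))
  rw [lintegral_const, measure_univ, mul_one]
  exact ENNReal.ofReal_ne_top

end Random

/-! ### The random limit and the convergence of expectations -/

section RandomLimit

variable {N : ℕ} {X : Type*} [NormedAddCommGroup X] [InnerProductSpace ℝ X] [CompleteSpace X]
  {Y : Fin N → Type*} [∀ i, NormedAddCommGroup (Y i)] [∀ i, NormedSpace ℝ (Y i)]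
  {p : Params} {Θ : X → EReal} {x₀ ξ₀ : X} {F : ∀ i, X → Y i}
  {L : ∀ i, X → X →L[ℝ] Y i} {y : ∀ i, Y i} {ρ B₀ : ℝ}
  {Ω : Type*} [MeasurableSpace Ω] {P : Measure Ω} {idx : ℕ → Ω → Fin N}

/-- The limits of the exact iterates can be chosen as a random element with values in the set of
solutions; off the event of square summable residuals it is given an arbitrary constant value. -/
lemma Problem.exists_random_limit (H : Problem p Θ x₀ ξ₀ F L y ρ B₀) [Nonempty (Fin N)]
    (hidx : ∀ n, Measurable (idx n)) :
    ∃ xstar : Ω → X, StronglyMeasurable xstar ∧ (∀ ω, xstar ω ∈ solSet Θ x₀ F y ρ) ∧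
      ∀ ω, totalRes p Θ F L x₀ ξ₀ y (fun n => idx n ω) ≠ ⊤ →
        Tendsto (fun n => bregR Θ (exactRun p Θ F L x₀ ξ₀ y (fun n => idx n ω) n).ξ (xstar ω)
          (exactRun p Θ F L x₀ ξ₀ y (fun n => idx n ω) n).x) atTop (𝓝 0) ∧
        (∀ z ∈ solSet Θ x₀ F y ρ, bregR Θ ξ₀ (xstar ω) x₀ ≤ bregR Θ ξ₀ z x₀ +
          3 * p.μ₁ * (1 + p.η) / (1 - p.β) *
            (totalRes p Θ F L x₀ ξ₀ y (fun n => idx n ω)).toReal) ∧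
        ∀ z ∈ solSet Θ x₀ F y ρ,
          (∀ i, ∀ x ∈ Metric.closedBall x₀ (2 * ρ), ∀ φ,
            inner ℝ (adj (L i x) φ) (xstar ω - z) = 0) →
          bregR Θ ξ₀ (xstar ω) x₀ ≤ bregR Θ ξ₀ z x₀ := by
  classical
  obtain ⟨z₀, hz₀, -⟩ := H.exists_mem_solSet
  set G : Set Ω := {ω | totalRes p Θ F L x₀ ξ₀ y (fun n => idx n ω) ≠ ⊤} with hG
  have hGm : MeasurableSet G :=
    (measurable_totalRes (F := F) (L := L) hidx) (measurableSet_singleton ⊤).compl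
  have hex : ∀ ω ∈ G, _ := fun ω hω => H.exact_convergence (path := fun n => idx n ω)
    (summable_of_totalRes_ne_top hω).1
  choose xs hxs hconv hbound hperp using hex
  set xstar : Ω → X := fun ω => if h : ω ∈ G then xs ω h else z₀ with hxstar
  have hval : ∀ ω (h : ω ∈ G), xstar ω = xs ω h := fun ω h => dif_pos h
  refine ⟨xstar, ?_, fun ω => ?_, fun ω hω => ?_⟩
  · refine stronglyMeasurable_of_tendsto atTop
      (f := fun n => G.piecewise
        (fun ω => (exactRun p Θ F L x₀ ξ₀ y (fun n => idx n ω) n).x) fun _ => z₀)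
      (fun n => StronglyMeasurable.piecewise hGm (stronglyMeasurable_of_dependsOn hidx
        (g := fun path => (exactRun p Θ F L x₀ ξ₀ y path n).x) (n := n)
        fun _ _ h => congrArg State.x (dependsOn_run n h)) stronglyMeasurable_const) ?_
    rw [tendsto_pi_nhds]
    intro ω
    by_cases h : ω ∈ G
    · simp only [Set.piecewise_eq_of_mem _ _ _ h, hval ω h]
      exact H.tendsto_of_bregR_tendsto (fun n => H.inv_exactRun n) (hxs ω h).2.1 (hconv ω h)
    · simp only [Set.piecewise_eq_of_notMem _ _ _ h, hxstar, dif_neg h]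
      exact tendsto_const_nhds
  · by_cases h : ω ∈ G
    · rw [hval ω h]; exact hxs ω h
    · rw [hxstar]; simp only [dif_neg h]; exact hz₀
  · have h : ω ∈ G := hω
    rw [hval ω h, ← (summable_of_totalRes_ne_top hω).2]
    exact ⟨hconv ω h, hbound ω h, hperp ω h⟩

end RandomLimit

end HeavyBall

theorem mainTheorem1 {N : ℕ}
    {X : Type*} [NormedAddCommGroup X] [InnerProductSpace ℝ X] [CompleteSpace X]
    {Y : Fin N → Type*} [∀ i, NormedAddCommGroup (Y i)] [∀ i, NormedSpace ℝ (Y i)]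
    [∀ i, CompleteSpace (Y i)]
    -- the function `Θ` and the initial guess
    (p : HeavyBall.Params) (Θ : X → EReal) (x₀ ξ₀ : X)
    (hσ : 0 < p.σ)
    (hproper : HeavyBall.IsProper Θ) (hlsc : LowerSemicontinuous Θ)
    (hconv : ∃ κ : ℝ, 0 < κ ∧ HeavyBall.StronglyConvexWith Θ κ)
    (hΘσ : ∀ x ξ : X, x ∈ HeavyBall.effDom Θ → ξ ∈ HeavyBall.subdiff Θ x →
      ∀ z : X, ((p.σ * ‖z - x‖ ^ 2 : ℝ) : EReal) ≤ HeavyBall.bregman Θ ξ z x)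
    (hx₀ : x₀ ∈ HeavyBall.effDom Θ) (hξ₀ : ξ₀ ∈ HeavyBall.subdiff Θ x₀)
    -- the operators and the exact data
    (domF : Fin N → Set X) (F : ∀ i, X → Y i) (y : ∀ i, Y i)
    (hY : ∀ i, HeavyBall.IsUniformlySmooth (Y i))
    (ρ : ℝ) (hρ : 0 < ρ) (hball : ∀ i, Metric.closedBall x₀ (2 * ρ) ⊆ domF i)
    (hsol : ∃ z, z ∈ HeavyBall.effDom Θ ∧ HeavyBall.IsSolution domF F y z ∧
      HeavyBall.bregman Θ ξ₀ z x₀ ≤ ((p.σ * ρ ^ 2 : ℝ) : EReal))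
    (L : ∀ i, X → X →L[ℝ] Y i)
    (hLcont : ∀ i, ContinuousOn (L i) (Metric.closedBall x₀ (2 * ρ)))
    (B₀ : ℝ) (hB₀ : 0 < B₀) (hLB : ∀ i, ∀ x ∈ Metric.closedBall x₀ (2 * ρ), ‖L i x‖ ≤ B₀)
    (hη : 0 ≤ p.η) (hη1 : p.η < 1)
    (htcc : ∀ i, ∀ x ∈ Metric.closedBall x₀ (2 * ρ), ∀ z ∈ Metric.closedBall x₀ (2 * ρ),
      ‖F i x - F i z - L i x (x - z)‖ ≤ p.η * ‖F i x - F i z‖)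
    -- the parameters of the method
    (hr : 1 < p.r) (hμ₀ : 0 < p.μ₀) (hμ₀σ : p.μ₀ < 4 * p.σ) (hμ₁ : 0 < p.μ₁)
    (hυ₀ : 0 < p.υ₀) (hυ₁ : 0 < p.υ₁) (hβ : 0 ≤ p.β) (hβ1 : p.β < 1)
    (hτ : (1 + p.η) / (1 - p.η) < p.τ)
    -- the random indices: independent and uniformly distributed
    {Ω : Type*} [MeasurableSpace Ω] (P : Measure Ω) [IsProbabilityMeasure P]
    (idx : ℕ → Ω → Fin N) (hidx : ∀ n, Measurable (idx n)) (hindep : iIndepFun idx P)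
    (hunif : ∀ n i, P {ω | idx n ω = i} = (N : ENNReal)⁻¹)
    -- the noisy data and the noise levels
    (yδ : ℕ → ∀ i, Y i) (δ : ℕ → Fin N → ℝ) (hδ : ∀ l i, 0 < δ l i)
    (hyδ : ∀ l i, ‖yδ l i - y i‖ ≤ δ l i)
    (hδ0 : Tendsto (fun l => ⨆ i, δ l i) atTop (𝓝 0))
    -- the stopped iterates `x_{n_l}` and `ξ_{n_l}` along the common sample path
    (xout ξout : ℕ → Ω → X)
    (hxout : ∀ l ω, xout l ω =
      (HeavyBall.output p Θ F L x₀ ξ₀ (yδ l) (δ l) (fun n => idx n ω)).x)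
    (hξout : ∀ l ω, ξout l ω =
      (HeavyBall.output p Θ F L x₀ ξ₀ (yδ l) (δ l) (fun n => idx n ω)).ξ) :
    -- the method terminates almost surely, and the minimal solution exists and is unique
    (∀ᵐ ω ∂P, ∀ l, HeavyBall.Terminates p Θ F L x₀ ξ₀ (yδ l) (δ l) (fun n => idx n ω)) ∧
    (∃! xdag, HeavyBall.IsMinimalSolution domF F y Θ x₀ ξ₀ xdag) ∧
    ∃ xstar : Ω → X,
      StronglyMeasurable xstar ∧
      (∀ ω, xstar ω ∈ Metric.closedBall x₀ (2 * ρ) ∧ xstar ω ∈ HeavyBall.effDom Θ ∧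
        HeavyBall.IsSolution domF F y (xstar ω)) ∧
      (∀ᵐ ω ∂P, Tendsto (fun l => ‖xout l ω - xstar ω‖) atTop (𝓝 0)) ∧
      (∀ᵐ ω ∂P, Tendsto (fun l => HeavyBall.bregman Θ (ξout l ω) (xstar ω) (xout l ω))
        atTop (𝓝 0)) ∧
      (∀ l, Integrable (fun ω => ‖xout l ω - xstar ω‖ ^ 2) P) ∧
      Tendsto (fun l => ∫ ω, ‖xout l ω - xstar ω‖ ^ 2 ∂P) atTop (𝓝 0) ∧
      (∀ l, Integrable
        (fun ω => (HeavyBall.bregman Θ (ξout l ω) (xstar ω) (xout l ω)).toReal) P) ∧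
      Tendsto (fun l => ∫ ω, (HeavyBall.bregman Θ (ξout l ω) (xstar ω) (xout l ω)).toReal ∂P)
        atTop (𝓝 0) ∧
      (∀ xdag, HeavyBall.IsMinimalSolution domF F y Θ x₀ ξ₀ xdag →
        (∀ i, ∀ x ∈ Metric.closedBall x₀ (2 * ρ),
          Set.range (HeavyBall.adj (L i x)) ⊆ closure (Set.range (HeavyBall.adj (L i xdag)))) →
        ∀ᵐ ω ∂P, xstar ω = xdag) := by
  have hsol' : ∃ z ∈ HeavyBall.effDom Θ, (∀ i, F i z = y i) ∧
      HeavyBall.bregR Θ ξ₀ z x₀ ≤ p.σ * ρ ^ 2 := by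
    obtain ⟨z, hz, hzs, hzρ⟩ := hsol
    rw [HeavyBall.bregman_eq_coe hproper hz hx₀] at hzρ
    exact ⟨z, hz, fun i => (hzs i).2, by exact_mod_cast hzρ⟩
  have H : HeavyBall.Problem p Θ x₀ ξ₀ F L y ρ B₀ :=
    ⟨hσ, hproper, hlsc, hconv, hΘσ, hx₀, hξ₀, hY, hρ, hsol', hLcont, hB₀, hLB, hη, hη1, htcc, hr,
      hμ₀, hμ₀σ, hμ₁, hυ₀, hυ₁, hβ, hβ1, hτ⟩
  obtain ⟨ω₀⟩ : Nonempty Ω := P.nonempty_of_neZero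
  have : Nonempty (Fin N) := ⟨idx 0 ω₀⟩
  have hδ0' : ∀ i, Tendsto (fun l => δ l i) atTop (𝓝 0) := fun i =>
    squeeze_zero (fun l => (hδ l i).le) (fun l => le_ciSup (Set.finite_range _).bddAbove i) hδ0
  have hterm : ∀ᵐ ω ∂P, ∀ l,
      HeavyBall.Terminates p Θ F L x₀ ξ₀ (yδ l) (δ l) (fun n => idx n ω) := by
    filter_upwards [HeavyBall.ae_frequently_eq hidx hindep hunif] with ω hω l
    exact H.terminates (hyδ l) (hδ l) hω
  have hfin := H.lintegral_totalRes_ne_top hidx hindep hunif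
  have hmeas := HeavyBall.measurable_totalRes (p := p) (Θ := Θ) (F := F) (L := L) (x₀ := x₀)
    (ξ₀ := ξ₀) (y := y) hidx
  have hae : ∀ᵐ ω ∂P, HeavyBall.totalRes p Θ F L x₀ ξ₀ y (fun n => idx n ω) ≠ ⊤ := by
    filter_upwards [ae_lt_top hmeas hfin] with ω hω using hω.ne
  obtain ⟨xstar, hsm, hxsol, hxstar⟩ := H.exists_random_limit (Ω := Ω) hidx
  obtain ⟨z₀, hz₀, -⟩ := H.exists_mem_solSet
  have hinv : ∀ l ω, HeavyBall.Inv p Θ x₀ ξ₀ F y ρ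
      (HeavyBall.output p Θ F L x₀ ξ₀ (yδ l) (δ l) (fun n => idx n ω)) := fun l ω =>
    H.inv_run (hyδ l) _
  have hxmem : ∀ l ω, xout l ω ∈ HeavyBall.effDom Θ := fun l ω => by
    rw [hxout]; exact (hinv l ω).mem
  have hξmem : ∀ l ω, ξout l ω ∈ HeavyBall.subdiff Θ (xout l ω) := fun l ω => by
    rw [hxout, hξout]; exact (hinv l ω).sub
  set D : ℕ → Ω → ℝ := fun l ω => HeavyBall.bregR Θ (ξout l ω) (xstar ω) (xout l ω) with hD
  have hbreg : ∀ l ω, HeavyBall.bregman Θ (ξout l ω) (xstar ω) (xout l ω) = ((D l ω : ℝ) : EReal) :=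
    fun l ω => HeavyBall.bregman_eq_coe hproper (hxsol ω).2.1 (hxmem l ω) _
  have hD0 : ∀ l ω, 0 ≤ D l ω := fun l ω =>
    H.bregR_nonneg (hxmem l ω) (hξmem l ω) (hxsol ω).2.1
  have hnorm : ∀ l ω, ‖xout l ω - xstar ω‖ ^ 2 ≤ D l ω / p.σ := fun l ω => by
    rw [le_div_iff₀ hσ, norm_sub_rev, mul_comm]
    exact H.le_bregR (hxmem l ω) (hξmem l ω) (hxsol ω).2.1
  have hDlim : ∀ᵐ ω ∂P, Tendsto (fun l => D l ω) atTop (𝓝 0) := by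
    filter_upwards [hterm, hae] with ω h1 h2
    simp only [hD, hxout, hξout]
    exact H.tendsto_bregR_output hyδ hδ0' h1 (hxsol ω) (hxstar ω h2).1
  have hsqlim : ∀ᵐ ω ∂P, Tendsto (fun l => ‖xout l ω - xstar ω‖ ^ 2) atTop (𝓝 0) := by
    filter_upwards [hDlim] with ω h
    exact squeeze_zero (fun _ => sq_nonneg _) (fun l => hnorm l ω) (by simpa using h.div_const p.σ)
  -- the integrable majorant: the initial Bregman distance to the random limit is controlled by the
  -- sum of the squared residuals, which has finite expectation
  set bound : Ω → ℝ := fun ω => HeavyBall.bregR Θ ξ₀ z₀ x₀ +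
    3 * p.μ₁ * (1 + p.η) / (1 - p.β) *
      (HeavyBall.totalRes p Θ F L x₀ ξ₀ y (fun n => idx n ω)).toReal with hbound
  have hbint : Integrable bound P := (integrable_const _).add
    ((integrable_toReal_of_lintegral_ne_top hmeas.aemeasurable hfin).const_mul _)
  have hDle : ∀ l, ∀ᵐ ω ∂P, D l ω ≤ bound ω := by
    intro l
    filter_upwards [hae] with ω h
    refine le_trans ?_ ((hxstar ω h).2.1 z₀ hz₀)
    simp only [hD, hxout, hξout]
    exact H.antitone_bregR_run (path := fun n => idx n ω) (hyδ l) (hxsol ω) (Nat.zero_le _)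
  borelize X
  have hxoutm : ∀ l, StronglyMeasurable (xout l) := fun l => by
    rw [funext (hxout l)]
    exact HeavyBall.stronglyMeasurable_output hidx HeavyBall.State.x
  have hξoutm : ∀ l, StronglyMeasurable (ξout l) := fun l => by
    rw [funext (hξout l)]
    exact HeavyBall.stronglyMeasurable_output hidx HeavyBall.State.ξ
  have hΘm : Measurable Θ := hlsc.measurable
  have hDm : ∀ l, AEStronglyMeasurable (D l) P := fun l =>
    (((hΘm.comp hsm.measurable).ereal_toReal.sub
      (hΘm.comp (hxoutm l).measurable).ereal_toReal).sub
        ((hξoutm l).inner (hsm.sub (hxoutm l))).measurable).aestronglyMeasurable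
  have hsqm : ∀ l, AEStronglyMeasurable (fun ω => ‖xout l ω - xstar ω‖ ^ 2) P := fun l =>
    (((hxoutm l).sub hsm).norm.pow 2).aestronglyMeasurable
  have hDnorm : ∀ l, ∀ᵐ ω ∂P, ‖D l ω‖ ≤ bound ω := fun l => by
    filter_upwards [hDle l] with ω h
    rwa [Real.norm_of_nonneg (hD0 l ω)]
  have hsqnorm : ∀ l, ∀ᵐ ω ∂P, ‖‖xout l ω - xstar ω‖ ^ 2‖ ≤ bound ω / p.σ := fun l => by
    filter_upwards [hDle l] with ω h
    rw [Real.norm_of_nonneg (sq_nonneg _)]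
    exact (hnorm l ω).trans (div_le_div_of_nonneg_right h hσ.le)
  refine ⟨hterm, H.existsUnique_isMinimalSolution hball, xstar, hsm,
    fun ω => ⟨(hxsol ω).1, (hxsol ω).2.1, fun i => ⟨hball i (hxsol ω).1, (hxsol ω).2.2 i⟩⟩,
    ?_, ?_, fun l => (hbint.div_const p.σ).mono' (hsqm l) (hsqnorm l), ?_, fun l => ?_, ?_, ?_⟩
  · filter_upwards [hsqlim] with ω h
    simpa [Real.sqrt_sq] using h.sqrt
  · filter_upwards [hDlim] with ω h
    simp only [hbreg]
    exact (continuous_coe_real_ereal.tendsto 0).comp h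
  · simpa using tendsto_integral_of_dominated_convergence _ hsqm (hbint.div_const p.σ) hsqnorm hsqlim
  · simp only [hbreg, EReal.toReal_coe]
    exact hbint.mono' (hDm l) (hDnorm l)
  · simp only [hbreg, EReal.toReal_coe]
    simpa using tendsto_integral_of_dominated_convergence _ hDm hbint hDnorm hDlim
  · intro xdag hdag hrange
    filter_upwards [hae] with ω h
    exact H.eq_of_range_condition hball (hxsol ω) (hxstar ω h).2.2 hdag hrange
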